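/- Let $M$ be a smooth (Hausdorff, second countable, finite-dimensional) manifold and let $\tau:E\to M$ be a Lie algebroid over $M$ of finite rank with anchor $\rho:E\to TM$. A curve $a$ in $E$ with base curve $\gamma=\tau\circ a$ is admissible if $\dot\gamma=\rho(a)$. For $k\ge 1$ let $E^k$ be the manifold of $(k-1)$-jets $[a]^{k-1}$ at $t=0$ of (smooth) admissible curves $a$ defined near $0$, and let $E^0=M$; let $\tau_{k,l}:E^k\to E^l$, $l\le k$, be the projections. The $E$-tangent $\mathcal{T}^EE^k\to E^k$ is the vector bundle with fibres $$\mathcal{T}^E_AE^k=\{(b,v)\in E_{\tau_{k,0}(A)}\times T_AE^k\mid \rho(b)=T\tau_{k,0}(v)\},$$ with its Lie algebroid structure, in which the anchor is $(b,v)\mapsto v$ and the bracket of projectable sections (those of the form $A\mapsto(\sigma(\tau_{k,0}(A)),X(A))$, with $\sigma$ a section of $E$ and $X$ a vector field on $E^k$) is given by the bracket of sections of $E$ and the bracket of vector fields on $E^k$; $d$ denotes its exterior differential. Let $\mathcal{T}\tau_{k,l}:\mathcal{T}^EE^k\to\mathcal{T}^EE^l$, $(b,v)\mapsto(b,T\tau_{k,l}(v))$.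 A smooth section $\lambda$ of $(\mathcal{T}^EE^k)^*$ (a 1-form) is called $\tau_{k,l}$-semibasic if it vanishes on $\ker\mathcal{T}\tau_{k,l}$. Let $\mathbf{T}$ be the section of $\mathcal{T}^EE^k$ along $\tau_{k+1,k}$ that maps the $k$-jet $[a]^k\in E^{k+1}$ of an admissible curve $a$ to the pair of $a(0)$ and the velocity at $t=0$ of the curve $t\mapsto[s\mapsto a(t+s)]^{k-1}$ in $E^k$ (for $k=0$ this is the curve $t\mapsto\tau(a(t))$ in $M$), and let $d_{\mathbf{T}}\lambda=d(i_{\mathbf{T}}\lambda)+i_{\mathbf{T}}(d\lambda)$ be the total time derivative, mapping 1-forms on $\mathcal{T}^EE^k$ to 1-forms on $\mathcal{T}^EE^{k+1}$. Then for every $k\ge0$ there is exactly one smooth field $S$ of endomorphisms of $\mathcal{T}^EE^k$ (the vertical endomorphism) whose dual action on 1-forms, $S(\lambda)=\lambda\circ S$, satisfies $S(d^r_{\mathbf{T}}\theta)=r\,d^{r-1}_{\mathbf{T}}\theta$ for all smooth sections $\theta$ of $E^*$ (regarded as 1-forms on $\mathcal{T}^EE^0=E$) and all $r=0,\dots,k$,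 where pullbacks to $\mathcal{T}^EE^k$ along $\mathcal{T}\tau_{k,r}$ and $\mathcal{T}\tau_{k,r-1}$ are understood and $S(\theta)=0$ for $r=0$; and the following hold. 1. For $0\le l\le k$, a smooth 1-form $\lambda$ on $\mathcal{T}^EE^k$ is $\tau_{k,l}$-semibasic if and only if $S^{l+1}(\lambda)=0$. 2. For $0\le l\le k$, the image of $S^l$ on the smooth 1-forms on $\mathcal{T}^EE^k$ is exactly the set of smooth $\tau_{k,k-l}$-semibasic 1-forms. 3. $S^{k+1}=0$. -/

import Mathlib

open Set Filter Topology Bundle Manifold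
open scoped ContDiff

/-! ### Total derivatives in coordinates -/

namespace JetCalculus

section

variable {EM F G : Type*} [NormedAddCommGroup EM] [NormedSpace ℝ EM]
  [NormedAddCommGroup F] [NormedSpace ℝ F] [NormedAddCommGroup G] [NormedSpace ℝ G]

/-- The total derivative of a function `f (x, y₀, …, yₙ)` along the differential equation
`x' = R (x, y₀)`, `yᵢ' = yᵢ₊₁`. -/
noncomputable def totalDeriv (R : EM × F → EM) {n : ℕ} (f : EM × (Fin (n + 1) → F) → G) :
    EM × (Fin (n + 2) → F) → G := fun p =>
  fderiv ℝ f (p.1, fun i => p.2 i.castSucc) (R (p.1, p.2 0), fun i => p.2 i.succ)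

/-- The `n`-fold iterated total derivative of a function `f (x, y₀)`. -/
noncomputable def totalDerivIter (R : EM × F → EM) (f : EM × F → G) :
    (n : ℕ) → EM × (Fin (n + 1) → F) → G
  | 0 => fun p => f (p.1, p.2 0)
  | n + 1 => totalDeriv R (totalDerivIter R f n)

theorem contDiffAt_iteratedDeriv {g : ℝ → G} {t : ℝ} (hg : ContDiffAt ℝ ∞ g t) (n : ℕ) :
    ContDiffAt ℝ ∞ (iteratedDeriv n g) t := by
  induction n with
  | zero => simpa using hg
  | succ n ih =>
    rw [iteratedDeriv_succ]
    exact (ih.fderiv_right (m := ∞) (by simp)).clm_apply contDiffAt_const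

theorem contDiffOn_totalDerivIter {R : EM × F → EM} {f : EM × F → G} {W : Set EM} (hW : IsOpen W)
    (hR : ContDiffOn ℝ ∞ R (W ×ˢ univ)) (hf : ContDiffOn ℝ ∞ f (W ×ˢ univ)) (n : ℕ) :
    ContDiffOn ℝ ∞ (totalDerivIter R f n) (W ×ˢ univ) := by
  induction n with
  | zero =>
    refine hf.comp (g := f) (f := fun p : EM × (Fin 1 → F) => (p.1, p.2 0)) ?_ ?_
    · exact ContDiff.contDiffOn (by fun_prop)
    · intro p hp; exact ⟨hp.1, mem_univ _⟩
  | succ n ih =>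
    have h1 : ContDiffOn ℝ ∞ (fderiv ℝ (totalDerivIter R f n)) (W ×ˢ univ) :=
      ih.fderiv_of_isOpen (hW.prod isOpen_univ) (by simp)
    have h2 : ContDiffOn ℝ ∞ (fun p : EM × (Fin (n + 2) → F) =>
        fderiv ℝ (totalDerivIter R f n) (p.1, fun i => p.2 i.castSucc)) (W ×ˢ univ) := by
      refine h1.comp (f := fun p : EM × (Fin (n + 2) → F) =>
        (p.1, fun i : Fin (n + 1) => p.2 i.castSucc)) ?_ ?_
      · exact ContDiff.contDiffOn (by fun_prop)
      · intro p hp; exact ⟨hp.1, mem_univ _⟩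
    have h3 : ContDiffOn ℝ ∞ (fun p : EM × (Fin (n + 2) → F) => R (p.1, p.2 0)) (W ×ˢ univ) := by
      refine hR.comp (f := fun p : EM × (Fin (n + 2) → F) => (p.1, p.2 0)) ?_ ?_
      · exact ContDiff.contDiffOn (by fun_prop)
      · intro p hp; exact ⟨hp.1, mem_univ _⟩
    refine h2.clm_apply (h3.prodMk ?_)
    exact ContDiff.contDiffOn (by fun_prop)

/-- Existence of a curve with prescribed initial position and prescribed derivatives. -/
theorem exists_curve [CompleteSpace EM] [CompleteSpace F] {R : EM × F → EM} {W : Set EM}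
    (hW : IsOpen W) (hR : ContDiffOn ℝ ∞ R (W ×ˢ univ)) {u : EM} (hu : u ∈ W) {k : ℕ}
    (y : Fin k → F) :
    ∃ c : ℝ → EM × F, (c 0).1 = u ∧
      (∀ i : Fin k, iteratedDeriv i (fun s => (c s).2) 0 = y i) ∧
      ∀ᶠ t in 𝓝 (0 : ℝ), ContDiffAt ℝ ∞ c t ∧
        HasDerivAt (fun s => (c s).1) (R (c t)) t ∧ (c t).1 ∈ W := by
  let sh : EM × (Fin (k + 1) → F) → (Fin (k + 1) → F) := fun p i =>
    if h : (i : ℕ) + 1 < k + 1 then p.2 ⟨i + 1, h⟩ else 0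
  let X : EM × (Fin (k + 1) → F) → EM × (Fin (k + 1) → F) := fun p => (R (p.1, p.2 0), sh p)
  have hsh : ContDiff ℝ ∞ sh := by
    refine contDiff_pi.2 fun i => ?_
    by_cases h : (i : ℕ) + 1 < k + 1
    · simp only [sh, h, dif_pos]; fun_prop
    · simp only [sh, h, dif_neg, not_false_eq_true]; fun_prop
  have hX : ContDiffOn ℝ ∞ X (W ×ˢ univ) := by
    refine ContDiffOn.prodMk ?_ hsh.contDiffOn
    refine hR.comp (f := fun p : EM × (Fin (k + 1) → F) => (p.1, p.2 0)) ?_ ?_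
    · exact ContDiff.contDiffOn (by fun_prop)
    · intro p hp; exact ⟨hp.1, mem_univ _⟩
  have hWo : IsOpen (W ×ˢ (univ : Set (Fin (k + 1) → F))) := hW.prod isOpen_univ
  let y' : Fin (k + 1) → F := fun i => if h : (i : ℕ) < k then y ⟨i, h⟩ else 0
  have hXat : ContDiffAt ℝ 1 X (u, y') :=
    ((hX.contDiffAt (hWo.mem_nhds ⟨hu, mem_univ _⟩))).of_le (by simp)
  obtain ⟨α, hα0, ε, hε, hα⟩ :=
    hXat.exists_forall_mem_closedBall_exists_eq_forall_mem_Ioo_hasDerivAt₀ 0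
  have hαd : ∀ᶠ t in 𝓝 (0 : ℝ), HasDerivAt α (X (α t)) t := by
    filter_upwards [Ioo_mem_nhds (a := 0 - ε) (b := 0 + ε) (by linarith) (by linarith)] with t ht
    exact hα t ht
  have hα0d : HasDerivAt α (X (α 0)) 0 := hαd.self_of_nhds
  have hαW : ∀ᶠ t in 𝓝 (0 : ℝ), α t ∈ W ×ˢ (univ : Set (Fin (k + 1) → F)) := by
    refine hα0d.continuousAt.eventually_mem ?_
    rw [hα0]
    exact hWo.mem_nhds ⟨hu, mem_univ _⟩
  have hαs : ∀ᶠ t in 𝓝 (0 : ℝ), ContDiffAt ℝ ∞ α t := by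
    obtain ⟨δ, hδ, hball⟩ := Metric.eventually_nhds_iff.1 (hαd.and hαW)
    have hI : ∀ t ∈ Icc (-(δ / 2)) (δ / 2), dist t 0 < δ := by
      intro t ht
      rw [Real.dist_eq, sub_zero, abs_lt]
      constructor <;> linarith [ht.1, ht.2]
    have key := ODE.contDiffOn_enat_Icc_of_hasDerivWithinAt (n := ⊤) (f := fun _ => X) (α := α)
      (tmin := -(δ / 2)) (tmax := δ / 2) (u := W ×ˢ univ)
      (hX.comp (f := fun q : ℝ × (EM × (Fin (k + 1) → F)) => q.2) contDiff_snd.contDiffOn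
        (fun q hq => hq.2))
      (fun t ht => ((hball (hI t ht)).1).hasDerivWithinAt)
      (fun t ht => (hball (hI t ht)).2)
    filter_upwards [Ioo_mem_nhds (a := -(δ / 2)) (b := δ / 2) (by linarith) (by linarith)]
      with t ht
    exact key.contDiffAt (Icc_mem_nhds ht.1 ht.2)
  have hit : ∀ j : ℕ, ∀ hj : j < k + 1, ∀ᶠ t in 𝓝 (0 : ℝ),
      iteratedDeriv j (fun s => (α s).2 0) t = (α t).2 ⟨j, hj⟩ := by
    intro j
    induction j with
    | zero =>
      intro hj
      filter_upwards with t
      rw [iteratedDeriv_zero]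
      rfl
    | succ j ih =>
      intro hj
      filter_upwards [(ih (by omega)).eventually_nhds, hαd] with t ht htd
      rw [iteratedDeriv_succ, Filter.EventuallyEq.deriv_eq ht]
      have h2 : HasDerivAt (fun s => (α s).2) (sh (α t)) t := htd.snd
      have h3 := (hasDerivAt_pi.1 h2) ⟨j, by omega⟩
      rw [h3.deriv]
      exact dif_pos hj
  refine ⟨fun t => ((α t).1, (α t).2 0), by simp [hα0], ?_, ?_⟩
  · intro i
    have := (hit i (by omega)).self_of_nhds
    simp only at this ⊢
    rw [this, hα0]
    simp [y']
  · filter_upwards [hαd, hαW, hαs] with t h1 h2 h3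
    refine ⟨?_, h1.fst, h2.1⟩
    exact h3.fst.prodMk ((contDiffAt_pi.1 h3.snd) 0)

theorem iteratedDeriv_comp_eq {R : EM × F → EM} {f : EM × F → G} {W : Set EM} (hW : IsOpen W)
    (hR : ContDiffOn ℝ ∞ R (W ×ˢ univ)) (hf : ContDiffOn ℝ ∞ f (W ×ˢ univ)) {c : ℝ → EM × F}
    {t₀ : ℝ} (hc : ∀ᶠ t in 𝓝 t₀, ContDiffAt ℝ ∞ c t ∧
      HasDerivAt (fun s => (c s).1) (R (c t)) t ∧ (c t).1 ∈ W) (n : ℕ) :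
    ∀ᶠ t in 𝓝 t₀, iteratedDeriv n (fun s => f (c s)) t =
      totalDerivIter R f n ((c t).1, fun i : Fin (n + 1) => iteratedDeriv i (fun s => (c s).2) t) := by
  induction n with
  | zero =>
    filter_upwards with t
    simp [totalDerivIter]
  | succ n ih =>
    filter_upwards [ih.eventually_nhds, hc] with t ht hct
    obtain ⟨hc1, hc2, hc3⟩ := hct
    rw [iteratedDeriv_succ, Filter.EventuallyEq.deriv_eq ht]
    have h2 : ContDiffAt ℝ ∞ (fun s => (c s).2) t := hc1.snd
    have hd : HasDerivAt (fun s => ((c s).1, fun i : Fin (n + 1) =>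
        iteratedDeriv i (fun s => (c s).2) s))
        (R (c t), fun i : Fin (n + 1) => iteratedDeriv (i + 1) (fun s => (c s).2) t) t := by
      refine hc2.prodMk (hasDerivAt_pi.2 fun i => ?_)
      rw [iteratedDeriv_succ]
      exact ((contDiffAt_iteratedDeriv h2 i).differentiableAt (by simp)).hasDerivAt
    have hdf : DifferentiableAt ℝ (totalDerivIter R f n)
        ((c t).1, fun i : Fin (n + 1) => iteratedDeriv i (fun s => (c s).2) t) :=
      ((contDiffOn_totalDerivIter hW hR hf n).contDiffAt
        ((hW.prod isOpen_univ).mem_nhds ⟨hc3, mem_univ _⟩)).differentiableAt (by simp)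
    exact (hdf.hasFDerivAt.comp_hasDerivAt t hd).deriv

end

end JetCalculus
set_option linter.unusedSectionVars false

/-! ### Lie algebroids -/

/-- The derivative `v(f)` of a real function `f` on a manifold along a tangent vector `v` at `p`. -/
noncomputable def tangentDeriv {EN HN N : Type*} [NormedAddCommGroup EN] [NormedSpace ℝ EN]
    [TopologicalSpace HN] (I : ModelWithCorners ℝ EN HN) [TopologicalSpace N] [ChartedSpace HN N]
    (f : N → ℝ) (p : N) : TangentSpace I p →ₗ[ℝ] ℝ :=
  (mfderiv I 𝓘(ℝ, ℝ) f p).toLinearMap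

section LieAlgebroid

variable (EM F : Type*) {M : Type*} (V : M → Type*)
  [NormedAddCommGroup EM] [NormedSpace ℝ EM]
  [NormedAddCommGroup F] [NormedSpace ℝ F]
  [TopologicalSpace M] [ChartedSpace EM M] [IsManifold 𝓘(ℝ, EM) ∞ M]
  [TopologicalSpace (TotalSpace F V)] [∀ x, TopologicalSpace (V x)] [FiberBundle F V]
  [∀ x, AddCommGroup (V x)] [∀ x, Module ℝ (V x)] [VectorBundle ℝ F V]
  [ContMDiffVectorBundle ∞ F V 𝓘(ℝ, EM)]

/-- A Lie algebroid structure on the smooth vector bundle `V → M` with typical fibre `F`, over the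
manifold `M` modelled on `EM`: a smooth vector bundle map `anchor : V → TM` over the identity and
a Lie bracket on the smooth sections of `V` satisfying the Leibniz rule
`[σ, f η] = (ρ(σ) f) η + f [σ, η]`. -/
structure LieAlgebroid where
  anchor : ∀ x, V x →ₗ[ℝ] TangentSpace 𝓘(ℝ, EM) x
  contMDiff_anchor : ContMDiff (𝓘(ℝ, EM).prod 𝓘(ℝ, F)) 𝓘(ℝ, EM).tangent ∞
    (fun p : TotalSpace F V => (⟨p.proj, anchor p.proj p.snd⟩ : TangentBundle 𝓘(ℝ, EM) M))
  bracket : Cₛ^∞⟮𝓘(ℝ, EM); F, V⟯ → Cₛ^∞⟮𝓘(ℝ, EM); F, V⟯ → Cₛ^∞⟮𝓘(ℝ, EM); F, V⟯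
  bracket_add_left : ∀ σ₁ σ₂ η, bracket (σ₁ + σ₂) η = bracket σ₁ η + bracket σ₂ η
  bracket_add_right : ∀ σ η₁ η₂, bracket σ (η₁ + η₂) = bracket σ η₁ + bracket σ η₂
  bracket_self : ∀ σ, bracket σ σ = 0
  jacobi : ∀ σ η ζ,
    bracket σ (bracket η ζ) + bracket η (bracket ζ σ) + bracket ζ (bracket σ η) = 0
  leibniz : ∀ (f : M → ℝ), ContMDiff 𝓘(ℝ, EM) 𝓘(ℝ, ℝ) ∞ f →
    ∀ σ η fη : Cₛ^∞⟮𝓘(ℝ, EM); F, V⟯, (∀ x, fη x = f x • η x) →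
    ∀ x, bracket σ fη x =
      tangentDeriv 𝓘(ℝ, EM) f x (anchor x (σ x)) • η x + f x • bracket σ η x

end LieAlgebroid

namespace LieAlgebroid

section

variable {EM F : Type*} {M : Type*} {V : M → Type*}
  [NormedAddCommGroup EM] [NormedSpace ℝ EM]
  [NormedAddCommGroup F] [NormedSpace ℝ F]
  [TopologicalSpace M] [ChartedSpace EM M] [IsManifold 𝓘(ℝ, EM) ∞ M]
  [TopologicalSpace (TotalSpace F V)] [∀ x, TopologicalSpace (V x)] [FiberBundle F V]
  [∀ x, AddCommGroup (V x)] [∀ x, Module ℝ (V x)] [VectorBundle ℝ F V]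
  [ContMDiffVectorBundle ∞ F V 𝓘(ℝ, EM)]
  (𝒜 : LieAlgebroid EM F V)

/-! ### Admissible curves and their jets -/

/-- The curve `a` in the total space of the bundle is smooth at time `t`, and its base curve `γ`
satisfies `γ'(t) = ρ(a(t))`. -/
def IsAdmissibleAt (a : ℝ → TotalSpace F V) (t : ℝ) : Prop :=
  ContMDiffAt 𝓘(ℝ, ℝ) (𝓘(ℝ, EM).prod 𝓘(ℝ, F)) ∞ a t ∧
  HasMFDerivAt 𝓘(ℝ, ℝ) 𝓘(ℝ, EM) (fun s => (a s).proj) t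
    ((1 : ℝ →L[ℝ] ℝ).smulRight (𝒜.anchor (a t).proj (a t).snd))

/-- Admissible curves over `x`: curves `a` in the total space of the bundle, admissible on some
open interval around `0` (outside of it, the values of `a` are irrelevant), whose base curve is at
`x` at time `0`. -/
structure EPath (x : M) where
  toFun : ℝ → TotalSpace F V
  proj_zero : (toFun 0).proj = x
  admissible : ∀ᶠ t in 𝓝 (0 : ℝ), 𝒜.IsAdmissibleAt toFun t

/-- The chart of the manifold given by the total space of the bundle which is associated to the
preferred chart of `M` and the preferred local trivialization of the bundle at `x₀`. -/
noncomputable def bundleChart (_ : LieAlgebroid EM F V) (x₀ : M) :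
    PartialEquiv (TotalSpace F V) (EM × F) :=
  extChartAt (𝓘(ℝ, EM).prod 𝓘(ℝ, F)) (⟨x₀, 0⟩ : TotalSpace F V)

/-- The domain in `M` of the local coordinates at `x₀`. -/
def dom (_ : LieAlgebroid EM F V) (x₀ : M) : Set M :=
  (chartAt EM x₀).source ∩ (trivializationAt F V x₀).baseSet

theorem mem_dom (x₀ : M) : x₀ ∈ 𝒜.dom x₀ :=
  ⟨mem_chart_source EM x₀, mem_baseSet_trivializationAt F V x₀⟩

theorem isOpen_dom (x₀ : M) : IsOpen (𝒜.dom x₀) :=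
  (chartAt EM x₀).open_source.inter (trivializationAt F V x₀).open_baseSet

/-- Two admissible curves over `x` have the same `(k-1)`-jet at `0`: the derivatives of order `< k`
of their coordinate expressions agree. (For `k = 0` the only datum is the base point `x`.) -/
def jetSetoid (k : ℕ) (x : M) : Setoid (𝒜.EPath x) where
  r a b := ∀ j < k, iteratedDeriv j (fun t => 𝒜.bundleChart x (a.toFun t)) 0 =
    iteratedDeriv j (fun t => 𝒜.bundleChart x (b.toFun t)) 0
  iseqv := ⟨fun _ _ _ => rfl, fun h j hj => (h j hj).symm,
    fun h h' j hj => (h j hj).trans (h' j hj)⟩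

/-- The set `Eᵏ` of `(k-1)`-jets of admissible curves, presented as pairs of a base point in `M`
and a jet of an admissible curve over this base point. For `k = 0`, this is `M`. -/
structure JetSpace (k : ℕ) where
  base : M
  jet : Quotient (𝒜.jetSetoid k base)

variable {𝒜} in
/-- The `(k-1)`-jet at `0` of an admissible curve. -/
def EPath.toJet {x : M} (a : 𝒜.EPath x) (k : ℕ) : 𝒜.JetSpace k :=
  ⟨x, Quotient.mk _ a⟩

theorem bundleChart_source (x₀ : M) :
    (𝒜.bundleChart x₀).source = {p | p.proj ∈ 𝒜.dom x₀} := by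
  ext p
  simp only [bundleChart, FiberBundle.extChartAt, dom]
  simp only [PartialEquiv.trans_source, PartialEquiv.prod_source, PartialEquiv.refl_source,
    mem_inter_iff, mem_preimage, mem_prod, mem_univ, and_true, mem_ofPred_eq, extChartAt_source]
  have key : p.proj ∈ (trivializationAt F V x₀).baseSet →
      ((trivializationAt F V x₀).toPartialEquiv p).1 = p.proj := fun h =>
    Trivialization.coe_fst' _ h
  constructor
  · rintro ⟨h1, h2⟩
    have h3 := (Trivialization.mem_source _).1 h1
    exact ⟨key h3 ▸ h2, h3⟩
  · rintro ⟨h1, h2⟩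
    exact ⟨(Trivialization.mem_source _).2 h2, (key h2).symm ▸ h1⟩

theorem bundleChart_fst (x₀ : M) {p : TotalSpace F V} (hp : p.proj ∈ 𝒜.dom x₀) :
    (𝒜.bundleChart x₀ p).1 = chartAt EM x₀ p.proj := by
  simp only [bundleChart, FiberBundle.extChartAt]
  simp [Trivialization.coe_fst' _ hp.2]

/-- The image of the coordinate domain at `x₀` in the model space. -/
def cdom (x₀ : M) : Set EM :=
  (chartAt EM x₀).target ∩ (chartAt EM x₀).symm ⁻¹' 𝒜.dom x₀

theorem isOpen_cdom (x₀ : M) : IsOpen (𝒜.cdom x₀) :=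
  (chartAt EM x₀).isOpen_inter_preimage_symm (𝒜.isOpen_dom x₀)

theorem bundleChart_target (x₀ : M) :
    (𝒜.bundleChart x₀).target = 𝒜.cdom x₀ ×ˢ univ := by
  rw [bundleChart, FiberBundle.extChartAt_target]
  ext p
  simp only [cdom, dom, mem_prod, mem_inter_iff, mem_preimage]
  simp
  intro h _
  exact (chartAt EM x₀).map_target h

theorem chart_mem_cdom {x₀ x : M} (hx : x ∈ 𝒜.dom x₀) : chartAt EM x₀ x ∈ 𝒜.cdom x₀ :=
  ⟨(chartAt EM x₀).map_source hx.1, by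
    rw [mem_preimage, (chartAt EM x₀).left_inv hx.1]; exact hx⟩

/-- The anchor in the local coordinates at `x₀`. -/
noncomputable def localAnchor (x₀ : M) (p : EM × F) : EM :=
  (extChartAt 𝓘(ℝ, EM).tangent (⟨x₀, 0⟩ : TangentBundle 𝓘(ℝ, EM) M)
    ⟨((𝒜.bundleChart x₀).symm p).proj,
      𝒜.anchor ((𝒜.bundleChart x₀).symm p).proj ((𝒜.bundleChart x₀).symm p).snd⟩).2

theorem symm_proj_mem_dom {x₀ : M} {p : EM × F} (hp : p.1 ∈ 𝒜.cdom x₀) :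
    ((𝒜.bundleChart x₀).symm p).proj ∈ 𝒜.dom x₀ := by
  have h := (𝒜.bundleChart x₀).map_target (x := p) (by
    rw [bundleChart_target]; exact ⟨hp, mem_univ _⟩)
  rw [bundleChart_source] at h
  exact h

theorem contMDiffOn_bundleChart (x₀ : M) :
    ContMDiffOn (𝓘(ℝ, EM).prod 𝓘(ℝ, F)) 𝓘(ℝ, EM × F) ∞ (𝒜.bundleChart x₀)
      {p | p.proj ∈ 𝒜.dom x₀} := by
  rw [← bundleChart_source]
  have := contMDiffOn_extChartAt (I := 𝓘(ℝ, EM).prod 𝓘(ℝ, F)) (n := ∞)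
    (x := (⟨x₀, 0⟩ : TotalSpace F V))
  rwa [← extChartAt_source (𝓘(ℝ, EM).prod 𝓘(ℝ, F))] at this

theorem contMDiffOn_bundleChart_symm (x₀ : M) :
    ContMDiffOn 𝓘(ℝ, EM × F) (𝓘(ℝ, EM).prod 𝓘(ℝ, F)) ∞ (𝒜.bundleChart x₀).symm
      (𝒜.cdom x₀ ×ˢ univ) := by
  rw [← bundleChart_target]
  exact contMDiffOn_extChartAt_symm (I := 𝓘(ℝ, EM).prod 𝓘(ℝ, F)) (n := ∞)
    (⟨x₀, 0⟩ : TotalSpace F V)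

theorem contDiffOn_localAnchor (x₀ : M) :
    ContDiffOn ℝ ∞ (𝒜.localAnchor x₀) (𝒜.cdom x₀ ×ˢ univ) := by
  rw [← contMDiffOn_iff_contDiffOn]
  have h1 := 𝒜.contMDiff_anchor.comp_contMDiffOn (𝒜.contMDiffOn_bundleChart_symm x₀)
  have h2 := contMDiffOn_extChartAt (I := 𝓘(ℝ, EM).tangent) (n := ∞)
    (x := (⟨x₀, 0⟩ : TangentBundle 𝓘(ℝ, EM) M))
  have h3 := h2.comp h1 (by
    intro p hp
    rw [mem_preimage, TangentBundle.mem_chart_source_iff]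
    exact (𝒜.symm_proj_mem_dom hp.1).1)
  exact (contDiff_snd (n := ∞) (𝕜 := ℝ) (E := EM) (F := EM)).contMDiff.comp_contMDiffOn h3

theorem localAnchor_apply {x₀ : M} {p : TotalSpace F V} (hp : p.proj ∈ 𝒜.dom x₀) :
    𝒜.localAnchor x₀ (𝒜.bundleChart x₀ p) =
      mfderiv 𝓘(ℝ, EM) 𝓘(ℝ, EM) (chartAt EM x₀) p.proj (𝒜.anchor p.proj p.snd) := by
  have h1 : (𝒜.bundleChart x₀).symm (𝒜.bundleChart x₀ p) = p :=
    (𝒜.bundleChart x₀).left_inv (by rw [bundleChart_source]; exact hp)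
  rw [localAnchor, h1, mfderiv_chartAt_eq_tangentCoordChange hp.1, FiberBundle.extChartAt]
  simp [TangentBundle.trivializationAt_apply]
  rfl

variable {𝒜}

theorem IsAdmissibleAt.coord {a : ℝ → TotalSpace F V} {t : ℝ} (h : 𝒜.IsAdmissibleAt a t) {x₀ : M}
    (ht : (a t).proj ∈ 𝒜.dom x₀) :
    ContDiffAt ℝ ∞ (fun s => 𝒜.bundleChart x₀ (a s)) t ∧
      HasDerivAt (fun s => (𝒜.bundleChart x₀ (a s)).1)
        (𝒜.localAnchor x₀ (𝒜.bundleChart x₀ (a t))) t ∧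
      (𝒜.bundleChart x₀ (a t)).1 ∈ 𝒜.cdom x₀ := by
  obtain ⟨h1, h2⟩ := h
  have hop : IsOpen {p : TotalSpace F V | p.proj ∈ 𝒜.dom x₀} :=
    (𝒜.isOpen_dom x₀).preimage (FiberBundle.continuous_proj F V)
  refine ⟨?_, ?_, ?_⟩
  · rw [← contMDiffAt_iff_contDiffAt]
    exact ((𝒜.contMDiffOn_bundleChart x₀).contMDiffAt (hop.mem_nhds ht)).comp t h1
  · rw [𝒜.localAnchor_apply ht]
    have h3 := (hasMFDerivAt_extChartAt (I := 𝓘(ℝ, EM)) ht.1).comp t h2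
    let L : ℝ →L[ℝ] EM := (mfderiv 𝓘(ℝ, EM) 𝓘(ℝ, EM) (chartAt EM x₀) (a t).proj).comp
      ((1 : ℝ →L[ℝ] ℝ).smulRight (𝒜.anchor (a t).proj (a t).snd))
    have h4 : HasFDerivAt (fun s => chartAt EM x₀ (a s).proj) L t := h3.hasFDerivAt
    have h5 := h4.hasDerivAt
    have hev : (fun s => (𝒜.bundleChart x₀ (a s)).1) =ᶠ[𝓝 t] fun s => chartAt EM x₀ (a s).proj := by
      filter_upwards [h1.continuousAt.eventually_mem (hop.mem_nhds ht)] with s hs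
      exact 𝒜.bundleChart_fst x₀ hs
    refine HasDerivAt.congr_of_eventuallyEq ?_ hev
    have hL : L 1 = mfderiv 𝓘(ℝ, EM) 𝓘(ℝ, EM) (chartAt EM x₀) (a t).proj
        (𝒜.anchor (a t).proj (a t).snd) := by
      show mfderiv 𝓘(ℝ, EM) 𝓘(ℝ, EM) (chartAt EM x₀) (a t).proj
        ((1 : ℝ) • (𝒜.anchor (a t).proj (a t).snd)) = _
      rw [one_smul]
    rw [← hL]
    exact h5
  · rw [𝒜.bundleChart_fst x₀ ht]
    exact 𝒜.chart_mem_cdom ht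

variable (𝒜)

/-- The part of the coordinate domain at `x₀` on which the coordinates at `x₁` are defined. -/
def cdom₂ (x₀ x₁ : M) : Set EM := 𝒜.cdom x₀ ∩ (chartAt EM x₀).symm ⁻¹' 𝒜.dom x₁

theorem isOpen_cdom₂ (x₀ x₁ : M) : IsOpen (𝒜.cdom₂ x₀ x₁) := by
  have : 𝒜.cdom₂ x₀ x₁ =
      (chartAt EM x₀).target ∩ (chartAt EM x₀).symm ⁻¹' (𝒜.dom x₀ ∩ 𝒜.dom x₁) := by
    ext u; simp [cdom₂, cdom, and_assoc]
  rw [this]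
  exact (chartAt EM x₀).isOpen_inter_preimage_symm ((𝒜.isOpen_dom x₀).inter (𝒜.isOpen_dom x₁))

theorem cdom₂_subset (x₀ x₁ : M) : 𝒜.cdom₂ x₀ x₁ ⊆ 𝒜.cdom x₀ := inter_subset_left

theorem bundleChart_symm_proj {x₀ : M} {p : EM × F} (hp : p.1 ∈ 𝒜.cdom x₀) :
    ((𝒜.bundleChart x₀).symm p).proj = (chartAt EM x₀).symm p.1 := by
  have h1 := 𝒜.symm_proj_mem_dom hp
  have h2 := 𝒜.bundleChart_fst x₀ h1
  rw [(𝒜.bundleChart x₀).right_inv (by rw [bundleChart_target]; exact ⟨hp, mem_univ _⟩)] at h2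
  rw [h2, (chartAt EM x₀).left_inv h1.1]

/-- The change of coordinates on the total space of the bundle. -/
noncomputable def coordChange (x₀ x₁ : M) (p : EM × F) : EM × F :=
  𝒜.bundleChart x₁ ((𝒜.bundleChart x₀).symm p)

theorem contDiffOn_coordChange (x₀ x₁ : M) :
    ContDiffOn ℝ ∞ (𝒜.coordChange x₀ x₁) (𝒜.cdom₂ x₀ x₁ ×ˢ univ) := by
  rw [← contMDiffOn_iff_contDiffOn]
  refine (𝒜.contMDiffOn_bundleChart x₁).comp ((𝒜.contMDiffOn_bundleChart_symm x₀).mono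
    (prod_mono (𝒜.cdom₂_subset x₀ x₁) subset_rfl)) ?_
  intro p hp
  show ((𝒜.bundleChart x₀).symm p).proj ∈ 𝒜.dom x₁
  rw [𝒜.bundleChart_symm_proj hp.1.1]
  exact hp.1.2

variable {𝒜}

theorem EPath.eventually_mem {x : M} (a : 𝒜.EPath x) {U : Set M} (hU : IsOpen U) (hx : x ∈ U) :
    ∀ᶠ t in 𝓝 (0 : ℝ), (a.toFun t).proj ∈ U := by
  have h1 := a.admissible.self_of_nhds.1.continuousAt
  have h2 : ContinuousAt (fun t => (a.toFun t).proj) 0 :=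
    (FiberBundle.continuous_proj F V).continuousAt.comp h1
  exact h2.eventually_mem (by rw [a.proj_zero]; exact hU.mem_nhds hx)

/-- The derivatives at `0` of the fibre coordinates of `a` at `x₀`. -/
noncomputable def EPath.fib {x : M} (a : 𝒜.EPath x) (x₀ : M) (i : ℕ) : F :=
  iteratedDeriv i (fun t => (𝒜.bundleChart x₀ (a.toFun t)).2) 0

theorem EPath.iteratedDeriv_coord {x : M} (a : 𝒜.EPath x) {x₀ x₁ : M} (h₀ : x ∈ 𝒜.dom x₀)
    (h₁ : x ∈ 𝒜.dom x₁) (j : ℕ) :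
    iteratedDeriv j (fun t => 𝒜.bundleChart x₁ (a.toFun t)) 0 =
      JetCalculus.totalDerivIter (𝒜.localAnchor x₀) (𝒜.coordChange x₀ x₁) j
        (chartAt EM x₀ x, fun i : Fin (j + 1) => a.fib x₀ i) := by
  have hadm : ∀ᶠ t in 𝓝 (0 : ℝ), ContDiffAt ℝ ∞ (fun s => 𝒜.bundleChart x₀ (a.toFun s)) t ∧
      HasDerivAt (fun s => (𝒜.bundleChart x₀ (a.toFun s)).1)
        (𝒜.localAnchor x₀ (𝒜.bundleChart x₀ (a.toFun t))) t ∧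
      (𝒜.bundleChart x₀ (a.toFun t)).1 ∈ 𝒜.cdom₂ x₀ x₁ := by
    filter_upwards [a.admissible, a.eventually_mem (𝒜.isOpen_dom x₀) h₀,
      a.eventually_mem (𝒜.isOpen_dom x₁) h₁] with t ht1 ht2 ht3
    obtain ⟨h1, h2, h3⟩ := ht1.coord ht2
    refine ⟨h1, h2, h3, ?_⟩
    rw [mem_preimage, 𝒜.bundleChart_fst x₀ ht2, (chartAt EM x₀).left_inv ht2.1]
    exact ht3
  have key := (JetCalculus.iteratedDeriv_comp_eq (𝒜.isOpen_cdom₂ x₀ x₁)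
    ((𝒜.contDiffOn_localAnchor x₀).mono (prod_mono (𝒜.cdom₂_subset x₀ x₁) subset_rfl))
    (𝒜.contDiffOn_coordChange x₀ x₁) hadm j).self_of_nhds
  have h0 : (𝒜.bundleChart x₀ (a.toFun 0)).1 = chartAt EM x₀ x := by
    rw [𝒜.bundleChart_fst x₀ (by rw [a.proj_zero]; exact h₀), a.proj_zero]
  rw [h0] at key
  refine Eq.trans ?_ key
  refine Filter.EventuallyEq.iteratedDeriv_eq j ?_
  filter_upwards [a.eventually_mem (𝒜.isOpen_dom x₀) h₀] with t ht
  rw [coordChange, (𝒜.bundleChart x₀).left_inv (by rw [bundleChart_source]; exact ht)]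

theorem EPath.fib_eq_snd {x : M} (a : 𝒜.EPath x) {x₀ : M} (h₀ : x ∈ 𝒜.dom x₀) (j : ℕ) :
    a.fib x₀ j = (iteratedDeriv j (fun t => 𝒜.bundleChart x₀ (a.toFun t)) 0).2 := by
  have h : ∀ j : ℕ, ∀ᶠ t in 𝓝 (0 : ℝ),
      iteratedDeriv j (fun t => (𝒜.bundleChart x₀ (a.toFun t)).2) t =
        (iteratedDeriv j (fun t => 𝒜.bundleChart x₀ (a.toFun t)) t).2 := by
    intro j
    induction j with
    | zero => filter_upwards with t; simp
    | succ j ih =>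
      filter_upwards [ih.eventually_nhds, a.admissible,
        a.eventually_mem (𝒜.isOpen_dom x₀) h₀] with t h1 h2 h3
      rw [iteratedDeriv_succ, iteratedDeriv_succ, Filter.EventuallyEq.deriv_eq h1]
      have h4 : HasDerivAt
          (fun s => (iteratedDeriv j (fun t => 𝒜.bundleChart x₀ (a.toFun t)) s).2)
          (deriv (iteratedDeriv j (fun t => 𝒜.bundleChart x₀ (a.toFun t))) t).2 t :=
        ((JetCalculus.contDiffAt_iteratedDeriv (h2.coord h3).1 j).differentiableAt
          (by simp)).hasDerivAt.snd
      exact h4.deriv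
  exact (h j).self_of_nhds

theorem EPath.rel_iff {x : M} (a b : 𝒜.EPath x) {x₀ : M} (h₀ : x ∈ 𝒜.dom x₀) (k : ℕ) :
    (𝒜.jetSetoid k x).r a b ↔ ∀ j < k, a.fib x₀ j = b.fib x₀ j := by
  constructor
  · intro h j hj
    have hfib : ∀ i < k, a.fib x i = b.fib x i := fun i hi => by
      rw [a.fib_eq_snd (𝒜.mem_dom x), b.fib_eq_snd (𝒜.mem_dom x), h i hi]
    rw [a.fib_eq_snd h₀, b.fib_eq_snd h₀, a.iteratedDeriv_coord (𝒜.mem_dom x) h₀,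
      b.iteratedDeriv_coord (𝒜.mem_dom x) h₀]
    have : (fun i : Fin (j + 1) => a.fib x i) = fun i : Fin (j + 1) => b.fib x i := by
      funext i; exact hfib i (by omega)
    rw [this]
  · intro h j hj
    rw [a.iteratedDeriv_coord h₀ (𝒜.mem_dom x), b.iteratedDeriv_coord h₀ (𝒜.mem_dom x)]
    have : (fun i : Fin (j + 1) => a.fib x₀ i) = fun i : Fin (j + 1) => b.fib x₀ i := by
      funext i; exact h i (by omega)
    rw [this]

/-- Existence of admissible curves with prescribed base point and prescribed derivatives of the
fibre coordinates. -/
theorem exists_epath [CompleteSpace EM] [CompleteSpace F] {x₀ x : M} (hx : x ∈ 𝒜.dom x₀) {k : ℕ}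
    (y : Fin k → F) : ∃ a : 𝒜.EPath x, ∀ i : Fin k, a.fib x₀ i = y i := by
  obtain ⟨c, hc0, hcy, hc⟩ := JetCalculus.exists_curve (𝒜.isOpen_cdom x₀)
    (𝒜.contDiffOn_localAnchor x₀) (𝒜.chart_mem_cdom hx) y
  have hop : IsOpen (𝒜.cdom x₀ ×ˢ (univ : Set F)) := (𝒜.isOpen_cdom x₀).prod isOpen_univ
  have hright : ∀ t, (c t).1 ∈ 𝒜.cdom x₀ →
      𝒜.bundleChart x₀ ((𝒜.bundleChart x₀).symm (c t)) = c t := fun t ht =>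
    (𝒜.bundleChart x₀).right_inv (by rw [bundleChart_target]; exact ⟨ht, mem_univ _⟩)
  have hc0' : (c 0).1 ∈ 𝒜.cdom x₀ := hc.self_of_nhds.2.2
  refine ⟨⟨fun t => (𝒜.bundleChart x₀).symm (c t), ?_, ?_⟩, ?_⟩
  · rw [𝒜.bundleChart_symm_proj hc0', hc0, (chartAt EM x₀).left_inv hx.1]
  · filter_upwards [hc.eventually_nhds] with t ht
    obtain ⟨h1, h2, h3⟩ := ht.self_of_nhds
    have hsm : ContMDiffAt 𝓘(ℝ, ℝ) (𝓘(ℝ, EM).prod 𝓘(ℝ, F)) ∞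
        (fun t => (𝒜.bundleChart x₀).symm (c t)) t :=
      ((𝒜.contMDiffOn_bundleChart_symm x₀).contMDiffAt
        (hop.mem_nhds ⟨h3, mem_univ _⟩)).comp t h1.contMDiffAt
    refine ⟨hsm, ?_⟩
    have hbase : ContMDiffAt 𝓘(ℝ, ℝ) 𝓘(ℝ, EM) ∞
        (fun s => ((𝒜.bundleChart x₀).symm (c s)).proj) t :=
      (contMDiff_proj V).contMDiffAt.comp t hsm
    have hb := (hbase.mdifferentiableAt (by simp)).hasMFDerivAt
    have hmem := 𝒜.symm_proj_mem_dom h3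
    have h4 := (hasMFDerivAt_extChartAt (I := 𝓘(ℝ, EM)) hmem.1).comp t hb
    let γ' := mfderiv 𝓘(ℝ, ℝ) 𝓘(ℝ, EM) (fun s => ((𝒜.bundleChart x₀).symm (c s)).proj) t
    let D := mfderiv 𝓘(ℝ, EM) 𝓘(ℝ, EM) (chartAt EM x₀) ((𝒜.bundleChart x₀).symm (c t)).proj
    let L : ℝ →L[ℝ] EM := D.comp γ'
    have h5 : HasFDerivAt (fun s => chartAt EM x₀ ((𝒜.bundleChart x₀).symm (c s)).proj) L t :=
      h4.hasFDerivAt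
    have hev : (fun s => chartAt EM x₀ ((𝒜.bundleChart x₀).symm (c s)).proj) =ᶠ[𝓝 t]
        fun s => (c s).1 := by
      filter_upwards [ht] with s hs
      rw [← 𝒜.bundleChart_fst x₀ (𝒜.symm_proj_mem_dom hs.2.2), hright s hs.2.2]
    have h6 : L 1 = 𝒜.localAnchor x₀ (c t) := by
      have := (h5.hasDerivAt.congr_of_eventuallyEq hev.symm).unique h2
      exact this
    have h7 : D (γ' (1 : ℝ)) = D (𝒜.anchor _ ((𝒜.bundleChart x₀).symm (c t)).snd) := by
      rw [← 𝒜.localAnchor_apply hmem, hright t h3]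
      exact h6
    have hinj : Function.Injective D := by
      have := isInvertible_mfderiv_extChartAt (I := 𝓘(ℝ, EM)) (x := x₀)
        (y := ((𝒜.bundleChart x₀).symm (c t)).proj) (by simpa using hmem.1)
      exact this.injective
    have h8 := hinj h7
    refine hb.congr_mfderiv ?_
    refine ContinuousLinearMap.ext fun (r : ℝ) => ?_
    have hr : r = r • (1 : ℝ) := by simp
    show γ' r = r • _
    rw [← h8]
    conv_lhs => rw [hr]
    exact γ'.map_smul r (1 : ℝ)
  · intro i
    rw [← hcy i]
    refine Filter.EventuallyEq.iteratedDeriv_eq i ?_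
    filter_upwards [hc] with t ht
    rw [hright t ht.2.2]

variable (𝒜)

/-- The local coordinates `(x, y₁, …, y_k)` on `Eᵏ` at `x₀`: the coordinates of the base point
and the derivatives of order `0, …, k - 1` of the fibre coordinates. -/
noncomputable def jetCoord (k : ℕ) (x₀ : M) (A : 𝒜.JetSpace k) : EM × (Fin k → F) :=
  (chartAt EM x₀ A.base, fun i => A.jet.out.fib x₀ i)

variable {𝒜}

theorem jetCoord_mk {k : ℕ} {x₀ x : M} (hx : x ∈ 𝒜.dom x₀) (a : 𝒜.EPath x) :
    𝒜.jetCoord k x₀ (a.toJet k) =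
      (chartAt EM x₀ x, fun i : Fin k => a.fib x₀ i) := by
  have h : (𝒜.jetSetoid k x).r (Quotient.mk (𝒜.jetSetoid k x) a).out a := Quotient.mk_out a
  have h' := (EPath.rel_iff _ _ hx k).1 h
  simp only [jetCoord, EPath.toJet]
  congr 1
  funext i
  exact h' i i.2

variable (𝒜)

/-- The domain in `Eᵏ` of the local coordinates at `x₀`. -/
def jetDom (k : ℕ) (x₀ : M) : Set (𝒜.JetSpace k) := {A | A.base ∈ 𝒜.dom x₀}

theorem injOn_jetCoord (k : ℕ) (x₀ : M) : InjOn (𝒜.jetCoord k x₀) (𝒜.jetDom k x₀) := by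
  rintro ⟨x, A⟩ hA ⟨x', B⟩ hB h
  have h1 : x = x' := (chartAt EM x₀).injOn hA.1 hB.1 (congrArg Prod.fst h)
  subst h1
  induction A using Quotient.inductionOn with | _ a
  induction B using Quotient.inductionOn with | _ b
  have hx : x ∈ 𝒜.dom x₀ := hA
  have h : 𝒜.jetCoord k x₀ (a.toJet k) = 𝒜.jetCoord k x₀ (b.toJet k) := h
  rw [jetCoord_mk hx, jetCoord_mk hx] at h
  have h2 := congrArg Prod.snd h
  have : (Quotient.mk (𝒜.jetSetoid k x) a) = Quotient.mk _ b :=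
    Quotient.sound ((EPath.rel_iff a b hx k).2 fun j hj => congrFun h2 ⟨j, hj⟩)
  rw [this]

variable [FiniteDimensional ℝ EM] [FiniteDimensional ℝ F]

theorem bijOn_jetCoord (k : ℕ) (x₀ : M) :
    BijOn (𝒜.jetCoord k x₀) (𝒜.jetDom k x₀) (𝒜.cdom x₀ ×ˢ univ) := by
  have : CompleteSpace EM := FiniteDimensional.complete ℝ EM
  have : CompleteSpace F := FiniteDimensional.complete ℝ F
  refine ⟨?_, 𝒜.injOn_jetCoord k x₀, ?_⟩
  · intro A hA
    exact ⟨𝒜.chart_mem_cdom hA, mem_univ _⟩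
  · rintro ⟨u, y⟩ ⟨hu, -⟩
    have hu' : u ∈ 𝒜.cdom x₀ := hu
    obtain ⟨a, ha⟩ := exists_epath (𝒜 := 𝒜) (x₀ := x₀) (x := (chartAt EM x₀).symm u) hu'.2 y
    refine ⟨a.toJet k, hu'.2, ?_⟩
    rw [jetCoord_mk hu'.2, (chartAt EM x₀).right_inv hu'.1]
    congr 1
    funext i
    exact ha i

theorem nonempty_jetSpace (k : ℕ) (x₀ : M) : Nonempty (𝒜.JetSpace k) := by
  obtain ⟨A, -, -⟩ := (𝒜.bijOn_jetCoord k x₀).surjOn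
    (⟨𝒜.chart_mem_cdom (𝒜.mem_dom x₀), mem_univ (0 : Fin k → F)⟩ :
      (chartAt EM x₀ x₀, (0 : Fin k → F)) ∈ 𝒜.cdom x₀ ×ˢ univ)
  exact ⟨A⟩

/-- The local coordinates on `Eᵏ` at `x₀`, as a partial bijection. -/
noncomputable def jetChart (k : ℕ) (x₀ : M) : PartialEquiv (𝒜.JetSpace k) (EM × (Fin k → F)) :=
  have := 𝒜.nonempty_jetSpace k x₀
  (𝒜.bijOn_jetCoord k x₀).toPartialEquiv _ _ _

theorem jetChart_trans_source (k : ℕ) (x₀ x₁ : M) :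
    ((𝒜.jetChart k x₀).symm.trans (𝒜.jetChart k x₁)).source = 𝒜.cdom₂ x₀ x₁ ×ˢ univ := by
  have h1 : ∀ p ∈ (𝒜.jetChart k x₀).target,
      ((𝒜.jetChart k x₀).symm p).base = (chartAt EM x₀).symm p.1 := by
    intro p hp
    have h2 := (𝒜.jetChart k x₀).map_target hp
    have h3 := congrArg Prod.fst ((𝒜.jetChart k x₀).right_inv hp)
    rw [← h3]
    exact ((chartAt EM x₀).left_inv (And.left h2)).symm
  ext p
  rw [PartialEquiv.trans_source, PartialEquiv.symm_source]
  constructor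
  · rintro ⟨h2, h3⟩
    refine ⟨⟨h2.1, ?_⟩, mem_univ _⟩
    rw [mem_preimage, ← h1 p h2]
    exact h3
  · rintro ⟨⟨h2, h3⟩, -⟩
    have h4 : p ∈ (𝒜.jetChart k x₀).target := ⟨h2, mem_univ _⟩
    refine ⟨h4, ?_⟩
    show ((𝒜.jetChart k x₀).symm p).base ∈ 𝒜.dom x₁
    rw [h1 p h4]
    exact h3

/-- The change of coordinates on `Eᵏ`. -/
noncomputable def jetCoordChange (k : ℕ) (x₀ x₁ : M) (p : EM × (Fin k → F)) :
    EM × (Fin k → F) :=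
  (chartAt EM x₁ ((chartAt EM x₀).symm p.1), fun j =>
    (JetCalculus.totalDerivIter (𝒜.localAnchor x₀) (𝒜.coordChange x₀ x₁) j
      (p.1, fun i : Fin (j + 1) => p.2 ⟨i, by omega⟩)).2)

theorem jetChart_trans_eqOn (k : ℕ) (x₀ x₁ : M) :
    EqOn ((𝒜.jetChart k x₀).symm.trans (𝒜.jetChart k x₁)) (𝒜.jetCoordChange k x₀ x₁)
      (𝒜.cdom₂ x₀ x₁ ×ˢ univ) := by
  intro p hp
  have hp' := hp
  rw [← jetChart_trans_source] at hp'
  obtain ⟨h1, h2⟩ := hp'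
  have h3 := (𝒜.jetChart k x₀).right_inv h1
  have h4 := (𝒜.jetChart k x₀).map_target h1
  show 𝒜.jetCoord k x₁ ((𝒜.jetChart k x₀).symm p) = _
  replace h2 : ((𝒜.jetChart k x₀).symm p).base ∈ 𝒜.dom x₁ := h2
  replace h4 : ((𝒜.jetChart k x₀).symm p).base ∈ 𝒜.dom x₀ := h4
  replace h3 : 𝒜.jetCoord k x₀ ((𝒜.jetChart k x₀).symm p) = p := h3
  generalize (𝒜.jetChart k x₀).symm p = A at h2 h3 h4
  obtain ⟨x, q⟩ := A
  induction q using Quotient.inductionOn with | _ a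
  have hx0 : x ∈ 𝒜.dom x₀ := h4
  have hx1 : x ∈ 𝒜.dom x₁ := h2
  replace h3 : 𝒜.jetCoord k x₀ (a.toJet k) = p := h3
  show 𝒜.jetCoord k x₁ (a.toJet k) = _
  rw [jetCoord_mk hx0] at h3
  subst h3
  rw [jetCoord_mk hx1, jetCoordChange, (chartAt EM x₀).left_inv hx0.1]
  congr 1
  funext j
  rw [a.fib_eq_snd hx1, a.iteratedDeriv_coord hx0 hx1]

theorem contDiffOn_jetCoordChange (k : ℕ) (x₀ x₁ : M) :
    ContDiffOn ℝ ∞ (𝒜.jetCoordChange k x₀ x₁) (𝒜.cdom₂ x₀ x₁ ×ˢ univ) := by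
  have hR : ContDiffOn ℝ ∞ (𝒜.localAnchor x₀) (𝒜.cdom₂ x₀ x₁ ×ˢ univ) :=
    (𝒜.contDiffOn_localAnchor x₀).mono (prod_mono (𝒜.cdom₂_subset x₀ x₁) subset_rfl)
  refine ContDiffOn.prodMk ?_ ?_
  · have h1 : ContDiffOn ℝ ∞ (fun p : EM × (Fin k → F) => (𝒜.coordChange x₀ x₁ (p.1, 0)).1)
        (𝒜.cdom₂ x₀ x₁ ×ˢ univ) := by
      refine ContDiffOn.fst ?_
      refine (𝒜.contDiffOn_coordChange x₀ x₁).comp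
        (f := fun p : EM × (Fin k → F) => (p.1, (0 : F))) ?_ ?_
      · exact ContDiff.contDiffOn (by fun_prop)
      · intro p hp; exact ⟨hp.1, mem_univ _⟩
    refine h1.congr fun p hp => ?_
    have h3 := 𝒜.bundleChart_symm_proj (x₀ := x₀) (p := (p.1, (0 : F))) hp.1.1
    rw [coordChange, 𝒜.bundleChart_fst x₁ (by rw [h3]; exact hp.1.2), h3]
  · refine contDiffOn_pi.2 fun j => ContDiffOn.snd ?_
    refine (JetCalculus.contDiffOn_totalDerivIter (𝒜.isOpen_cdom₂ x₀ x₁) hR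
      (𝒜.contDiffOn_coordChange x₀ x₁) j).comp (f := fun p : EM × (Fin k → F) =>
        (p.1, fun i : Fin (j + 1) => p.2 ⟨i, by omega⟩)) ?_ ?_
    · exact ContDiff.contDiffOn (by fun_prop)
    · intro p hp; exact ⟨hp.1, mem_univ _⟩

theorem contDiffOn_jetChart_trans (k : ℕ) (x₀ x₁ : M) :
    ContDiffOn ℝ ∞ ((𝒜.jetChart k x₀).symm.trans (𝒜.jetChart k x₁))
      ((𝒜.jetChart k x₀).symm.trans (𝒜.jetChart k x₁)).source := by
  rw [jetChart_trans_source]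
  exact (𝒜.contDiffOn_jetCoordChange k x₀ x₁).congr (𝒜.jetChart_trans_eqOn k x₀ x₁)

/-- The atlas of `Eᵏ` given by the local coordinates. -/
noncomputable def jetCore (k : ℕ) : ChartedSpaceCore (EM × (Fin k → F)) (𝒜.JetSpace k) where
  atlas := range (𝒜.jetChart k)
  chartAt A := 𝒜.jetChart k A.base
  mem_chart_source A := 𝒜.mem_dom A.base
  chart_mem_atlas A := mem_range_self _
  open_source := by
    rintro _ _ ⟨x₀, rfl⟩ ⟨x₁, rfl⟩
    rw [jetChart_trans_source]
    exact (𝒜.isOpen_cdom₂ x₀ x₁).prod isOpen_univ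
  continuousOn_toFun := by
    rintro _ _ ⟨x₀, rfl⟩ ⟨x₁, rfl⟩
    exact (𝒜.contDiffOn_jetChart_trans k x₀ x₁).continuousOn

noncomputable instance instTopologicalSpaceJetSpace (k : ℕ) : TopologicalSpace (𝒜.JetSpace k) :=
  (𝒜.jetCore k).toTopologicalSpace

noncomputable instance instChartedSpaceJetSpace (k : ℕ) : ChartedSpace (EM × (Fin k → F)) (𝒜.JetSpace k) :=
  (𝒜.jetCore k).toChartedSpace

instance instIsManifoldJetSpace (k : ℕ) : IsManifold 𝓘(ℝ, EM × (Fin k → F)) ∞ (𝒜.JetSpace k) := by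
  refine isManifold_of_contDiffOn _ _ _ ?_
  intro e e' he he'
  obtain ⟨f, ⟨x₀, rfl⟩, hf⟩ : ∃ f, ∃ hf : f ∈ (𝒜.jetCore k).atlas,
      e = (𝒜.jetCore k).openPartialHomeomorph f hf := by
    simpa using mem_iUnion₂.1 he
  obtain ⟨f', ⟨x₁, rfl⟩, hf'⟩ : ∃ f, ∃ hf : f ∈ (𝒜.jetCore k).atlas,
      e' = (𝒜.jetCore k).openPartialHomeomorph f hf := by
    simpa using mem_iUnion₂.1 he'
  subst hf hf'
  have h := 𝒜.contDiffOn_jetChart_trans k x₀ x₁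
  simp only [mfld_simps] at h ⊢
  exact h

theorem contMDiffOn_jetCoord (k : ℕ) (x₀ : M) :
    ContMDiffOn 𝓘(ℝ, EM × (Fin k → F)) 𝓘(ℝ, EM × (Fin k → F)) ∞ (𝒜.jetCoord k x₀)
      (𝒜.jetDom k x₀) := by
  have h : (𝒜.jetCore k).openPartialHomeomorph (𝒜.jetChart k x₀) (mem_range_self _) ∈
      atlas (EM × (Fin k → F)) (𝒜.JetSpace k) :=
    mem_iUnion₂.2 ⟨_, mem_range_self x₀, rfl⟩
  exact contMDiffOn_of_mem_maximalAtlas (n := ∞)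
    (IsManifold.subset_maximalAtlas (I := 𝓘(ℝ, EM × (Fin k → F))) h)

theorem contMDiffOn_jetChart_symm (k : ℕ) (x₀ : M) :
    ContMDiffOn 𝓘(ℝ, EM × (Fin k → F)) 𝓘(ℝ, EM × (Fin k → F)) ∞ (𝒜.jetChart k x₀).symm
      (𝒜.cdom x₀ ×ˢ univ) := by
  have h : (𝒜.jetCore k).openPartialHomeomorph (𝒜.jetChart k x₀) (mem_range_self _) ∈
      atlas (EM × (Fin k → F)) (𝒜.JetSpace k) :=
    mem_iUnion₂.2 ⟨_, mem_range_self x₀, rfl⟩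
  exact contMDiffOn_symm_of_mem_maximalAtlas (n := ∞)
    (IsManifold.subset_maximalAtlas (I := 𝓘(ℝ, EM × (Fin k → F))) h)

theorem isOpen_jetDom (k : ℕ) (x₀ : M) : IsOpen (𝒜.jetDom k x₀) :=
  ((𝒜.jetCore k).openPartialHomeomorph (𝒜.jetChart k x₀) (mem_range_self _)).open_source

/-- The projection `Eᵏ → M`. -/
def proj (k : ℕ) (A : 𝒜.JetSpace k) : M := A.base

theorem contMDiff_proj (k : ℕ) :
    ContMDiff 𝓘(ℝ, EM × (Fin k → F)) 𝓘(ℝ, EM) ∞ (𝒜.proj k) := by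
  intro A
  have hA : A ∈ 𝒜.jetDom k A.base := 𝒜.mem_dom A.base
  have h1 : ContMDiffOn 𝓘(ℝ, EM × (Fin k → F)) 𝓘(ℝ, EM) ∞
      (fun B => (𝒜.jetCoord k A.base B).1) (𝒜.jetDom k A.base) :=
    (contDiff_fst (n := ∞) (𝕜 := ℝ) (E := EM) (F := Fin k → F)).contMDiff.comp_contMDiffOn
      (𝒜.contMDiffOn_jetCoord k A.base)
  have h2 := (contMDiffOn_chart_symm (I := 𝓘(ℝ, EM)) (n := ∞) (x := A.base)).comp h1
    (fun B hB => (chartAt EM A.base).map_source (And.left hB))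
  have h3 : ContMDiffOn 𝓘(ℝ, EM × (Fin k → F)) 𝓘(ℝ, EM) ∞ (𝒜.proj k) (𝒜.jetDom k A.base) :=
    h2.congr fun B hB => ((chartAt EM A.base).left_inv (And.left hB)).symm
  exact h3.contMDiffAt ((𝒜.isOpen_jetDom k A.base).mem_nhds hA)

/-- The projection `τ_{k,l} : Eᵏ → Eˡ`, for `l ≤ k`. -/
def trunc {l k : ℕ} (h : l ≤ k) (A : 𝒜.JetSpace k) : 𝒜.JetSpace l :=
  ⟨A.base, Quotient.map id (fun a b (hab : (𝒜.jetSetoid k A.base).r a b) =>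
    show (𝒜.jetSetoid l A.base).r a b from fun j hj => hab j (hj.trans_le h)) A.jet⟩

theorem jetCoord_trunc {l k : ℕ} (h : l ≤ k) {x₀ : M} {A : 𝒜.JetSpace k}
    (hA : A ∈ 𝒜.jetDom k x₀) :
    𝒜.jetCoord l x₀ (𝒜.trunc h A) =
      ((𝒜.jetCoord k x₀ A).1, fun i => (𝒜.jetCoord k x₀ A).2 (Fin.castLE h i)) := by
  obtain ⟨x, q⟩ := A
  induction q using Quotient.inductionOn with | _ a
  have hx : x ∈ 𝒜.dom x₀ := hA
  show 𝒜.jetCoord l x₀ (a.toJet l) = ((𝒜.jetCoord k x₀ (a.toJet k)).1,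
    fun i => (𝒜.jetCoord k x₀ (a.toJet k)).2 (Fin.castLE h i))
  rw [jetCoord_mk hx, jetCoord_mk hx]
  rfl

theorem contMDiff_trunc {l k : ℕ} (h : l ≤ k) :
    ContMDiff 𝓘(ℝ, EM × (Fin k → F)) 𝓘(ℝ, EM × (Fin l → F)) ∞ (𝒜.trunc h) := by
  intro A
  have hA : A ∈ 𝒜.jetDom k A.base := 𝒜.mem_dom A.base
  have hlin : ContDiff ℝ ∞ (fun p : EM × (Fin k → F) =>
      (p.1, fun i : Fin l => p.2 (Fin.castLE h i))) := by fun_prop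
  have h1 := hlin.contMDiff.comp_contMDiffOn (𝒜.contMDiffOn_jetCoord k A.base)
  have h2 := (𝒜.contMDiffOn_jetChart_symm l A.base).comp h1
    (fun B hB => ⟨𝒜.chart_mem_cdom hB, mem_univ _⟩)
  have h3 : ContMDiffOn 𝓘(ℝ, EM × (Fin k → F)) 𝓘(ℝ, EM × (Fin l → F)) ∞ (𝒜.trunc h)
      (𝒜.jetDom k A.base) := by
    refine h2.congr fun B hB => ?_
    have hB' : 𝒜.trunc h B ∈ (𝒜.jetChart l A.base).source := hB
    have h4 := (𝒜.jetChart l A.base).left_inv hB'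
    rw [← h4]
    exact congrArg _ (𝒜.jetCoord_trunc h hB)
  exact h3.contMDiffAt ((𝒜.isOpen_jetDom k A.base).mem_nhds hA)

/-! ### The `E`-tangent to `Eᵏ` -/

/-- The fibre at `A` of the `E`-tangent `𝒯ᴱEᵏ`: the pairs `(b, v)` of an element `b` of `E` over
the base point of `A` and a tangent vector `v` to `Eᵏ` at `A` with `ρ(b) = Tτ_{k,0}(v)`. -/
def ETangent (k : ℕ) (A : 𝒜.JetSpace k) :
    Submodule ℝ (V A.base × TangentSpace 𝓘(ℝ, EM × (Fin k → F)) A) where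
  carrier := {z | 𝒜.anchor A.base z.1 =
    mfderiv 𝓘(ℝ, EM × (Fin k → F)) 𝓘(ℝ, EM) (𝒜.proj k) A z.2}
  add_mem' {z w} hz hw := by
    simp only [mem_ofPred_eq] at hz hw ⊢
    rw [Prod.fst_add, Prod.snd_add, map_add, map_add, hz, hw]
    rfl
  zero_mem' := by simp; rfl
  smul_mem' c z hz := by
    simp only [mem_ofPred_eq] at hz ⊢
    rw [Prod.smul_fst, Prod.smul_snd, map_smul, map_smul, hz]
    rfl

/-- The projection `𝒯τ_{k,l} : 𝒯ᴱEᵏ → 𝒯ᴱEˡ`, `(b, v) ↦ (b, Tτ_{k,l}(v))`. -/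
noncomputable def ETangent.map {l k : ℕ} (h : l ≤ k) (A : 𝒜.JetSpace k) :
    𝒜.ETangent k A →ₗ[ℝ] 𝒜.ETangent l (𝒜.trunc h A) :=
  LinearMap.codRestrict _
    ((LinearMap.prodMap LinearMap.id
      (mfderiv 𝓘(ℝ, EM × (Fin k → F)) 𝓘(ℝ, EM × (Fin l → F)) (𝒜.trunc h) A).toLinearMap).comp
      (𝒜.ETangent k A).subtype) (by
    rintro ⟨⟨b, v⟩, hz⟩
    have h1 := mfderiv_comp A (((𝒜.contMDiff_proj l) (𝒜.trunc h A)).mdifferentiableAt (by simp))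
      (((𝒜.contMDiff_trunc h) A).mdifferentiableAt (by simp))
    have h2 : (𝒜.proj l) ∘ (𝒜.trunc h) = 𝒜.proj k := rfl
    rw [h2] at h1
    have hz' : 𝒜.anchor A.base b =
      mfderiv 𝓘(ℝ, EM × (Fin k → F)) 𝓘(ℝ, EM) (𝒜.proj k) A v := hz
    rw [h1] at hz'
    exact hz')

/-! ### The canonical inclusion `Eᵏ⁺¹ → 𝒯ᴱEᵏ` -/

theorem IsAdmissibleAt.shift {𝒜 : LieAlgebroid EM F V} {a : ℝ → TotalSpace F V} {t s : ℝ}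
    (h : 𝒜.IsAdmissibleAt a (t + s)) : 𝒜.IsAdmissibleAt (fun r => a (t + r)) s := by
  obtain ⟨h1, h2⟩ := h
  have h3 : ContMDiffAt 𝓘(ℝ, ℝ) 𝓘(ℝ, ℝ) ∞ (fun r : ℝ => t + r) s :=
    (contDiff_const.add contDiff_id).contMDiff.contMDiffAt
  refine ⟨ContMDiffAt.comp s h1 h3, ?_⟩
  have h4 : HasMFDerivAt 𝓘(ℝ, ℝ) 𝓘(ℝ, ℝ) (fun r : ℝ => t + r) s
      (ContinuousLinearMap.id ℝ ℝ) :=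
    ((hasFDerivAt_id s).const_add t).hasMFDerivAt
  exact HasMFDerivAt.comp s h2 h4

/-- The curve `t ↦ aᵏ(t) = [s ↦ a(t + s)]ᵏ⁻¹` in `Eᵏ`; it is defined for all times `t` around
which `a` is admissible (for other `t` a dummy value is used). -/
noncomputable def prolong (k : ℕ) {x : M} (a : 𝒜.EPath x) (t : ℝ) : 𝒜.JetSpace k :=
  open scoped Classical in
  if h : ∀ᶠ s in 𝓝 t, 𝒜.IsAdmissibleAt a.toFun s then
    EPath.toJet (x := (a.toFun t).proj)
      { toFun := fun s => a.toFun (t + s)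
        proj_zero := by rw [add_zero]
        admissible := by
          have h1 : Tendsto (fun s : ℝ => t + s) (𝓝 0) (𝓝 t) := by
            have : ContinuousAt (fun s : ℝ => t + s) 0 := by fun_prop
            simpa [ContinuousAt] using this
          exact (h1.eventually h).mono fun s hs => hs.shift } k
  else a.toJet k

theorem prolong_zero (k : ℕ) {x : M} (a : 𝒜.EPath x) :
    𝒜.prolong k a 0 = a.toJet k := by
  obtain ⟨f, hf, ha⟩ := a
  subst hf
  rw [prolong, dif_pos ha]
  simp

theorem eventually_jetCoord_prolong (k : ℕ) {x x₀ : M} (a : 𝒜.EPath x) (hx : x ∈ 𝒜.dom x₀) :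
    ∀ᶠ t in 𝓝 (0 : ℝ), 𝒜.prolong k a t ∈ 𝒜.jetDom k x₀ ∧
      𝒜.proj k (𝒜.prolong k a t) = (a.toFun t).proj ∧
      𝒜.jetCoord k x₀ (𝒜.prolong k a t) = ((𝒜.bundleChart x₀ (a.toFun t)).1,
        fun i : Fin k => iteratedDeriv i (fun s => (𝒜.bundleChart x₀ (a.toFun s)).2) t) := by
  filter_upwards [a.admissible.eventually_nhds, a.eventually_mem (𝒜.isOpen_dom x₀) hx]
    with t h1 h2
  rw [prolong, dif_pos h1]
  refine ⟨h2, rfl, ?_⟩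
  rw [jetCoord_mk h2, 𝒜.bundleChart_fst x₀ h2]
  congr 1
  funext i
  simp only [EPath.fib]
  rw [iteratedDeriv_comp_const_add i (fun s => (𝒜.bundleChart x₀ (a.toFun s)).2) t]
  simp

theorem contMDiffAt_prolong (k : ℕ) {x : M} (a : 𝒜.EPath x) :
    ContMDiffAt 𝓘(ℝ, ℝ) 𝓘(ℝ, EM × (Fin k → F)) ∞ (𝒜.prolong k a) 0 := by
  have hx := 𝒜.mem_dom x
  have h0 := (a.admissible.self_of_nhds.coord (x₀ := x) (by rw [a.proj_zero]; exact hx))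
  have h1 : ContDiffAt ℝ ∞ (fun t => ((𝒜.bundleChart x (a.toFun t)).1,
        fun i : Fin k => iteratedDeriv i (fun s => (𝒜.bundleChart x (a.toFun s)).2) t)) 0 := by
    refine h0.1.fst.prodMk (contDiffAt_pi.2 fun i => ?_)
    exact JetCalculus.contDiffAt_iteratedDeriv h0.1.snd i
  have hop : IsOpen (𝒜.cdom x ×ˢ (univ : Set (Fin k → F))) := (𝒜.isOpen_cdom x).prod isOpen_univ
  have h2 := ((𝒜.contMDiffOn_jetChart_symm k x).contMDiffAt (hop.mem_nhds
    (show ((𝒜.bundleChart x (a.toFun 0)).1,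
        fun i : Fin k => iteratedDeriv i (fun s => (𝒜.bundleChart x (a.toFun s)).2) 0) ∈
          𝒜.cdom x ×ˢ univ from ⟨h0.2.2, mem_univ _⟩))).comp (0 : ℝ) h1.contMDiffAt
  refine h2.congr_of_eventuallyEq ?_
  filter_upwards [𝒜.eventually_jetCoord_prolong k a hx] with t ht
  have h3 := (𝒜.jetChart k x).left_inv ht.1
  rw [← h3]
  exact congrArg _ ht.2.2

/-- The velocity at time `0` of the curve `t ↦ aᵏ(t)` in `Eᵏ`. -/
noncomputable def prolongVelocity (k : ℕ) {x : M} (a : 𝒜.EPath x) :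
    TangentSpace 𝓘(ℝ, EM × (Fin k → F)) (a.toJet k) :=
  mfderiv 𝓘(ℝ, ℝ) 𝓘(ℝ, EM × (Fin k → F)) (𝒜.prolong k a) 0 (1 : ℝ)

/-- The value `a(0)`, as an element of the fibre over the base point. -/
def EPath.value {𝒜 : LieAlgebroid EM F V} {x : M} (a : 𝒜.EPath x) : V x :=
  a.proj_zero ▸ (a.toFun 0).snd

theorem EPath.mk_value {𝒜 : LieAlgebroid EM F V} {x : M} (a : 𝒜.EPath x) :
    (⟨x, a.value⟩ : TotalSpace F V) = a.toFun 0 := by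
  obtain ⟨f, hf, ha⟩ := a
  subst hf
  rfl

theorem mem_ETangent_prolong (k : ℕ) {x : M} (a : 𝒜.EPath x) :
    (a.value, 𝒜.prolongVelocity k a) ∈ 𝒜.ETangent k (a.toJet k) := by
  show 𝒜.anchor x a.value = mfderiv 𝓘(ℝ, EM × (Fin k → F)) 𝓘(ℝ, EM) (𝒜.proj k)
    (a.toJet k) (𝒜.prolongVelocity k a)
  have h1 := ((𝒜.contMDiffAt_prolong k a).mdifferentiableAt (by simp)).hasMFDerivAt
  have h2 := (((𝒜.contMDiff_proj k) (𝒜.prolong k a 0)).mdifferentiableAt (by simp)).hasMFDerivAt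
  have h3 := h2.comp (0 : ℝ) h1
  have h4 : (𝒜.proj k ∘ 𝒜.prolong k a) =ᶠ[𝓝 0] fun t => (a.toFun t).proj := by
    filter_upwards [𝒜.eventually_jetCoord_prolong k a (𝒜.mem_dom x)] with t ht
    exact ht.2.1
  have h5 := hasMFDerivAt_unique (h3.congr_of_eventuallyEq h4.symm) a.admissible.self_of_nhds.2
  have h6 : ∀ A B : 𝒜.JetSpace k, A = B → ∀ v : EM × (Fin k → F),
      (show EM from mfderiv 𝓘(ℝ, EM × (Fin k → F)) 𝓘(ℝ, EM) (𝒜.proj k) A v) =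
        mfderiv 𝓘(ℝ, EM × (Fin k → F)) 𝓘(ℝ, EM) (𝒜.proj k) B v := by
    rintro A _ rfl v; rfl
  have h7 : ∀ p q : TotalSpace F V, p = q →
      (show EM from 𝒜.anchor p.proj p.snd) = 𝒜.anchor q.proj q.snd := by
    rintro p _ rfl; rfl
  have h8 := congrArg (fun L : ℝ →L[ℝ] EM => L 1) h5
  refine (h7 _ _ a.mk_value).trans (Eq.trans ?_ (h6 _ _ (𝒜.prolong_zero k a) _))
  refine Eq.trans ?_ h8.symm
  exact (one_smul ℝ (𝒜.anchor (a.toFun 0).proj (a.toFun 0).snd)).symm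

theorem prolongVelocity_eq (k : ℕ) {x : M} (a : 𝒜.EPath x) :
    𝒜.prolongVelocity k a = (𝒜.localAnchor x (𝒜.bundleChart x (a.toFun 0)),
      fun i : Fin k => a.fib x (i + 1)) := by
  have h1 := ((𝒜.contMDiffAt_prolong k a).mdifferentiableAt (by simp)).hasMFDerivAt.2
  have h0 := (a.admissible.self_of_nhds.coord (x₀ := x)
    (by rw [a.proj_zero]; exact 𝒜.mem_dom x))
  have hb : (𝒜.prolong k a 0).base = x := by rw [𝒜.prolong_zero]; rfl
  have h2 : HasFDerivAt (fun t => 𝒜.jetCoord k (𝒜.prolong k a 0).base (𝒜.prolong k a t))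
      (show ℝ →L[ℝ] EM × (Fin k → F) from
        mfderiv 𝓘(ℝ, ℝ) 𝓘(ℝ, EM × (Fin k → F)) (𝒜.prolong k a) 0) 0 := by
    rw [← hasFDerivWithinAt_univ]
    simp only [mfld_simps] at h1
    exact h1
  rw [hb] at h2
  have h3 : HasDerivAt (fun t => ((𝒜.bundleChart x (a.toFun t)).1,
      fun i : Fin k => iteratedDeriv i (fun s => (𝒜.bundleChart x (a.toFun s)).2) t))
      (𝒜.localAnchor x (𝒜.bundleChart x (a.toFun 0)), fun i : Fin k => a.fib x (i + 1)) 0 := by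
    refine h0.2.1.prodMk (hasDerivAt_pi.2 fun i => ?_)
    rw [EPath.fib, iteratedDeriv_succ]
    exact ((JetCalculus.contDiffAt_iteratedDeriv h0.1.snd i).differentiableAt
      (by simp)).hasDerivAt
  have h4 : (fun t => 𝒜.jetCoord k x (𝒜.prolong k a t)) =ᶠ[𝓝 0]
      fun t => ((𝒜.bundleChart x (a.toFun t)).1,
        fun i : Fin k => iteratedDeriv i (fun s => (𝒜.bundleChart x (a.toFun s)).2) t) := by
    filter_upwards [𝒜.eventually_jetCoord_prolong k a (𝒜.mem_dom x)] with t ht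
    exact ht.2.2
  exact (h2.hasDerivAt.congr_of_eventuallyEq h4.symm).unique h3

theorem bundleChart_eq_of_rel {k : ℕ} {x : M} {a b : 𝒜.EPath x}
    (h : (𝒜.jetSetoid (k + 1) x).r a b) :
    𝒜.bundleChart x (a.toFun 0) = 𝒜.bundleChart x (b.toFun 0) := by
  simpa using h 0 (Nat.succ_pos k)

theorem value_eq_of_rel {k : ℕ} {x : M} {a b : 𝒜.EPath x}
    (h : (𝒜.jetSetoid (k + 1) x).r a b) : a.value = b.value := by
  have h1 : a.toFun 0 = b.toFun 0 := by
    refine (𝒜.bundleChart x).injOn ?_ ?_ (𝒜.bundleChart_eq_of_rel h)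
    · rw [bundleChart_source]
      show (a.toFun 0).proj ∈ 𝒜.dom x
      rw [a.proj_zero]; exact 𝒜.mem_dom x
    · rw [bundleChart_source]
      show (b.toFun 0).proj ∈ 𝒜.dom x
      rw [b.proj_zero]; exact 𝒜.mem_dom x
  rw [← a.mk_value, ← b.mk_value] at h1
  exact TotalSpace.mk_injective x h1

theorem prolongVelocity_eq_of_rel {k : ℕ} {x : M} {a b : 𝒜.EPath x}
    (h : (𝒜.jetSetoid (k + 1) x).r a b) :
    (show EM × (Fin k → F) from 𝒜.prolongVelocity k a) = 𝒜.prolongVelocity k b := by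
  refine (𝒜.prolongVelocity_eq k a).trans (Eq.trans ?_ (𝒜.prolongVelocity_eq k b).symm)
  rw [𝒜.bundleChart_eq_of_rel h]
  congr 1
  funext i
  exact (EPath.rel_iff a b (𝒜.mem_dom x) (k + 1)).1 h (i + 1) (by omega)

/-- The canonical inclusion `𝐓 = i_{k,1} : Eᵏ⁺¹ → 𝒯ᴱEᵏ`,
`[a]ᵏ ↦ ([a]ᵏ⁻¹, a(0), (d/dt) aᵏ(t) at t = 0)`, a section of `𝒯ᴱEᵏ` along `τ_{k+1,k}`. -/
noncomputable def canonicalInclusion (k : ℕ) (A : 𝒜.JetSpace (k + 1)) :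
    𝒜.ETangent k (𝒜.trunc k.le_succ A) :=
  ⟨(Quotient.lift (s := 𝒜.jetSetoid (k + 1) A.base) (fun a => a.value)
      (fun _ _ h => 𝒜.value_eq_of_rel h) A.jet,
    Quotient.lift (s := 𝒜.jetSetoid (k + 1) A.base)
      (fun a => (show EM × (Fin k → F) from 𝒜.prolongVelocity k a))
      (fun _ _ h => 𝒜.prolongVelocity_eq_of_rel h) A.jet), by
    obtain ⟨x, q⟩ := A
    induction q using Quotient.inductionOn with | _ a
    exact 𝒜.mem_ETangent_prolong k a⟩

/-! ### Sections and one-forms on the `E`-tangent -/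

/-- Smoothness of a section of `𝒯ᴱEᵏ`. -/
def IsSmoothSection (k : ℕ) (Z : ∀ A : 𝒜.JetSpace k, 𝒜.ETangent k A) : Prop :=
  ContMDiff 𝓘(ℝ, EM × (Fin k → F)) (𝓘(ℝ, EM).prod 𝓘(ℝ, F)) ∞
    (fun A => (⟨A.base, (Z A).1.1⟩ : TotalSpace F V)) ∧
  ContMDiff 𝓘(ℝ, EM × (Fin k → F)) 𝓘(ℝ, EM × (Fin k → F)).tangent ∞
    (fun A => (⟨A, (Z A).1.2⟩ : TangentBundle 𝓘(ℝ, EM × (Fin k → F)) (𝒜.JetSpace k)))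

/-- Not necessarily smooth one-forms on `𝒯ᴱEᵏ`, i.e. sections of the dual bundle `(𝒯ᴱEᵏ)*`. -/
abbrev OneForm (k : ℕ) : Type _ := ∀ A : 𝒜.JetSpace k, Module.Dual ℝ (𝒜.ETangent k A)

/-- A one-form is smooth if its pairing with every smooth section of `𝒯ᴱEᵏ` is a smooth
function. -/
def IsSmoothForm {k : ℕ} (lam : 𝒜.OneForm k) : Prop :=
  ∀ Z, 𝒜.IsSmoothSection k Z →
    ContMDiff 𝓘(ℝ, EM × (Fin k → F)) 𝓘(ℝ, ℝ) ∞ (fun A => lam A (Z A))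

/-- The pullback `(𝒯τ_{k,l})* λ` of a one-form `λ` on `𝒯ᴱEˡ` to `𝒯ᴱEᵏ`. -/
noncomputable def pullback {l k : ℕ} (h : l ≤ k) (lam : 𝒜.OneForm l) : 𝒜.OneForm k :=
  fun A => (lam (𝒜.trunc h A)).comp (ETangent.map 𝒜 h A)

/-- A one-form on `𝒯ᴱEᵏ` is `τ_{k,l}`-semibasic if it vanishes on the kernel of `𝒯τ_{k,l}`. -/
def IsSemibasic {l k : ℕ} (h : l ≤ k) (lam : 𝒜.OneForm k) : Prop :=
  ∀ (A : 𝒜.JetSpace k) (z : 𝒜.ETangent k A), ETangent.map 𝒜 h A z = 0 → lam A z = 0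

/-! ### Lie algebroid structure of the `E`-tangent, exterior differential, total derivative -/

/-- Projectable sections of `𝒯ᴱEᵏ`: the sections `A ↦ (σ(τ_{k,0}(A)), X(A))` given by a smooth
section `σ` of `E` and a smooth vector field `X` on `Eᵏ` projecting to `ρ(σ)`. -/
structure ProjectableSection (k : ℕ) where
  sec : Cₛ^∞⟮𝓘(ℝ, EM); F, V⟯
  vec : ∀ A : 𝒜.JetSpace k, TangentSpace 𝓘(ℝ, EM × (Fin k → F)) A
  contMDiff_vec : ContMDiff 𝓘(ℝ, EM × (Fin k → F)) 𝓘(ℝ, EM × (Fin k → F)).tangent ∞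
    (fun A => (⟨A, vec A⟩ : TangentBundle 𝓘(ℝ, EM × (Fin k → F)) (𝒜.JetSpace k)))
  mem : ∀ A : 𝒜.JetSpace k, (sec A.base, vec A) ∈ 𝒜.ETangent k A

/-- The section of `𝒯ᴱEᵏ` defined by a projectable section. -/
noncomputable def ProjectableSection.toSection {𝒜 : LieAlgebroid EM F V} {k : ℕ}
    (Z : 𝒜.ProjectableSection k) (A : 𝒜.JetSpace k) : 𝒜.ETangent k A :=
  ⟨(Z.sec A.base, Z.vec A), Z.mem A⟩

/-- The projectable section `B` is the bracket `[Z, W]` in the Lie algebroid `𝒯ᴱEᵏ`, i.e. its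
components are the bracket of the sections of `E` and the bracket of the vector fields on `Eᵏ`. -/
def IsBracket {k : ℕ} (Z W B : 𝒜.ProjectableSection k) : Prop :=
  B.sec = 𝒜.bracket Z.sec W.sec ∧
  B.vec = VectorField.mlieBracket 𝓘(ℝ, EM × (Fin k → F)) Z.vec W.vec

/-- `om` is the exterior differential `dλ` of the one-form `λ` on the Lie algebroid `𝒯ᴱEᵏ`:
`om(Z, W) = Z(λ(W)) - W(λ(Z)) - λ([Z, W])` for all projectable sections `Z`, `W`. Projectable
sections span every fibre, so that this determines `om`. -/
def IsExteriorDifferential {k : ℕ} (lam : 𝒜.OneForm k)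
    (om : ∀ A : 𝒜.JetSpace k, 𝒜.ETangent k A →ₗ[ℝ] 𝒜.ETangent k A →ₗ[ℝ] ℝ) : Prop :=
  ∀ Z W B : 𝒜.ProjectableSection k, 𝒜.IsBracket Z W B → ∀ A : 𝒜.JetSpace k,
    om A (Z.toSection A) (W.toSection A) =
      tangentDeriv 𝓘(ℝ, EM × (Fin k → F)) (fun A' => lam A' (W.toSection A')) A (Z.vec A) -
      tangentDeriv 𝓘(ℝ, EM × (Fin k → F)) (fun A' => lam A' (Z.toSection A')) A (W.vec A) -
      lam A (B.toSection A)

/-- The exterior differential `dλ` of a one-form on the Lie algebroid `𝒯ᴱEᵏ` (with dummy value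
`0` if there is none, which does not occur for smooth `λ`). -/
noncomputable def exteriorDifferential {k : ℕ} (lam : 𝒜.OneForm k) :
    ∀ A : 𝒜.JetSpace k, 𝒜.ETangent k A →ₗ[ℝ] 𝒜.ETangent k A →ₗ[ℝ] ℝ :=
  open scoped Classical in
  if h : ∃ om, 𝒜.IsExteriorDifferential lam om then h.choose else 0

/-- The function `i_𝐓 λ` on `Eᵏ⁺¹`, for a one-form `λ` on `𝒯ᴱEᵏ`. -/
noncomputable def contractT {k : ℕ} (lam : 𝒜.OneForm k) (A : 𝒜.JetSpace (k + 1)) : ℝ :=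
  lam (𝒜.trunc k.le_succ A) (𝒜.canonicalInclusion k A)

/-- The total time derivative `d_𝐓 λ = d(i_𝐓 λ) + i_𝐓(dλ)` of a one-form `λ` on `𝒯ᴱEᵏ`, which is
a one-form on `𝒯ᴱEᵏ⁺¹`. Here `df(b, v) = v(f)` for a function `f` on `Eᵏ⁺¹`. -/
noncomputable def totalTimeDeriv {k : ℕ} (lam : 𝒜.OneForm k) : 𝒜.OneForm (k + 1) := fun A =>
  (tangentDeriv 𝓘(ℝ, EM × (Fin (k + 1) → F)) (𝒜.contractT lam) A).comp
    ((LinearMap.snd ℝ _ _).comp (𝒜.ETangent (k + 1) A).subtype) +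
  (𝒜.exteriorDifferential lam (𝒜.trunc k.le_succ A) (𝒜.canonicalInclusion k A)).comp
    (ETangent.map 𝒜 k.le_succ A)

/-- Smooth sections `θ` of `E*`. -/
def IsSmoothDualSection (_ : LieAlgebroid EM F V) (θ : ∀ x, Module.Dual ℝ (V x)) : Prop :=
  ContMDiff (𝓘(ℝ, EM).prod 𝓘(ℝ, F)) 𝓘(ℝ, ℝ) ∞ (fun p : TotalSpace F V => θ p.proj p.snd)

/-- The iterated total time derivative `d_𝐓ʳ θ`, a one-form on `𝒯ᴱEʳ`, of a section `θ` of `E*`,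
which is considered as a one-form on `𝒯ᴱE⁰ = 𝒯ᴱM = E`. -/
noncomputable def iterTotalTimeDeriv (θ : ∀ x, Module.Dual ℝ (V x)) : (r : ℕ) → 𝒜.OneForm r
  | 0 => fun A => (θ A.base).comp ((LinearMap.fst ℝ _ _).comp (𝒜.ETangent 0 A).subtype)
  | r + 1 => 𝒜.totalTimeDeriv (iterTotalTimeDeriv θ r)

/-! ### The vertical endomorphism -/

/-- The action `λ ↦ λ ∘ S` on one-forms of a field `S` of endomorphisms of `𝒯ᴱEᵏ`. -/
noncomputable def dualAction {k : ℕ} (S : ∀ A : 𝒜.JetSpace k, Module.End ℝ (𝒜.ETangent k A))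
    (lam : 𝒜.OneForm k) : 𝒜.OneForm k := fun A => (lam A).comp (S A)

/-- `S` is the vertical endomorphism of `𝒯ᴱEᵏ`: a smooth `(1,1)`-tensor field such that
`S(d_𝐓ʳ θ) = r d_𝐓ʳ⁻¹ θ` (with `S(θ) = 0` for `r = 0`) for all smooth sections `θ` of `E*` and
all `r = 0, …, k`; pullbacks to `𝒯ᴱEᵏ` are understood. -/
structure IsVerticalEndomorphism (k : ℕ)
    (S : ∀ A : 𝒜.JetSpace k, Module.End ℝ (𝒜.ETangent k A)) : Prop where
  smooth : ∀ Z, 𝒜.IsSmoothSection k Z → 𝒜.IsSmoothSection k (fun A => S A (Z A))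
  apply_eq : ∀ θ, 𝒜.IsSmoothDualSection θ → ∀ r (hr : r ≤ k),
    𝒜.dualAction S (𝒜.pullback hr (𝒜.iterTotalTimeDeriv θ r)) =
      (r : ℝ) • 𝒜.pullback ((Nat.sub_le r 1).trans hr) (𝒜.iterTotalTimeDeriv θ (r - 1))

end

end LieAlgebroid

/-! In local coordinates `(x, y₀, …, y_{k-1})` on `Eᵏ`, an element of `𝒯ᴱEᵏ` is described by `k + 1`
vectors `z₀, …, z_k` of `F`: the element of `E` and the fibre components of the tangent vector,
whose base component is then forced by the anchor. The operator `d_𝐓` becomes a derivation `D` along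
the total derivative field, which shifts the `zᵢ` up to a correction by the structure functions of
the bracket.

Let `e₀` be the tautological `F`-valued form `z ↦ z₀`, and `e_r = Dʳ e₀`. The form `e_r` is `z_r`
plus terms in the `z_i` with `i < r`, so `e₀, …, e_k` is a frame (`frameForm_apply_of_eq_zero`,
`isInvertible_frameMap`). Testing the defining identity of `S` on sections `θ` with locally constant
coefficients forces `e_r ∘ S = r e_{r-1}`: in the frame, `S` is the weighted shift `raise`. This is
uniqueness. Conversely a general `θ` is `f e₀` with variable coefficients, and the binomial
expansion of `Dʳ(f e₀)` together with `i · (r choose i) = r · (r-1 choose i-1)` gives `S Dʳ = r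
Dʳ⁻¹` on it. The lemma `truncDeriv_iterate_comp` proves this by induction, without binomials. Since
the characterisation by the shift holds in every chart and the defining identity mentions none, the
local shifts agree on overlaps and define `S` globally (`exists_vertical`).

The three assertions are linear algebra of a weighted shift. By triangularity, `ker 𝒯τ_{k,l}`
consists of the vectors whose first `l + 1` frame coordinates vanish (`map_eq_zero_iff`). This is
the image of `S^(l+1)`, and `ker 𝒯τ_{k,k-l}` is killed by `S^l`. To write a smooth semibasic form as
`λ ∘ S^l` with `λ` smooth, the backward shift `lower` is used as a local inverse of `S` modulo the
kernel. It depends on the chart, so its powers are glued by a partition of unity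
(`exists_glued_frameEnd`).

The coordinate formula for `d_𝐓` needs the exterior differential, hence brackets of projectable
sections. Two facts about Lie algebroids enter: the bracket has smooth structure functions
(`exists_structure`), and the anchor preserves brackets (`localAnchor_bracket`), which follows from
the Jacobi identity and the Leibniz rule. -/

namespace LieAlgebroid

section

variable {EM F : Type*} {M : Type*} {V : M → Type*}
  [NormedAddCommGroup EM] [NormedSpace ℝ EM]
  [NormedAddCommGroup F] [NormedSpace ℝ F]
  [TopologicalSpace M] [ChartedSpace EM M] [IsManifold 𝓘(ℝ, EM) ∞ M]
  [TopologicalSpace (TotalSpace F V)] [∀ x, TopologicalSpace (V x)] [FiberBundle F V]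
  [∀ x, AddCommGroup (V x)] [∀ x, Module ℝ (V x)] [VectorBundle ℝ F V]
  [ContMDiffVectorBundle ∞ F V 𝓘(ℝ, EM)]
  (𝒜 : LieAlgebroid EM F V)

/-! ### Sections in local coordinates -/

/-- The fibre coordinates at `x₀`, as a linear map on the fibre over `x`. -/
noncomputable def fibMap (_ : LieAlgebroid EM F V) (x₀ x : M) : V x →ₗ[ℝ] F :=
  (trivializationAt F V x₀).linearMapAt ℝ x

/-- The inverse of the fibre coordinates at `x₀`. -/
noncomputable def fibInv (_ : LieAlgebroid EM F V) (x₀ x : M) : F →ₗ[ℝ] V x :=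
  (trivializationAt F V x₀).symmₗ ℝ x

theorem fibMap_fibInv {x₀ x : M} (hx : x ∈ 𝒜.dom x₀) (v : F) :
    𝒜.fibMap x₀ x (𝒜.fibInv x₀ x v) = v :=
  (trivializationAt F V x₀).linearMapAt_symmₗ hx.2 v

theorem fibInv_fibMap {x₀ x : M} (hx : x ∈ 𝒜.dom x₀) (b : V x) :
    𝒜.fibInv x₀ x (𝒜.fibMap x₀ x b) = b :=
  (trivializationAt F V x₀).symmₗ_linearMapAt hx.2 b

theorem bundleChart_mk {x₀ x : M} (hx : x ∈ 𝒜.dom x₀) (b : V x) :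
    𝒜.bundleChart x₀ ⟨x, b⟩ = (chartAt EM x₀ x, 𝒜.fibMap x₀ x b) := by
  refine Prod.ext (𝒜.bundleChart_fst x₀ hx) ?_
  simp only [bundleChart, FiberBundle.extChartAt, fibMap]
  rw [Trivialization.linearMapAt_apply, if_pos hx.2]
  rfl

theorem localAnchor_eq {x₀ x : M} (hx : x ∈ 𝒜.dom x₀) (b : V x) :
    𝒜.localAnchor x₀ (chartAt EM x₀ x, 𝒜.fibMap x₀ x b) =
      mfderiv 𝓘(ℝ, EM) 𝓘(ℝ, EM) (chartAt EM x₀) x (𝒜.anchor x b) := by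
  rw [← 𝒜.bundleChart_mk hx b]
  exact 𝒜.localAnchor_apply (p := ⟨x, b⟩) hx

/-- The definition of `localAnchor` through charts of total spaces hides its linearity in the fibre
variable. Here it appears as a composite of linear maps, from which additivity and homogeneity
follow. -/
theorem localAnchor_eq' {x₀ : M} {u : EM} (hu : u ∈ 𝒜.cdom x₀) (v : F) :
    𝒜.localAnchor x₀ (u, v) =
      mfderiv 𝓘(ℝ, EM) 𝓘(ℝ, EM) (chartAt EM x₀) ((chartAt EM x₀).symm u)
        (𝒜.anchor _ (𝒜.fibInv x₀ ((chartAt EM x₀).symm u) v)) := by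
  have h := 𝒜.localAnchor_eq (x₀ := x₀) (x := (chartAt EM x₀).symm u) hu.2
    (𝒜.fibInv x₀ _ v)
  rwa [𝒜.fibMap_fibInv hu.2, (chartAt EM x₀).right_inv hu.1] at h

theorem localAnchor_add {x₀ : M} {u : EM} (hu : u ∈ 𝒜.cdom x₀) (v w : F) :
    𝒜.localAnchor x₀ (u, v + w) = 𝒜.localAnchor x₀ (u, v) + 𝒜.localAnchor x₀ (u, w) := by
  rw [𝒜.localAnchor_eq' hu, 𝒜.localAnchor_eq' hu, 𝒜.localAnchor_eq' hu, map_add, map_add]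
  exact map_add _ _ _

theorem localAnchor_smul {x₀ : M} {u : EM} (hu : u ∈ 𝒜.cdom x₀) (r : ℝ) (v : F) :
    𝒜.localAnchor x₀ (u, r • v) = r • 𝒜.localAnchor x₀ (u, v) := by
  rw [𝒜.localAnchor_eq' hu, 𝒜.localAnchor_eq' hu, map_smul, map_smul]
  exact map_smul _ _ _

/-- The coordinate expression at `x₀` of a section. -/
noncomputable def secLoc (x₀ : M) (σ : ∀ x, V x) (u : EM) : F :=
  𝒜.fibMap x₀ ((chartAt EM x₀).symm u) (σ ((chartAt EM x₀).symm u))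

theorem symm_mem_dom {x₀ : M} {u : EM} (hu : u ∈ 𝒜.cdom x₀) :
    (chartAt EM x₀).symm u ∈ 𝒜.dom x₀ := hu.2

theorem contMDiffOn_fibMap (x₀ : M) (σ : Cₛ^∞⟮𝓘(ℝ, EM); F, V⟯) :
    ContMDiffOn 𝓘(ℝ, EM) 𝓘(ℝ, F) ∞ (fun x => 𝒜.fibMap x₀ x (σ x)) (𝒜.dom x₀) := by
  have h1 : ContMDiffOn 𝓘(ℝ, EM) 𝓘(ℝ, EM × F) ∞
      (fun x => 𝒜.bundleChart x₀ (⟨x, σ x⟩ : TotalSpace F V)) (𝒜.dom x₀) :=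
    (𝒜.contMDiffOn_bundleChart x₀).comp σ.contMDiff.contMDiffOn fun x hx => hx
  have h2 := (contDiff_snd (n := ∞) (𝕜 := ℝ) (E := EM) (F := F)).contMDiff.comp_contMDiffOn h1
  exact h2.congr fun x hx => by
    rw [Function.comp_apply, 𝒜.bundleChart_mk hx]

theorem contMDiffOn_chart_symm_cdom (x₀ : M) :
    ContMDiffOn 𝓘(ℝ, EM) 𝓘(ℝ, EM) ∞ (chartAt EM x₀).symm (𝒜.cdom x₀) :=
  (contMDiffOn_chart_symm (I := 𝓘(ℝ, EM)) (n := ∞) (x := x₀)).mono inter_subset_left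

theorem contDiffOn_comp_symm {G : Type*} [NormedAddCommGroup G] [NormedSpace ℝ G] (x₀ : M)
    {f : M → G} {U : Set M}
    (hf : ContMDiffOn 𝓘(ℝ, EM) 𝓘(ℝ, G) ∞ f U) :
    ContDiffOn ℝ ∞ (fun u => f ((chartAt EM x₀).symm u))
      (𝒜.cdom x₀ ∩ (chartAt EM x₀).symm ⁻¹' U) := by
  rw [← contMDiffOn_iff_contDiffOn]
  exact hf.comp ((𝒜.contMDiffOn_chart_symm_cdom x₀).mono inter_subset_left) fun u hu => hu.2

theorem contDiffOn_secLoc (x₀ : M) (σ : Cₛ^∞⟮𝓘(ℝ, EM); F, V⟯) :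
    ContDiffOn ℝ ∞ (𝒜.secLoc x₀ σ) (𝒜.cdom x₀) := by
  refine (𝒜.contDiffOn_comp_symm x₀ (𝒜.contMDiffOn_fibMap x₀ σ)).mono ?_
  exact fun u hu => ⟨hu, hu.2⟩

theorem differentiableAt_secLoc {x₀ : M} {u : EM} (hu : u ∈ 𝒜.cdom x₀)
    (σ : Cₛ^∞⟮𝓘(ℝ, EM); F, V⟯) : DifferentiableAt ℝ (𝒜.secLoc x₀ σ) u :=
  ((𝒜.contDiffOn_secLoc x₀ σ).contDiffAt ((𝒜.isOpen_cdom x₀).mem_nhds hu)).differentiableAt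
    (by simp)

theorem secLoc_add (x₀ : M) (σ η : Cₛ^∞⟮𝓘(ℝ, EM); F, V⟯) :
    𝒜.secLoc x₀ (σ + η : Cₛ^∞⟮𝓘(ℝ, EM); F, V⟯) = 𝒜.secLoc x₀ σ + 𝒜.secLoc x₀ η := by
  funext u
  simp [secLoc]

/-- The derivative of a function along the anchor of a section, in coordinates. -/
theorem tangentDeriv_anchor {x₀ x : M} (hx : x ∈ 𝒜.dom x₀) {f : M → ℝ}
    (hf : MDifferentiableAt 𝓘(ℝ, EM) 𝓘(ℝ, ℝ) f x) (b : V x) :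
    tangentDeriv 𝓘(ℝ, EM) f x (𝒜.anchor x b) =
      fderiv ℝ (fun u => f ((chartAt EM x₀).symm u)) (chartAt EM x₀ x)
        (𝒜.localAnchor x₀ (chartAt EM x₀ x, 𝒜.fibMap x₀ x b)) := by
  have hu : chartAt EM x₀ x ∈ 𝒜.cdom x₀ := 𝒜.chart_mem_cdom hx
  have hinv : (chartAt EM x₀).symm (chartAt EM x₀ x) = x := (chartAt EM x₀).left_inv hx.1
  have h1 : MDifferentiableAt 𝓘(ℝ, EM) 𝓘(ℝ, EM) (chartAt EM x₀).symm (chartAt EM x₀ x) :=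
    ((𝒜.contMDiffOn_chart_symm_cdom x₀).contMDiffAt
      ((𝒜.isOpen_cdom x₀).mem_nhds hu)).mdifferentiableAt (by simp)
  have h2 : MDifferentiableAt 𝓘(ℝ, EM) 𝓘(ℝ, EM) (chartAt EM x₀) x :=
    ((contMDiffOn_chart (I := 𝓘(ℝ, EM)) (n := ∞) (x := x₀)).contMDiffAt
      ((chartAt EM x₀).open_source.mem_nhds hx.1)).mdifferentiableAt (by simp)
  have h3 : HasMFDerivAt 𝓘(ℝ, EM) 𝓘(ℝ, ℝ) f ((chartAt EM x₀).symm (chartAt EM x₀ x))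
      (mfderiv 𝓘(ℝ, EM) 𝓘(ℝ, ℝ) f x) := by
    rw [hinv]; exact hf.hasMFDerivAt
  have h4 := h3.comp (chartAt EM x₀ x) h1.hasMFDerivAt
  have h5 : HasMFDerivAt 𝓘(ℝ, EM) 𝓘(ℝ, ℝ) (fun u => f ((chartAt EM x₀).symm u))
      (chartAt EM x₀ x) (fderiv ℝ (fun u => f ((chartAt EM x₀).symm u)) (chartAt EM x₀ x)) :=
    (h4.mdifferentiableAt.differentiableAt).hasFDerivAt.hasMFDerivAt
  have h6 := h5.comp x h2.hasMFDerivAt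
  have h7 : f =ᶠ[𝓝 x] (fun u => f ((chartAt EM x₀).symm u)) ∘ (chartAt EM x₀) := by
    filter_upwards [(chartAt EM x₀).open_source.mem_nhds hx.1] with y hy
    simp [(chartAt EM x₀).left_inv hy]
  have h8 := hasMFDerivAt_unique (h6.congr_of_eventuallyEq h7) hf.hasMFDerivAt
  rw [𝒜.localAnchor_eq hx]
  have h9 := congrArg (fun L : EM →L[ℝ] ℝ => L (𝒜.anchor x b)) h8
  exact h9.symm

theorem tangentDeriv_anchor' {x₀ : M} {u : EM} (hu : u ∈ 𝒜.cdom x₀) {f : M → ℝ}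
    (hf : ContMDiff 𝓘(ℝ, EM) 𝓘(ℝ, ℝ) ∞ f) (σ : ∀ x, V x) :
    tangentDeriv 𝓘(ℝ, EM) f ((chartAt EM x₀).symm u) (𝒜.anchor _ (σ _)) =
      fderiv ℝ (fun u => f ((chartAt EM x₀).symm u)) u
        (𝒜.localAnchor x₀ (u, 𝒜.secLoc x₀ σ u)) := by
  have h := 𝒜.tangentDeriv_anchor (x₀ := x₀) hu.2 (hf.mdifferentiable (by simp) _)
    (σ ((chartAt EM x₀).symm u))
  rwa [(chartAt EM x₀).right_inv hu.1] at h

/-- The product of a smooth function and a smooth section. -/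
noncomputable def smulSection (_ : LieAlgebroid EM F V) {f : M → ℝ}
    (hf : ContMDiff 𝓘(ℝ, EM) 𝓘(ℝ, ℝ) ∞ f)
    (σ : Cₛ^∞⟮𝓘(ℝ, EM); F, V⟯) : Cₛ^∞⟮𝓘(ℝ, EM); F, V⟯ :=
  ⟨fun x => f x • σ x, hf.smul_section σ.contMDiff⟩

@[simp] theorem smulSection_apply {f : M → ℝ} (hf : ContMDiff 𝓘(ℝ, EM) 𝓘(ℝ, ℝ) ∞ f)
    (σ : Cₛ^∞⟮𝓘(ℝ, EM); F, V⟯) (x : M) : 𝒜.smulSection hf σ x = f x • σ x := rfl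

/-- The section `φ · s`, where `s` is given by its fibre coordinates and `φ` is supported in the
coordinate domain. -/
noncomputable def cutoffSection {x₀ : M} {φ : M → ℝ} (hφ : ContMDiff 𝓘(ℝ, EM) 𝓘(ℝ, ℝ) ∞ φ)
    (hs : tsupport φ ⊆ 𝒜.dom x₀) (v : F) : Cₛ^∞⟮𝓘(ℝ, EM); F, V⟯ :=
  ⟨φ • (fun x => 𝒜.fibInv x₀ x v), by
    refine ContMDiffOn.smul_section_of_tsupport (u := 𝒜.dom x₀) hφ.contMDiffOn
      (𝒜.isOpen_dom x₀) hs ?_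
    refine ((trivializationAt F V x₀).contMDiffOn_section_iff (𝒜.isOpen_dom x₀) fun x hx => hx.2).2 ?_
    refine (contMDiffOn_const (c := v)).congr fun x hx => ?_
    have := 𝒜.fibMap_fibInv hx v
    rwa [fibMap, Trivialization.linearMapAt_apply, if_pos hx.2] at this⟩

theorem cutoffSection_apply {x₀ : M} {φ : M → ℝ} (hφ : ContMDiff 𝓘(ℝ, EM) 𝓘(ℝ, ℝ) ∞ φ)
    (hs : tsupport φ ⊆ 𝒜.dom x₀) (v : F) (x : M) :
    𝒜.cutoffSection hφ hs v x = φ x • 𝒜.fibInv x₀ x v := rfl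

theorem fibMap_cutoffSection {x₀ : M} {φ : M → ℝ} (hφ : ContMDiff 𝓘(ℝ, EM) 𝓘(ℝ, ℝ) ∞ φ)
    (hs : tsupport φ ⊆ 𝒜.dom x₀) (v : F) {x : M} (hx : x ∈ 𝒜.dom x₀) :
    𝒜.fibMap x₀ x (𝒜.cutoffSection hφ hs v x) = φ x • v := by
  rw [cutoffSection_apply, map_smul, 𝒜.fibMap_fibInv hx]

end

end LieAlgebroid

namespace LieAlgebroid

section

variable {EM F : Type*} {M : Type*} {V : M → Type*}
  [NormedAddCommGroup EM] [NormedSpace ℝ EM]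
  [NormedAddCommGroup F] [NormedSpace ℝ F]
  [TopologicalSpace M] [ChartedSpace EM M] [IsManifold 𝓘(ℝ, EM) ∞ M]
  [TopologicalSpace (TotalSpace F V)] [∀ x, TopologicalSpace (V x)] [FiberBundle F V]
  [∀ x, AddCommGroup (V x)] [∀ x, Module ℝ (V x)] [VectorBundle ℝ F V]
  [ContMDiffVectorBundle ∞ F V 𝓘(ℝ, EM)]
  (𝒜 : LieAlgebroid EM F V)

/-! ### The bracket in local coordinates -/

theorem bracket_swap (σ η : Cₛ^∞⟮𝓘(ℝ, EM); F, V⟯) : 𝒜.bracket σ η = -𝒜.bracket η σ := by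
  have h := 𝒜.bracket_self (σ + η)
  rw [𝒜.bracket_add_left, 𝒜.bracket_add_right, 𝒜.bracket_add_right, 𝒜.bracket_self,
    𝒜.bracket_self, zero_add, add_zero] at h
  exact eq_neg_of_add_eq_zero_left h

theorem bracket_smulSection {f : M → ℝ} (hf : ContMDiff 𝓘(ℝ, EM) 𝓘(ℝ, ℝ) ∞ f)
    (σ η : Cₛ^∞⟮𝓘(ℝ, EM); F, V⟯) (x : M) :
    𝒜.bracket σ (𝒜.smulSection hf η) x =
      tangentDeriv 𝓘(ℝ, EM) f x (𝒜.anchor x (σ x)) • η x + f x • 𝒜.bracket σ η x :=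
  𝒜.leibniz f hf σ η _ (fun _ => rfl) x

theorem secLoc_smulSection (x₀ : M) {f : M → ℝ} (hf : ContMDiff 𝓘(ℝ, EM) 𝓘(ℝ, ℝ) ∞ f)
    (σ : Cₛ^∞⟮𝓘(ℝ, EM); F, V⟯) (u : EM) :
    𝒜.secLoc x₀ (𝒜.smulSection hf σ) u =
      f ((chartAt EM x₀).symm u) • 𝒜.secLoc x₀ σ u := by
  simp [secLoc]

theorem differentiableAt_comp_symm {x₀ : M} {u : EM} (hu : u ∈ 𝒜.cdom x₀) {f : M → ℝ}
    (hf : ContMDiff 𝓘(ℝ, EM) 𝓘(ℝ, ℝ) ∞ f) :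
    DifferentiableAt ℝ (fun u => f ((chartAt EM x₀).symm u)) u :=
  ((𝒜.contDiffOn_comp_symm x₀ (hf.contMDiffOn (s := 𝒜.dom x₀))).contDiffAt
    (Filter.inter_mem ((𝒜.isOpen_cdom x₀).mem_nhds hu) (Filter.mem_of_superset
      ((𝒜.isOpen_cdom x₀).mem_nhds hu) fun _ h => h.2))).differentiableAt (by simp)

/-- The failure of the coordinate expression of the bracket at `u` to be the one of a constant
structure. -/
noncomputable def bracketDefect (x₀ : M) (u : EM) (σ η : Cₛ^∞⟮𝓘(ℝ, EM); F, V⟯) : F :=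
  𝒜.secLoc x₀ (𝒜.bracket σ η) u
    - fderiv ℝ (𝒜.secLoc x₀ η) u (𝒜.localAnchor x₀ (u, 𝒜.secLoc x₀ σ u))
    + fderiv ℝ (𝒜.secLoc x₀ σ) u (𝒜.localAnchor x₀ (u, 𝒜.secLoc x₀ η u))

theorem bracketDefect_swap (x₀ : M) (u : EM) (σ η : Cₛ^∞⟮𝓘(ℝ, EM); F, V⟯) :
    𝒜.bracketDefect x₀ u σ η = -𝒜.bracketDefect x₀ u η σ := by
  have h : 𝒜.secLoc x₀ (𝒜.bracket σ η) u = -𝒜.secLoc x₀ (𝒜.bracket η σ) u := by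
    rw [𝒜.bracket_swap]; simp [secLoc]
  simp only [bracketDefect, h]
  abel

theorem bracketDefect_add_right {x₀ : M} {u : EM} (hu : u ∈ 𝒜.cdom x₀)
    (σ η η' : Cₛ^∞⟮𝓘(ℝ, EM); F, V⟯) :
    𝒜.bracketDefect x₀ u σ (η + η') =
      𝒜.bracketDefect x₀ u σ η + 𝒜.bracketDefect x₀ u σ η' := by
  simp only [bracketDefect]
  rw [𝒜.bracket_add_right, secLoc_add, secLoc_add,
    fderiv_add (𝒜.differentiableAt_secLoc hu η) (𝒜.differentiableAt_secLoc hu η')]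
  simp only [Pi.add_apply]
  rw [𝒜.localAnchor_add hu, map_add, _root_.add_apply]
  abel

/-- The Leibniz term `(ρ(σ)f) η` of the bracket is cancelled by the derivative of `f` in the
coordinate derivative of `f η`. Thus the defect is tensorial, which is what makes structure
functions possible. -/
theorem bracketDefect_smul_right {x₀ : M} {u : EM} (hu : u ∈ 𝒜.cdom x₀)
    {f : M → ℝ} (hf : ContMDiff 𝓘(ℝ, EM) 𝓘(ℝ, ℝ) ∞ f) (σ η : Cₛ^∞⟮𝓘(ℝ, EM); F, V⟯) :
    𝒜.bracketDefect x₀ u σ (𝒜.smulSection hf η) =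
      f ((chartAt EM x₀).symm u) • 𝒜.bracketDefect x₀ u σ η := by
  have h1 : 𝒜.secLoc x₀ (𝒜.smulSection hf η) =
      fun u => f ((chartAt EM x₀).symm u) • 𝒜.secLoc x₀ η u :=
    funext fun u => 𝒜.secLoc_smulSection x₀ hf η u
  have h2 : 𝒜.secLoc x₀ (𝒜.bracket σ (𝒜.smulSection hf η)) u =
      fderiv ℝ (fun u => f ((chartAt EM x₀).symm u)) u
        (𝒜.localAnchor x₀ (u, 𝒜.secLoc x₀ σ u)) • 𝒜.secLoc x₀ η u +
      f ((chartAt EM x₀).symm u) • 𝒜.secLoc x₀ (𝒜.bracket σ η) u := by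
    rw [← 𝒜.tangentDeriv_anchor' hu hf]
    simp only [secLoc]
    rw [𝒜.bracket_smulSection, map_add, map_smul, map_smul]
  simp only [bracketDefect]
  rw [h2, h1, fderiv_fun_smul (𝒜.differentiableAt_comp_symm hu hf)
    (𝒜.differentiableAt_secLoc hu η), 𝒜.localAnchor_smul hu]
  simp only [_root_.add_apply, _root_.smul_apply,
    ContinuousLinearMap.smulRight_apply, map_smul, smul_add, smul_sub]
  abel

variable [FiniteDimensional ℝ EM] [FiniteDimensional ℝ F] [T2Space M]

theorem exists_cutoff (EM : Type*) [NormedAddCommGroup EM] [NormedSpace ℝ EM]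
    [FiniteDimensional ℝ EM] [ChartedSpace EM M] [IsManifold 𝓘(ℝ, EM) ∞ M]
    {x : M} {O : Set M} (hO : IsOpen O) (hx : x ∈ O) :
    ∃ φ : M → ℝ, ContMDiff 𝓘(ℝ, EM) 𝓘(ℝ, ℝ) ∞ φ ∧ tsupport φ ⊆ O ∧ φ =ᶠ[𝓝 x] 1 := by
  obtain ⟨φ, -, h⟩ := (SmoothBumpFunction.nhds_basis_tsupport (I := 𝓘(ℝ, EM)) x).mem_iff.1
    (hO.mem_nhds hx)
  exact ⟨φ, φ.contMDiff, h, φ.eventuallyEq_one⟩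

/-- A `C^∞`-linear map on sections with values in the fibre at `x` only depends on the value of
the section at `x`. -/
theorem eq_zero_of_tensorial {G : Type*} [AddCommGroup G] [Module ℝ G] (x : M)
    (T : Cₛ^∞⟮𝓘(ℝ, EM); F, V⟯ →+ G)
    (hT : ∀ (f : M → ℝ) (hf : ContMDiff 𝓘(ℝ, EM) 𝓘(ℝ, ℝ) ∞ f) η,
      T (𝒜.smulSection hf η) = f x • T η)
    (η : Cₛ^∞⟮𝓘(ℝ, EM); F, V⟯) (hη : η x = 0) : T η = 0 := by
  obtain ⟨φ, hφ, hs, h1⟩ := exists_cutoff EM (𝒜.isOpen_dom x) (𝒜.mem_dom x)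
  have hφx : φ x = 1 := h1.self_of_nhds
  let b := Module.finBasis ℝ F
  let c : Fin (Module.finrank ℝ F) → M → ℝ := fun i y =>
    φ y • b.repr (𝒜.fibMap x y (η y)) i
  have hc : ∀ i, ContMDiff 𝓘(ℝ, EM) 𝓘(ℝ, ℝ) ∞ (c i) := by
    intro i
    refine contMDiff_of_tsupport fun y hy => ?_
    have hy' : y ∈ 𝒜.dom x := hs (closure_mono (Function.support_smul_subset_left _ _) hy)
    let L : F →L[ℝ] ℝ := LinearMap.toContinuousLinearMap (b.coord i)
    have h2 : ContMDiffAt 𝓘(ℝ, EM) 𝓘(ℝ, ℝ) ∞ (fun y => L (𝒜.fibMap x y (η y))) y :=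
      (L.contDiff (n := ∞)).contMDiff.contMDiffAt.comp y ((𝒜.contMDiffOn_fibMap x η).contMDiffAt
        ((𝒜.isOpen_dom x).mem_nhds hy'))
    exact (hφ y).smul h2
  -- The section is expanded in the local frame. One factor `φ` globalises the coefficients and the
  -- other the frame, so `φ² η` is an honest global combination. At `x` the cutoff is `1` and the
  -- coefficients vanish with `η x`.
  have key : 𝒜.smulSection (hφ.mul hφ) η =
      ∑ i, 𝒜.smulSection (hc i) (𝒜.cutoffSection hφ hs (b i)) := by
    ext y
    have hsum : (∑ i, 𝒜.smulSection (hc i) (𝒜.cutoffSection hφ hs (b i))) y =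
        ∑ i, 𝒜.smulSection (hc i) (𝒜.cutoffSection hφ hs (b i)) y := by
      let ev : Cₛ^∞⟮𝓘(ℝ, EM); F, V⟯ →+ V y := AddMonoidHom.mk' (fun σ => σ y) fun _ _ => rfl
      exact map_sum ev _ _
    rw [hsum]
    by_cases hy : y ∈ 𝒜.dom x
    · simp only [smulSection_apply, cutoffSection_apply, c]
      have h3 : (φ * φ) y • η y = (φ y * φ y) • 𝒜.fibInv x y (𝒜.fibMap x y (η y)) := by
        rw [𝒜.fibInv_fibMap hy]; rfl
      rw [h3]
      conv_lhs => rw [← b.sum_repr (𝒜.fibMap x y (η y))]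
      rw [map_sum, Finset.smul_sum]
      refine Finset.sum_congr rfl fun i _ => ?_
      rw [map_smul, smul_smul, smul_smul, smul_eq_mul]
      congr 1
      ring
    · have h0 : φ y = 0 := image_eq_zero_of_notMem_tsupport fun h => hy (hs h)
      simp [cutoffSection_apply, h0]
  have h4 := congrArg T key
  rw [map_sum, hT] at h4
  simp only [hT, Pi.mul_apply, hφx, mul_one, one_smul] at h4
  rw [h4]
  refine Finset.sum_eq_zero fun i _ => ?_
  simp [c, hη]

theorem bracketDefect_congr_right {x₀ : M} {u : EM} (hu : u ∈ 𝒜.cdom x₀)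
    (σ η η' : Cₛ^∞⟮𝓘(ℝ, EM); F, V⟯) (h : 𝒜.secLoc x₀ η u = 𝒜.secLoc x₀ η' u) :
    𝒜.bracketDefect x₀ u σ η = 𝒜.bracketDefect x₀ u σ η' := by
  let T : Cₛ^∞⟮𝓘(ℝ, EM); F, V⟯ →+ F :=
    AddMonoidHom.mk' (𝒜.bracketDefect x₀ u σ) (𝒜.bracketDefect_add_right hu σ)
  have hT := 𝒜.eq_zero_of_tensorial ((chartAt EM x₀).symm u) T
    (fun f hf ζ => 𝒜.bracketDefect_smul_right hu hf σ ζ) (η - η') (by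
      have h' := congrArg (𝒜.fibInv x₀ ((chartAt EM x₀).symm u)) h
      simp only [secLoc] at h'
      rw [𝒜.fibInv_fibMap hu.2, 𝒜.fibInv_fibMap hu.2] at h'
      simp [h'])
  rw [map_sub, sub_eq_zero] at hT
  exact hT

theorem bracketDefect_congr {x₀ : M} {u : EM} (hu : u ∈ 𝒜.cdom x₀)
    {σ σ' η η' : Cₛ^∞⟮𝓘(ℝ, EM); F, V⟯} (h : 𝒜.secLoc x₀ σ u = 𝒜.secLoc x₀ σ' u)
    (h' : 𝒜.secLoc x₀ η u = 𝒜.secLoc x₀ η' u) :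
    𝒜.bracketDefect x₀ u σ η = 𝒜.bracketDefect x₀ u σ' η' := by
  rw [𝒜.bracketDefect_congr_right hu σ η η' h', 𝒜.bracketDefect_swap,
    𝒜.bracketDefect_congr_right hu η' σ σ' h, ← 𝒜.bracketDefect_swap]

/-- Sections with constant coordinate expression near a given point. -/
theorem exists_section_const {x₀ : M} {u : EM} (hu : u ∈ 𝒜.cdom x₀) :
    ∃ E : F → Cₛ^∞⟮𝓘(ℝ, EM); F, V⟯, (∀ᶠ u' in 𝓝 u, ∀ v, 𝒜.secLoc x₀ (E v) u' = v) ∧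
      (∀ v w, E (v + w) = E v + E w) := by
  obtain ⟨φ, hφ, hs, h1⟩ := exists_cutoff EM (𝒜.isOpen_dom x₀) hu.2
  refine ⟨𝒜.cutoffSection hφ hs, ?_, ?_⟩
  · have hcont : ContinuousAt (chartAt EM x₀).symm u :=
      (chartAt EM x₀).continuousAt_symm hu.1
    filter_upwards [(𝒜.isOpen_cdom x₀).mem_nhds hu, hcont.eventually h1] with u' h2 h3 v
    rw [secLoc, 𝒜.fibMap_cutoffSection hφ hs v h2.2, h3]
    exact one_smul _ _
  · intro v w
    ext x
    simp [cutoffSection_apply]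

/-- The structure functions of the Lie algebroid in local coordinates. -/
theorem exists_structure (x₀ : M) : ∃ C : EM → F →L[ℝ] F →L[ℝ] F,
    ContDiffOn ℝ ∞ C (𝒜.cdom x₀) ∧ ∀ u ∈ 𝒜.cdom x₀, ∀ σ η : Cₛ^∞⟮𝓘(ℝ, EM); F, V⟯,
      𝒜.bracketDefect x₀ u σ η = C u (𝒜.secLoc x₀ σ u) (𝒜.secLoc x₀ η u) := by
  have hpt : ∀ u : EM, ∃ c : F →L[ℝ] F →L[ℝ] F, u ∈ 𝒜.cdom x₀ →
      ∀ σ η : Cₛ^∞⟮𝓘(ℝ, EM); F, V⟯,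
        𝒜.bracketDefect x₀ u σ η = c (𝒜.secLoc x₀ σ u) (𝒜.secLoc x₀ η u) := by
    intro u
    by_cases hu : u ∈ 𝒜.cdom x₀
    swap
    · exact ⟨0, fun h => absurd h hu⟩
    obtain ⟨E, hE, hadd⟩ := 𝒜.exists_section_const hu
    have hE0 := hE.self_of_nhds
    -- By tensoriality the defect depends only on the values at `u`, so evaluating it on any
    -- extensions of `v` and `w` loses nothing. Linearity in the first slot comes from skew
    -- symmetry.
    let c : F → F → F := fun v w => 𝒜.bracketDefect x₀ u (E v) (E w)
    have hadd_r : ∀ v w w', c v (w + w') = c v w + c v w' := fun v w w' => by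
      simp only [c]; rw [hadd, 𝒜.bracketDefect_add_right hu]
    have hswap : ∀ v w, c v w = -c w v := fun v w => 𝒜.bracketDefect_swap x₀ u _ _
    have hsmul_r : ∀ v (r : ℝ) w, c v (r • w) = r • c v w := fun v r w => by
      have h := 𝒜.bracketDefect_smul_right hu (f := fun _ => r) contMDiff_const (E v) (E w)
      rw [← h]
      refine 𝒜.bracketDefect_congr hu rfl ?_
      rw [hE0, secLoc_smulSection, hE0]
    let B : F →ₗ[ℝ] F →ₗ[ℝ] F := LinearMap.mk₂ ℝ c
      (fun v v' w => by rw [hswap, hadd_r, neg_add, ← hswap, ← hswap])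
      (fun r v w => by rw [hswap, hsmul_r, ← smul_neg, ← hswap])
      hadd_r (fun r v w => hsmul_r v r w)
    refine ⟨LinearMap.toContinuousLinearMap
      ((LinearMap.toContinuousLinearMap : (F →ₗ[ℝ] F) ≃ₗ[ℝ] (F →L[ℝ] F)).toLinearMap.comp B),
      fun _ σ η => ?_⟩
    show _ = 𝒜.bracketDefect x₀ u (E _) (E _)
    exact 𝒜.bracketDefect_congr hu (hE0 _).symm (hE0 _).symm
  choose C hC using hpt
  refine ⟨C, ?_, fun u hu => hC u hu⟩
  rw [contDiffOn_clm_apply]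
  intro v
  rw [contDiffOn_clm_apply]
  intro w u₁ hu₁
  obtain ⟨E, hE, -⟩ := 𝒜.exists_section_const hu₁
  refine ContDiffAt.contDiffWithinAt ?_
  have h1 : ContDiffAt ℝ ∞ (𝒜.secLoc x₀ (𝒜.bracket (E v) (E w))) u₁ :=
    (𝒜.contDiffOn_secLoc x₀ _).contDiffAt ((𝒜.isOpen_cdom x₀).mem_nhds hu₁)
  refine h1.congr_of_eventuallyEq ?_
  filter_upwards [hE.eventually_nhds, (𝒜.isOpen_cdom x₀).mem_nhds hu₁] with u h2 h3
  have h4 := hC u h3 (E v) (E w)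
  -- On locally constant sections the derivative terms of the defect vanish. Near `u₁` the function
  -- `C · v w` is therefore the coordinate expression of one fixed bracket, hence smooth, although
  -- `C` was chosen pointwise.
  have h5 : ∀ v, fderiv ℝ (𝒜.secLoc x₀ (E v)) u = 0 := fun v => by
    have : 𝒜.secLoc x₀ (E v) =ᶠ[𝓝 u] fun _ => v := h2.mono fun u' h => h v
    rw [this.fderiv_eq]; simp
  rw [h2.self_of_nhds v, h2.self_of_nhds w, bracketDefect, h5, h5] at h4
  simpa using h4.symm

/-- The structure functions of the Lie algebroid in the local coordinates at `x₀`. -/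
noncomputable def structureFun (x₀ : M) : EM → F →L[ℝ] F →L[ℝ] F :=
  (𝒜.exists_structure x₀).choose

theorem contDiffOn_structureFun (x₀ : M) :
    ContDiffOn ℝ ∞ (𝒜.structureFun x₀) (𝒜.cdom x₀) :=
  (𝒜.exists_structure x₀).choose_spec.1

theorem secLoc_bracket {x₀ : M} {u : EM} (hu : u ∈ 𝒜.cdom x₀)
    (σ η : Cₛ^∞⟮𝓘(ℝ, EM); F, V⟯) :
    𝒜.secLoc x₀ (𝒜.bracket σ η) u =
      fderiv ℝ (𝒜.secLoc x₀ η) u (𝒜.localAnchor x₀ (u, 𝒜.secLoc x₀ σ u))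
      - fderiv ℝ (𝒜.secLoc x₀ σ) u (𝒜.localAnchor x₀ (u, 𝒜.secLoc x₀ η u))
      + 𝒜.structureFun x₀ u (𝒜.secLoc x₀ σ u) (𝒜.secLoc x₀ η u) := by
  rw [structureFun, ← (𝒜.exists_structure x₀).choose_spec.2 u hu σ η, bracketDefect]
  abel

/-! ### The anchor preserves brackets -/

/-- The derivative of a function along the anchor of a section. -/
noncomputable def anchorDeriv (σ : Cₛ^∞⟮𝓘(ℝ, EM); F, V⟯) (f : M → ℝ) (x : M) : ℝ :=
  tangentDeriv 𝓘(ℝ, EM) f x (𝒜.anchor x (σ x))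

theorem contMDiff_anchorDeriv (σ : Cₛ^∞⟮𝓘(ℝ, EM); F, V⟯) {f : M → ℝ}
    (hf : ContMDiff 𝓘(ℝ, EM) 𝓘(ℝ, ℝ) ∞ f) :
    ContMDiff 𝓘(ℝ, EM) 𝓘(ℝ, ℝ) ∞ (𝒜.anchorDeriv σ f) := by
  intro x
  have h1 : ContDiffOn ℝ ∞ (fun u => fderiv ℝ (fun u => f ((chartAt EM x).symm u)) u
      (𝒜.localAnchor x (u, 𝒜.secLoc x σ u))) (𝒜.cdom x) := by
    have h2 : ContDiffOn ℝ ∞ (fun u => f ((chartAt EM x).symm u)) (𝒜.cdom x) :=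
      (𝒜.contDiffOn_comp_symm x (hf.contMDiffOn (s := 𝒜.dom x))).mono fun u hu => ⟨hu, hu.2⟩
    refine (h2.fderiv_of_isOpen (m := ∞) (𝒜.isOpen_cdom x) (by simp)).clm_apply ?_
    exact (𝒜.contDiffOn_localAnchor x).comp (f := fun u => (u, 𝒜.secLoc x σ u))
      (contDiffOn_id.prodMk (𝒜.contDiffOn_secLoc x σ)) fun u hu => ⟨hu, mem_univ _⟩
  have h3 : ContMDiffOn 𝓘(ℝ, EM) 𝓘(ℝ, EM) ∞ (chartAt EM x) (𝒜.dom x) :=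
    (contMDiffOn_chart (I := 𝓘(ℝ, EM)) (n := ∞) (x := x)).mono inter_subset_left
  have h4 := (contMDiffOn_iff_contDiffOn.2 h1).comp h3 fun y hy => 𝒜.chart_mem_cdom hy
  refine (h4.congr fun y hy => ?_).contMDiffAt ((𝒜.isOpen_dom x).mem_nhds (𝒜.mem_dom x))
  rw [anchorDeriv, 𝒜.tangentDeriv_anchor hy (hf.mdifferentiable (by simp) _)]
  simp only [Function.comp_apply, secLoc]
  rw [(chartAt EM x).left_inv hy.1]

/-- Expand the Jacobi identity for `σ`, `η`, `f ζ` by the Leibniz rule. The mixed first-order terms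
cancel, the terms carrying `f` itself cancel by Jacobi for `ζ`, and what remains compares `ρ[σ, η]f`
with the commutator of the two derivations, times `ζ`. -/
theorem anchorDeriv_bracket_smul (σ η ζ : Cₛ^∞⟮𝓘(ℝ, EM); F, V⟯) {f : M → ℝ}
    (hf : ContMDiff 𝓘(ℝ, EM) 𝓘(ℝ, ℝ) ∞ f) (x : M) :
    𝒜.anchorDeriv (𝒜.bracket σ η) f x • ζ x =
      (𝒜.anchorDeriv σ (𝒜.anchorDeriv η f) x - 𝒜.anchorDeriv η (𝒜.anchorDeriv σ f) x) • ζ x := by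
  have hσ := 𝒜.contMDiff_anchorDeriv σ hf
  have hη := 𝒜.contMDiff_anchorDeriv η hf
  have hl : ∀ (σ ζ : Cₛ^∞⟮𝓘(ℝ, EM); F, V⟯) {f : M → ℝ} (hf : ContMDiff 𝓘(ℝ, EM) 𝓘(ℝ, ℝ) ∞ f),
      𝒜.bracket σ (𝒜.smulSection hf ζ) =
        𝒜.smulSection (𝒜.contMDiff_anchorDeriv σ hf) ζ + 𝒜.smulSection hf (𝒜.bracket σ ζ) :=
    fun σ ζ f hf => by ext y; exact 𝒜.bracket_smulSection hf σ ζ y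
  have hneg : ∀ σ τ : Cₛ^∞⟮𝓘(ℝ, EM); F, V⟯, 𝒜.bracket σ (-τ) = -𝒜.bracket σ τ := fun σ τ => by
    have h := 𝒜.bracket_add_right σ τ (-τ)
    have h0 := 𝒜.bracket_add_right σ 0 0
    rw [add_zero] at h0
    rw [add_neg_cancel, left_eq_add.1 h0] at h
    exact (neg_eq_of_add_eq_zero_right h.symm).symm
  have j1 := 𝒜.jacobi σ η (𝒜.smulSection hf ζ)
  have j0 := congrArg (fun τ : Cₛ^∞⟮𝓘(ℝ, EM); F, V⟯ => τ x) (𝒜.jacobi σ η ζ)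
  rw [𝒜.bracket_swap (𝒜.smulSection hf ζ) σ, 𝒜.bracket_swap (𝒜.smulSection hf ζ) (𝒜.bracket σ η),
    hneg, hl, hl, hl, 𝒜.bracket_add_right, 𝒜.bracket_add_right, hl, hl, hl, hl] at j1
  rw [𝒜.bracket_swap ζ σ, 𝒜.bracket_swap ζ (𝒜.bracket σ η), hneg] at j0
  have j2 := congrArg (fun τ : Cₛ^∞⟮𝓘(ℝ, EM); F, V⟯ => τ x) j1
  simp only [ContMDiffSection.coe_add, ContMDiffSection.coe_neg, Pi.add_apply, Pi.neg_apply,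
    smulSection_apply, ContMDiffSection.coe_zero, Pi.zero_apply] at j0 j2
  have j3 : 𝒜.bracket σ (𝒜.bracket η ζ) x = 𝒜.bracket η (𝒜.bracket σ ζ) x +
      𝒜.bracket (𝒜.bracket σ η) ζ x := by
    rw [← sub_eq_zero, ← j0]; abel
  rw [j3] at j2
  rw [sub_smul]
  rw [← sub_eq_zero, ← neg_eq_zero, ← j2, smul_add]
  abel

/-- The anchor is a morphism of Lie algebras, in coordinates. -/
theorem localAnchor_bracket {x₀ : M} {u : EM} (hu : u ∈ 𝒜.cdom x₀)
    (σ η : Cₛ^∞⟮𝓘(ℝ, EM); F, V⟯) :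
    𝒜.localAnchor x₀ (u, 𝒜.secLoc x₀ (𝒜.bracket σ η) u) =
      fderiv ℝ (fun u => 𝒜.localAnchor x₀ (u, 𝒜.secLoc x₀ η u)) u
        (𝒜.localAnchor x₀ (u, 𝒜.secLoc x₀ σ u))
      - fderiv ℝ (fun u => 𝒜.localAnchor x₀ (u, 𝒜.secLoc x₀ σ u)) u
        (𝒜.localAnchor x₀ (u, 𝒜.secLoc x₀ η u)) := by
  have h0 : ∀ u ∈ 𝒜.cdom x₀, 𝒜.localAnchor x₀ (u, 0) = 0 := fun u hu => by
    have := 𝒜.localAnchor_smul hu 0 0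
    rwa [zero_smul, zero_smul] at this
  -- In rank zero there is no nonzero section `ζ` to cancel in `anchorDeriv_bracket_smul`; there,
  -- both sides vanish.
  rcases subsingleton_or_nontrivial F with hF | hF
  · have h1 : ∀ σ : Cₛ^∞⟮𝓘(ℝ, EM); F, V⟯,
        (fun u => 𝒜.localAnchor x₀ (u, 𝒜.secLoc x₀ σ u)) =ᶠ[𝓝 u] fun _ => 0 := fun σ => by
      filter_upwards [(𝒜.isOpen_cdom x₀).mem_nhds hu] with u' hu'
      rw [Subsingleton.elim (𝒜.secLoc x₀ σ u') 0, h0 u' hu']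
    rw [(h1 σ).fderiv_eq, (h1 η).fderiv_eq, Subsingleton.elim (𝒜.secLoc x₀ _ u) 0, h0 u hu]
    simp
  obtain ⟨φ, hφ, hs, h1⟩ := exists_cutoff EM (𝒜.isOpen_dom x₀) hu.2
  have hcont : ContinuousAt (chartAt EM x₀).symm u := (chartAt EM x₀).continuousAt_symm hu.1
  have hφu : ∀ᶠ u' in 𝓝 u, φ ((chartAt EM x₀).symm u') = 1 ∧ u' ∈ 𝒜.cdom x₀ :=
    (hcont.eventually h1).and ((𝒜.isOpen_cdom x₀).mem_nhds hu)
  obtain ⟨v, hv⟩ := exists_ne (0 : F)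
  refine (SeparatingDual.eq_iff_forall_dual_eq (R := ℝ)).2 fun ℓ => ?_
  -- Cut-off linear coordinate functions are the test functions. Near `u` the coordinate expression
  -- is `ℓ` itself, so differentiating along an anchored section returns `ℓ` of its anchor, and such
  -- `ℓ` separate points of `EM`.
  let f : M → ℝ := fun x => φ x • ℓ (chartAt EM x₀ x)
  have hf : ContMDiff 𝓘(ℝ, EM) 𝓘(ℝ, ℝ) ∞ f := by
    refine contMDiff_of_tsupport fun y hy => ?_
    have hy' : y ∈ 𝒜.dom x₀ := hs (closure_mono (Function.support_smul_subset_left _ _) hy)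
    refine (hφ y).smul ?_
    exact (ℓ.contDiff (n := ∞)).contMDiff.contMDiffAt.comp y
      ((contMDiffOn_chart (I := 𝓘(ℝ, EM)) (n := ∞) (x := x₀)).contMDiffAt
        ((chartAt EM x₀).open_source.mem_nhds hy'.1))
  have hfu : (fun u => f ((chartAt EM x₀).symm u)) =ᶠ[𝓝 u] ℓ := by
    filter_upwards [hφu] with u' h2
    simp only [f]
    rw [h2.1, one_smul, (chartAt EM x₀).right_inv h2.2.1]
  have hd : ∀ σ : Cₛ^∞⟮𝓘(ℝ, EM); F, V⟯,
      (fun u => 𝒜.anchorDeriv σ f ((chartAt EM x₀).symm u)) =ᶠ[𝓝 u]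
        fun u => ℓ (𝒜.localAnchor x₀ (u, 𝒜.secLoc x₀ σ u)) := fun σ => by
    filter_upwards [hfu.eventually_nhds, hφu] with u' h2 h3
    rw [anchorDeriv, 𝒜.tangentDeriv_anchor' h3.2 hf, Filter.EventuallyEq.fderiv_eq h2]
    simp
  have hdiff : ∀ σ : Cₛ^∞⟮𝓘(ℝ, EM); F, V⟯,
      DifferentiableAt ℝ (fun u => 𝒜.localAnchor x₀ (u, 𝒜.secLoc x₀ σ u)) u := fun σ => by
    have h2 : ContDiffOn ℝ ∞ (fun u => 𝒜.localAnchor x₀ (u, 𝒜.secLoc x₀ σ u)) (𝒜.cdom x₀) :=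
      (𝒜.contDiffOn_localAnchor x₀).comp (f := fun u => (u, 𝒜.secLoc x₀ σ u))
        (contDiffOn_id.prodMk (𝒜.contDiffOn_secLoc x₀ σ)) fun u hu => ⟨hu, mem_univ _⟩
    exact (h2.contDiffAt ((𝒜.isOpen_cdom x₀).mem_nhds hu)).differentiableAt (by simp)
  have hdd : ∀ σ η : Cₛ^∞⟮𝓘(ℝ, EM); F, V⟯,
      𝒜.anchorDeriv σ (𝒜.anchorDeriv η f) ((chartAt EM x₀).symm u) =
        ℓ (fderiv ℝ (fun u => 𝒜.localAnchor x₀ (u, 𝒜.secLoc x₀ η u)) u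
          (𝒜.localAnchor x₀ (u, 𝒜.secLoc x₀ σ u))) := fun σ η => by
    rw [anchorDeriv, 𝒜.tangentDeriv_anchor' hu (𝒜.contMDiff_anchorDeriv η hf),
      (hd η).fderiv_eq]
    have := (ℓ.hasFDerivAt.comp u (hdiff η).hasFDerivAt).fderiv
    simp only [Function.comp_def] at this
    rw [this]
    rfl
  have key := 𝒜.anchorDeriv_bracket_smul σ η (𝒜.cutoffSection hφ hs v) hf
    ((chartAt EM x₀).symm u)
  have hne : 𝒜.cutoffSection hφ hs v ((chartAt EM x₀).symm u) ≠ 0 := by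
    intro h
    have h2 := 𝒜.fibMap_cutoffSection hφ hs v hu.2
    rw [h, map_zero, hφu.self_of_nhds.1, one_smul] at h2
    exact hv h2.symm
  have key2 := smul_left_injective ℝ hne key
  rw [hdd, hdd] at key2
  rw [map_sub, ← key2]
  exact (hd _).self_of_nhds.symm

end

end LieAlgebroid

namespace JetCalculus

section

variable {EM F G : Type*} [NormedAddCommGroup EM] [NormedSpace ℝ EM]
  [NormedAddCommGroup F] [NormedSpace ℝ F] [NormedAddCommGroup G] [NormedSpace ℝ G]

/-! ### One-forms in coordinates and their total derivatives -/

/-- Reindexing of families, as a continuous linear map. -/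
def reindex (F : Type*) [NormedAddCommGroup F] [NormedSpace ℝ F] {m n : ℕ} (f : Fin n → Fin m) :
    (Fin m → F) →L[ℝ] (Fin n → F) :=
  ContinuousLinearMap.pi fun i => ContinuousLinearMap.proj (f i)

@[simp] theorem reindex_apply {m n : ℕ} (f : Fin n → Fin m) (y : Fin m → F) (i : Fin n) :
    reindex F f y i = y (f i) := rfl

/-- Restriction of coordinates of jets to lower order, as a continuous linear map. -/
def restrJet (EM F : Type*) [NormedAddCommGroup EM] [NormedSpace ℝ EM]
    [NormedAddCommGroup F] [NormedSpace ℝ F] {l k : ℕ} (h : l ≤ k) :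
    EM × (Fin k → F) →L[ℝ] EM × (Fin l → F) :=
  (ContinuousLinearMap.id ℝ EM).prodMap (reindex F (Fin.castLE h))

@[simp] theorem restrJet_fst {l k : ℕ} (h : l ≤ k) (p : EM × (Fin k → F)) :
    (restrJet EM F h p).1 = p.1 := rfl

@[simp] theorem restrJet_snd {l k : ℕ} (h : l ≤ k) (p : EM × (Fin k → F)) (i : Fin l) :
    (restrJet EM F h p).2 i = p.2 (Fin.castLE h i) := rfl

/-- The vector with fibre coordinates `z`. -/
def coVec (R : EM × F → EM) {k : ℕ} (u : EM) (z : Fin (k + 1) → F) : EM × (Fin k → F) :=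
  (R (u, z 0), fun i => z i.succ)

/-- Pullback of one-forms to higher order jets, in coordinates. -/
def pullbackLoc {l k : ℕ} (h : l ≤ k)
    (Λ : EM × (Fin l → F) → (Fin (l + 1) → F) →L[ℝ] G) :
    EM × (Fin k → F) → (Fin (k + 1) → F) →L[ℝ] G := fun p =>
  (Λ (restrJet EM F h p)).comp (reindex F (Fin.castLE (Nat.succ_le_succ h)))

/-- The shift of the fibre coordinates, corrected by a linear map in the first component. -/
noncomputable def shiftFib {k : ℕ} (c : F →L[ℝ] F) : (Fin (k + 2) → F) →L[ℝ] (Fin (k + 1) → F) :=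
  reindex F Fin.succ - (ContinuousLinearMap.single ℝ (fun _ : Fin (k + 1) => F) 0).comp
    (c.comp (ContinuousLinearMap.proj 0))

theorem shiftFib_apply {k : ℕ} (c : F →L[ℝ] F) (z : Fin (k + 2) → F) (i : Fin (k + 1)) :
    shiftFib c z i = z i.succ - if i = 0 then c (z 0) else 0 := by
  simp only [shiftFib, _root_.sub_apply, Pi.sub_apply, reindex_apply,
    ContinuousLinearMap.comp_apply, ContinuousLinearMap.single_apply,
    ContinuousLinearMap.proj_apply, Pi.single_apply]

/-- The total time derivative of a one-form, in coordinates, where `R` is the anchor and `C` the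
structure function. -/
noncomputable def totalDerivForm (R : EM × F → EM) (C : EM → F →L[ℝ] F →L[ℝ] F) {k : ℕ}
    (Λ : EM × (Fin k → F) → (Fin (k + 1) → F) →L[ℝ] G) :
    EM × (Fin (k + 1) → F) → (Fin (k + 2) → F) →L[ℝ] G := fun p =>
  (fderiv ℝ Λ (restrJet EM F k.le_succ p) (coVec R p.1 p.2)).comp
    (reindex F (Fin.castLE (Nat.succ_le_succ k.le_succ))) +
  (Λ (restrJet EM F k.le_succ p)).comp (shiftFib (C p.1 (p.2 0)))

/-- Extension of a finite family by zero. -/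
def extFam {k : ℕ} (y : Fin k → F) (j : ℕ) : F := if h : j < k then y ⟨j, h⟩ else 0

/-- The total derivative vector field, truncated to jets of fixed order. -/
def truncField (R : EM × F → EM) {k : ℕ} (p : EM × (Fin k → F)) : EM × (Fin k → F) :=
  (R (p.1, extFam p.2 0), fun i => extFam p.2 (i + 1))

/-- The fibre part of the total derivative, truncated to fixed order. -/
noncomputable def truncShift (C : EM → F →L[ℝ] F →L[ℝ] F) {k : ℕ} (p : EM × (Fin k → F)) :
    (Fin (k + 1) → F) →L[ℝ] (Fin (k + 1) → F) :=
  (ContinuousLinearMap.pi fun i : Fin (k + 1) =>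
    if h : (i : ℕ) + 1 < k + 1 then ContinuousLinearMap.proj ⟨i + 1, h⟩ else 0) -
  (ContinuousLinearMap.single ℝ (fun _ : Fin (k + 1) => F) 0).comp
      ((C p.1 (extFam p.2 0)).comp (ContinuousLinearMap.proj 0))

theorem truncShift_apply (C : EM → F →L[ℝ] F →L[ℝ] F) {k : ℕ} (p : EM × (Fin k → F))
    (z : Fin (k + 1) → F) (i : Fin (k + 1)) :
    truncShift C p z i =
      extFam z (i + 1) - if i = 0 then C p.1 (extFam p.2 0) (z 0) else 0 := by
  simp only [truncShift, _root_.sub_apply, Pi.sub_apply, ContinuousLinearMap.coe_pi',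
    ContinuousLinearMap.comp_apply, ContinuousLinearMap.single_apply,
    ContinuousLinearMap.proj_apply, Pi.single_apply, extFam]
  congr 1
  split_ifs <;> rfl

/-- The total derivative of one-forms, truncated to fixed order. -/
noncomputable def truncDeriv (R : EM × F → EM) (C : EM → F →L[ℝ] F →L[ℝ] F) {k : ℕ}
    (Λ : EM × (Fin k → F) → (Fin (k + 1) → F) →L[ℝ] G) :
    EM × (Fin k → F) → (Fin (k + 1) → F) →L[ℝ] G := fun p =>
  fderiv ℝ Λ p (truncField R p) + (Λ p).comp (truncShift C p)

/-- The total derivative of functions, truncated to fixed order. -/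
noncomputable def truncDerivFun (R : EM × F → EM) {k : ℕ}
    (θ : EM × (Fin k → F) → F →L[ℝ] G) : EM × (Fin k → F) → F →L[ℝ] G := fun p =>
  fderiv ℝ θ p (truncField R p)

theorem extFam_of_lt {k : ℕ} (y : Fin k → F) {j : ℕ} (h : j < k) : extFam y j = y ⟨j, h⟩ :=
  dif_pos h

/-- A total derivative raises the jet order by one, which makes iterates live on different spaces.
After pullback to order `k ≥ r + 1`, the derivative of an order-`r` form involves only entries that
exist on `Eᵏ`, so the zeros by which `truncDeriv` extends the families are never seen. All iterates
can thus be computed with one operator on a fixed space. -/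
theorem pullbackLoc_totalDerivForm (R : EM × F → EM) (C : EM → F →L[ℝ] F →L[ℝ] F) {r k : ℕ}
    (h : r + 1 ≤ k) (Λ : EM × (Fin r → F) → (Fin (r + 1) → F) →L[ℝ] G)
    (p : EM × (Fin k → F))
    (hd : DifferentiableAt ℝ Λ (restrJet EM F ((Nat.le_succ r).trans h) p)) :
    pullbackLoc h (totalDerivForm R C Λ) p =
      truncDeriv R C (pullbackLoc ((Nat.le_succ r).trans h) Λ) p := by
  have h1 : HasFDerivAt (pullbackLoc ((Nat.le_succ r).trans h) Λ)
      ((ContinuousLinearMap.compL ℝ (Fin (k + 1) → F) (Fin (r + 1) → F) G).flip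
        (reindex F (Fin.castLE (Nat.succ_le_succ ((Nat.le_succ r).trans h)))) ∘L
        ((fderiv ℝ Λ (restrJet EM F ((Nat.le_succ r).trans h) p)).comp
          (restrJet EM F ((Nat.le_succ r).trans h)))) p := by
    have h2 : HasFDerivAt (fun p => Λ (restrJet EM F ((Nat.le_succ r).trans h) p))
        ((fderiv ℝ Λ (restrJet EM F ((Nat.le_succ r).trans h) p)).comp
          (restrJet EM F ((Nat.le_succ r).trans h))) p :=
      hd.hasFDerivAt.comp p (restrJet EM F ((Nat.le_succ r).trans h)).hasFDerivAt
    exact ((ContinuousLinearMap.compL ℝ (Fin (k + 1) → F) (Fin (r + 1) → F) G).flip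
        (reindex F (Fin.castLE (Nat.succ_le_succ ((Nat.le_succ r).trans h))))).hasFDerivAt.comp p h2
  have e0 : extFam p.2 0 = p.2 ⟨0, by omega⟩ := extFam_of_lt _ _
  have e1 : restrJet EM F r.le_succ (restrJet EM F h p) =
      restrJet EM F ((Nat.le_succ r).trans h) p := rfl
  have e2 : coVec R (restrJet EM F h p).1 (restrJet EM F h p).2 =
      restrJet EM F ((Nat.le_succ r).trans h) (truncField R p) := by
    refine Prod.ext ?_ (funext fun i => ?_)
    · simp only [coVec, truncField, restrJet_fst, e0]
      rfl
    · simp only [coVec, truncField, restrJet_snd]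
      rw [extFam_of_lt _ (by simp; omega)]
      rfl
  have e3 : ∀ z : Fin (k + 1) → F,
      shiftFib (C (restrJet EM F h p).1 ((restrJet EM F h p).2 0))
        (reindex F (Fin.castLE (Nat.succ_le_succ h)) z) =
      reindex F (Fin.castLE (Nat.succ_le_succ ((Nat.le_succ r).trans h))) (truncShift C p z) := by
    intro z
    funext i
    simp only [shiftFib_apply, reindex_apply, truncShift_apply]
    rw [extFam_of_lt _ (by simp; omega), e0]
    congr 1
    rcases Fin.eq_zero_or_eq_succ i with rfl | ⟨j, rfl⟩
    · rfl
    · rw [if_neg (Fin.succ_ne_zero j), if_neg]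
      exact fun hh => absurd (congrArg Fin.val hh) (by simp)
  refine ContinuousLinearMap.ext fun z => ?_
  simp only [truncDeriv]
  rw [h1.fderiv]
  simp only [pullbackLoc, totalDerivForm, ContinuousLinearMap.comp_apply, _root_.add_apply,
    ContinuousLinearMap.flip_apply, ContinuousLinearMap.compL_apply, e1, e2]
  rw [e3]
  rfl

/-! ### Smoothness of the coordinate operators -/

section Smooth

variable {R : EM × F → EM} {C : EM → F →L[ℝ] F →L[ℝ] F} {W : Set EM}

theorem contDiff_extFam {k : ℕ} (j : ℕ) : ContDiff ℝ ∞ (fun y : Fin k → F => extFam y j) := by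
  by_cases h : j < k
  · simp only [extFam, h, dif_pos]; fun_prop
  · simp only [extFam, h, dif_neg, not_false_eq_true]; fun_prop

theorem contDiffOn_truncField (hR : ContDiffOn ℝ ∞ R (W ×ˢ univ)) (k : ℕ) :
    ContDiffOn ℝ ∞ (truncField R : EM × (Fin k → F) → _) (W ×ˢ univ) := by
  refine ContDiffOn.prodMk ?_ ?_
  · refine hR.comp (f := fun p : EM × (Fin k → F) => (p.1, extFam p.2 0)) ?_ ?_
    · exact (contDiff_fst.prodMk ((contDiff_extFam 0).comp contDiff_snd)).contDiffOn
    · intro p hp; exact ⟨hp.1, mem_univ _⟩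
  · refine ContDiff.contDiffOn (contDiff_pi.2 fun i => ?_)
    exact (contDiff_extFam _).comp contDiff_snd

theorem contDiffOn_truncShift (hC : ContDiffOn ℝ ∞ C W) (k : ℕ) :
    ContDiffOn ℝ ∞ (truncShift C : EM × (Fin k → F) → _) (W ×ˢ univ) := by
  refine contDiffOn_const.sub (contDiffOn_const.clm_comp (ContDiffOn.clm_comp ?_ contDiffOn_const))
  refine ContDiffOn.clm_apply (hC.comp contDiff_fst.contDiffOn fun p hp => hp.1) ?_
  exact ((contDiff_extFam 0).comp contDiff_snd).contDiffOn

theorem contDiffOn_truncDeriv (hW : IsOpen W) (hR : ContDiffOn ℝ ∞ R (W ×ˢ univ))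
    (hC : ContDiffOn ℝ ∞ C W) {k : ℕ}
    {Λ : EM × (Fin k → F) → (Fin (k + 1) → F) →L[ℝ] G} (hΛ : ContDiffOn ℝ ∞ Λ (W ×ˢ univ)) :
    ContDiffOn ℝ ∞ (truncDeriv R C Λ) (W ×ˢ univ) := by
  refine ContDiffOn.add ?_ (hΛ.clm_comp (contDiffOn_truncShift hC k))
  exact (hΛ.fderiv_of_isOpen (m := ∞) (hW.prod isOpen_univ) (by simp)).clm_apply
    (contDiffOn_truncField hR k)

theorem contDiffOn_truncDerivFun (hW : IsOpen W) (hR : ContDiffOn ℝ ∞ R (W ×ˢ univ)) {k : ℕ}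
    {θ : EM × (Fin k → F) → F →L[ℝ] G} (hθ : ContDiffOn ℝ ∞ θ (W ×ˢ univ)) :
    ContDiffOn ℝ ∞ (truncDerivFun R θ) (W ×ˢ univ) :=
  (hθ.fderiv_of_isOpen (m := ∞) (hW.prod isOpen_univ) (by simp)).clm_apply
    (contDiffOn_truncField hR k)

theorem contDiffOn_totalDerivForm (hW : IsOpen W) (hR : ContDiffOn ℝ ∞ R (W ×ˢ univ))
    (hC : ContDiffOn ℝ ∞ C W) {k : ℕ}
    {Λ : EM × (Fin k → F) → (Fin (k + 1) → F) →L[ℝ] G} (hΛ : ContDiffOn ℝ ∞ Λ (W ×ˢ univ)) :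
    ContDiffOn ℝ ∞ (totalDerivForm R C Λ) (W ×ˢ univ) := by
  have hr : MapsTo (restrJet EM F k.le_succ) (W ×ˢ univ) (W ×ˢ univ) :=
    fun p hp => ⟨hp.1, mem_univ _⟩
  have hr' : ContDiffOn ℝ ∞ (restrJet EM F k.le_succ) (W ×ˢ univ) :=
    (restrJet EM F k.le_succ).contDiff.contDiffOn
  refine ContDiffOn.add (ContDiffOn.clm_comp (ContDiffOn.clm_apply ?_ ?_) contDiffOn_const)
    (ContDiffOn.clm_comp (hΛ.comp hr' hr) (ContDiffOn.sub contDiffOn_const (contDiffOn_const.clm_comp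
      (ContDiffOn.clm_comp (ContDiffOn.clm_apply (hC.comp contDiff_fst.contDiffOn
        fun p hp => hp.1) ?_) contDiffOn_const))))
  · exact (hΛ.fderiv_of_isOpen (m := ∞) (hW.prod isOpen_univ) (by simp)).comp hr' hr
  · refine ContDiffOn.prodMk ?_ (ContDiff.contDiffOn (by fun_prop))
    refine hR.comp (f := fun p : EM × (Fin (k + 1) → F) => (p.1, p.2 0)) ?_ ?_
    · exact ContDiff.contDiffOn (by fun_prop)
    · intro p hp; exact ⟨hp.1, mem_univ _⟩
  · exact ContDiff.contDiffOn (by fun_prop)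

end Smooth

end

end JetCalculus

namespace JetCalculus

section

variable {EM F G : Type*} [NormedAddCommGroup EM] [NormedSpace ℝ EM]
  [NormedAddCommGroup F] [NormedSpace ℝ F] [NormedAddCommGroup G] [NormedSpace ℝ G]

/-! ### The weighted shift -/

/-- The weighted shift `(w₀, w₁, …) ↦ (0, w₀, 2 w₁, …)`. -/
noncomputable def raise (F : Type*) [NormedAddCommGroup F] [NormedSpace ℝ F] (k : ℕ) :
    (Fin (k + 1) → F) →L[ℝ] (Fin (k + 1) → F) :=
  ContinuousLinearMap.pi fun r => ((r : ℕ) : ℝ) • ContinuousLinearMap.proj ⟨r - 1, by omega⟩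

/-- The weighted backward shift `(w₀, w₁, …) ↦ (w₁, w₂ / 2, …)`. -/
noncomputable def lower (F : Type*) [NormedAddCommGroup F] [NormedSpace ℝ F] (k : ℕ) :
    (Fin (k + 1) → F) →L[ℝ] (Fin (k + 1) → F) :=
  ContinuousLinearMap.pi fun r => if h : (r : ℕ) + 1 < k + 1 then
    (((r : ℕ) : ℝ) + 1)⁻¹ • ContinuousLinearMap.proj ⟨r + 1, h⟩ else 0

/-- At `r = 0` the truncated index `r - 1` is `0` again, but the weight `0` removes that entry. -/
theorem raise_apply {k : ℕ} (w : Fin (k + 1) → F) (r : Fin (k + 1)) :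
    raise F k w r = ((r : ℕ) : ℝ) • w ⟨r - 1, by omega⟩ := rfl

theorem lower_apply {k : ℕ} (w : Fin (k + 1) → F) (r : Fin (k + 1)) (h : (r : ℕ) + 1 < k + 1) :
    lower F k w r = (((r : ℕ) : ℝ) + 1)⁻¹ • w ⟨r + 1, h⟩ := by
  simp only [lower, ContinuousLinearMap.coe_pi', dif_pos h]
  rfl

theorem raise_iterate_of_lt {k : ℕ} (l : ℕ) (w : Fin (k + 1) → F) (r : Fin (k + 1))
    (h : (r : ℕ) < l) : (raise F k)^[l] w r = 0 := by
  induction l generalizing r with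
  | zero => omega
  | succ l ih =>
    rw [Function.iterate_succ_apply', raise_apply]
    rcases Nat.eq_zero_or_pos (r : ℕ) with h0 | h0
    · simp [h0]
    · rw [ih _ (by simp; omega), smul_zero]

theorem raise_iterate_eq_zero {k : ℕ} (l : ℕ) (w : Fin (k + 1) → F)
    (h : ∀ i : Fin (k + 1), (i : ℕ) + l ≤ k → w i = 0) : (raise F k)^[l] w = 0 := by
  induction l generalizing w with
  | zero => exact funext fun i => h i (by omega)
  | succ l ih =>
    rw [Function.iterate_succ_apply]
    refine ih _ fun i hi => ?_
    rw [raise_apply]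
    rcases Nat.eq_zero_or_pos (i : ℕ) with h0 | h0
    · simp [h0]
    · rw [h _ (by simp; omega), smul_zero]

/-- The factors of `lower` invert the weights inserted by `raise`. The only information lost is in
the top `l` entries, which `raise` pushes past index `k`. -/
theorem lower_raise_iterate {k : ℕ} (l : ℕ) (w : Fin (k + 1) → F) (i : Fin (k + 1))
    (h : (i : ℕ) + l ≤ k) : (lower F k)^[l] ((raise F k)^[l] w) i = w i := by
  induction l generalizing w i with
  | zero => rfl
  | succ l ih =>
    rw [Function.iterate_succ_apply' (lower F k), Function.iterate_succ_apply (raise F k),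
      lower_apply _ _ (by omega), ih _ _ (by simp; omega), raise_apply, smul_smul]
    have : (((i : ℕ) : ℝ) + 1)⁻¹ * (((i : ℕ) + 1 : ℕ) : ℝ) = 1 := by
      push_cast
      exact inv_mul_cancel₀ (by positivity)
    rw [this, one_smul]
    rfl

/-- Shifting down destroys only the first `l` entries, and these are assumed to be zero. -/
theorem raise_lower_iterate {k : ℕ} (l : ℕ) (w : Fin (k + 1) → F)
    (h : ∀ i : Fin (k + 1), (i : ℕ) < l → w i = 0) :
    (raise F k)^[l] ((lower F k)^[l] w) = w := by
  induction l generalizing w with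
  | zero => rfl
  | succ l ih =>
    rw [Function.iterate_succ_apply' (raise F k), Function.iterate_succ_apply (lower F k), ih]
    · funext r
      rw [raise_apply]
      rcases Nat.eq_zero_or_pos (r : ℕ) with h0 | h0
      · rw [h r (by omega)]; simp [h0]
      · rw [lower_apply _ _ (by simp; omega), smul_smul]
        have h1 : (((r : ℕ) - 1 : ℕ) : ℝ) + 1 = ((r : ℕ) : ℝ) := by
          exact_mod_cast Nat.sub_add_cancel h0
        simp only [h1]
        rw [mul_inv_cancel₀ (by exact_mod_cast h0.ne'), one_smul]
        congr 1
        exact Fin.ext (Nat.sub_add_cancel h0)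
    -- The vanishing range shrinks by one under `lower`, as the induction hypothesis needs. The last
    -- entry of a lowered family is zero by definition.
    · intro i hi
      by_cases hk : (i : ℕ) + 1 < k + 1
      · rw [lower_apply _ _ hk, h _ (by simp; omega), smul_zero]
      · simp only [lower, ContinuousLinearMap.coe_pi', dif_neg hk]
        rfl

/-! ### The frame adapted to the total derivative -/

/-- The components of the adapted frame: the iterated total derivatives of the tautological
`F`-valued one-form. -/
noncomputable def frameForm (R : EM × F → EM) (C : EM → F →L[ℝ] F →L[ℝ] F) (k : ℕ) :
    ℕ → EM × (Fin k → F) → (Fin (k + 1) → F) →L[ℝ] F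
  | 0 => fun _ => ContinuousLinearMap.proj 0
  | r + 1 => truncDeriv R C (frameForm R C k r)

variable {R : EM × F → EM} {C : EM → F →L[ℝ] F →L[ℝ] F} {W : Set EM}

/-! ### Linearity and Leibniz rule of the truncated total derivative -/

theorem truncDeriv_add {k : ℕ} {Λ Λ' : EM × (Fin k → F) → (Fin (k + 1) → F) →L[ℝ] G}
    {p : EM × (Fin k → F)} (h : DifferentiableAt ℝ Λ p) (h' : DifferentiableAt ℝ Λ' p) :
    truncDeriv R C (Λ + Λ') p = truncDeriv R C Λ p + truncDeriv R C Λ' p := by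
  simp only [truncDeriv]
  rw [fderiv_add h h', Pi.add_apply, ContinuousLinearMap.add_comp, _root_.add_apply]
  abel

theorem truncDeriv_comp {k : ℕ} {θ : EM × (Fin k → F) → F →L[ℝ] G}
    {Λ : EM × (Fin k → F) → (Fin (k + 1) → F) →L[ℝ] F}
    {p : EM × (Fin k → F)} (h : DifferentiableAt ℝ θ p) (h' : DifferentiableAt ℝ Λ p) :
    truncDeriv R C (fun p => (θ p).comp (Λ p)) p =
      (truncDerivFun R θ p).comp (Λ p) + (θ p).comp (truncDeriv R C Λ p) := by
  simp only [truncDeriv, truncDerivFun]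
  rw [(h.hasFDerivAt.clm_comp h'.hasFDerivAt).fderiv]
  ext z
  simp
  abel

theorem truncDeriv_congr {k : ℕ} {Λ Λ' : EM × (Fin k → F) → (Fin (k + 1) → F) →L[ℝ] G}
    (hW : IsOpen W) (h : EqOn Λ Λ' (W ×ˢ univ)) :
    EqOn (truncDeriv R C Λ) (truncDeriv R C Λ') (W ×ˢ univ) := by
  intro p hp
  have h1 : Λ =ᶠ[𝓝 p] Λ' := by
    filter_upwards [(hW.prod isOpen_univ).mem_nhds hp] with q hq using h hq
  simp only [truncDeriv]
  rw [h1.fderiv_eq, h hp]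

theorem truncDeriv_iterate_congr {k : ℕ}
    {Λ Λ' : EM × (Fin k → F) → (Fin (k + 1) → F) →L[ℝ] G} (hW : IsOpen W)
    (h : EqOn Λ Λ' (W ×ˢ univ)) (r : ℕ) :
    EqOn ((truncDeriv R C)^[r] Λ) ((truncDeriv R C)^[r] Λ') (W ×ˢ univ) := by
  induction r with
  | zero => exact h
  | succ r ih =>
    rw [Function.iterate_succ_apply', Function.iterate_succ_apply']
    exact truncDeriv_congr hW ih

section

variable (hW : IsOpen W) (hR : ContDiffOn ℝ ∞ R (W ×ˢ univ)) (hC : ContDiffOn ℝ ∞ C W)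
include hW hR hC

theorem contDiffOn_truncDeriv_iterate {k : ℕ}
    {Λ : EM × (Fin k → F) → (Fin (k + 1) → F) →L[ℝ] G} (hΛ : ContDiffOn ℝ ∞ Λ (W ×ˢ univ))
    (r : ℕ) : ContDiffOn ℝ ∞ ((truncDeriv R C)^[r] Λ) (W ×ˢ univ) := by
  induction r with
  | zero => exact hΛ
  | succ r ih =>
    rw [Function.iterate_succ_apply']
    exact contDiffOn_truncDeriv hW hR hC ih

theorem truncDeriv_iterate_add {k : ℕ}
    {Λ Λ' : EM × (Fin k → F) → (Fin (k + 1) → F) →L[ℝ] G} (hΛ : ContDiffOn ℝ ∞ Λ (W ×ˢ univ))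
    (hΛ' : ContDiffOn ℝ ∞ Λ' (W ×ˢ univ)) (r : ℕ) :
    EqOn ((truncDeriv R C)^[r] (Λ + Λ'))
      ((truncDeriv R C)^[r] Λ + (truncDeriv R C)^[r] Λ') (W ×ˢ univ) := by
  induction r with
  | zero => exact fun p _ => rfl
  | succ r ih =>
    intro p hp
    have hn := (hW.prod isOpen_univ).mem_nhds hp
    rw [Function.iterate_succ_apply', truncDeriv_congr hW ih hp, truncDeriv_add]
    · rw [Pi.add_apply, Function.iterate_succ_apply', Function.iterate_succ_apply']
    · exact ((contDiffOn_truncDeriv_iterate hW hR hC hΛ r).contDiffAt hn).differentiableAt (by simp)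
    · exact ((contDiffOn_truncDeriv_iterate hW hR hC hΛ' r).contDiffAt hn).differentiableAt (by simp)

theorem contDiffOn_frameForm (k r : ℕ) : ContDiffOn ℝ ∞ (frameForm R C k r) (W ×ˢ univ) := by
  induction r with
  | zero => exact contDiffOn_const
  | succ r ih => exact contDiffOn_truncDeriv hW hR hC ih

/-- One Leibniz step, `D(θ e_j) = (Dθ) e_j + θ e_{j+1}`, valid because `e_{j+1}` is by definition `D
e_j`. Linearity of `Dʳ` does the rest; smoothness is needed because linearity only holds for
differentiable forms. -/
theorem truncDeriv_iterate_comp_frameForm {k : ℕ} {θ : EM × (Fin k → F) → F →L[ℝ] G}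
    (hθ : ContDiffOn ℝ ∞ θ (W ×ˢ univ)) (r j : ℕ) :
    EqOn ((truncDeriv R C)^[r + 1] fun p => (θ p).comp (frameForm R C k j p))
      (((truncDeriv R C)^[r] fun p => (truncDerivFun R θ p).comp (frameForm R C k j p)) +
        ((truncDeriv R C)^[r] fun p => (θ p).comp (frameForm R C k (j + 1) p)))
      (W ×ˢ univ) := by
  rw [Function.iterate_succ]
  have h1 : EqOn (truncDeriv R C fun p => (θ p).comp (frameForm R C k j p))
      ((fun p => (truncDerivFun R θ p).comp (frameForm R C k j p)) +
        fun p => (θ p).comp (frameForm R C k (j + 1) p)) (W ×ˢ univ) := by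
    intro p hp
    have hn := (hW.prod isOpen_univ).mem_nhds hp
    rw [truncDeriv_comp ((hθ.contDiffAt hn).differentiableAt (by simp))
      (((contDiffOn_frameForm hW hR hC k j).contDiffAt hn).differentiableAt (by simp))]
    rfl
  refine (truncDeriv_iterate_congr hW h1 r).trans (truncDeriv_iterate_add hW hR hC ?_ ?_ r)
  · exact (contDiffOn_truncDerivFun hW hR hθ).clm_comp (contDiffOn_frameForm hW hR hC k j)
  · exact hθ.clm_comp (contDiffOn_frameForm hW hR hC k (j + 1))

/-- An endomorphism which acts on the adapted frame as the weighted shift acts in the same way on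
all iterated total derivatives. -/
theorem truncDeriv_iterate_comp {k : ℕ} {p : EM × (Fin k → F)} (hp : p ∈ W ×ˢ (univ : Set _))
    {S : (Fin (k + 1) → F) → (Fin (k + 1) → F)}
    (hS : ∀ r ≤ k, ∀ z, frameForm R C k r p (S z) = (r : ℝ) • frameForm R C k (r - 1) p z)
    (r : ℕ) : ∀ (θ : EM × (Fin k → F) → F →L[ℝ] G), ContDiffOn ℝ ∞ θ (W ×ˢ univ) →
    ∀ j, r + j ≤ k → ∀ z,
    (truncDeriv R C)^[r] (fun p => (θ p).comp (frameForm R C k j p)) p (S z) =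
      (r : ℝ) • (truncDeriv R C)^[r - 1] (fun p => (θ p).comp (frameForm R C k j p)) p z +
      (j : ℝ) • (truncDeriv R C)^[r] (fun p => (θ p).comp (frameForm R C k (j - 1) p)) p z := by
  -- The exponent `j` is carried along because the Leibniz step replaces `θ e_j` by `θ e_{j+1}`. The
  -- application only needs `j = 0`, where the last term disappears.
  induction r with
  | zero =>
    intro θ hθ j hj z
    simp only [Function.iterate_zero, id, ContinuousLinearMap.comp_apply]
    rw [hS j (by omega), map_smul]
    simp
  | succ r ih =>
    intro θ hθ j hj z
    have hstep := fun i => truncDeriv_iterate_comp_frameForm hW hR hC hθ r i hp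
    have hθ' := contDiffOn_truncDerivFun hW hR hθ
    rw [hstep, Pi.add_apply, _root_.add_apply, ih _ hθ' j (by omega), ih θ hθ (j + 1) (by omega),
      Nat.add_sub_cancel, Nat.add_sub_cancel]
    -- Leibniz read backwards: the two terms with coefficient `r` recombine to `r Dʳ(θ e_j)`. For `r
    -- = 0` the truncated exponent `r - 1` is harmless because of the coefficient.
    have h1 : (r : ℝ) • (truncDeriv R C)^[r] (fun p => (θ p).comp (frameForm R C k j p)) p z =
        (r : ℝ) • (truncDeriv R C)^[r - 1]
          (fun p => (truncDerivFun R θ p).comp (frameForm R C k j p)) p z +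
        (r : ℝ) • (truncDeriv R C)^[r - 1]
          (fun p => (θ p).comp (frameForm R C k (j + 1) p)) p z := by
      rcases Nat.eq_zero_or_pos r with rfl | h0
      · simp
      · have h2 := truncDeriv_iterate_comp_frameForm hW hR hC hθ (r - 1) j hp
        rw [Nat.sub_add_cancel h0] at h2
        rw [h2, Pi.add_apply, _root_.add_apply, smul_add]
    -- The same for the terms with coefficient `j`. Of the coefficient `j + 1` given by the
    -- induction hypothesis, `j` is used here, and the remaining `1` turns `r` into `r + 1`.
    have h2 : (j : ℝ) • (truncDeriv R C)^[r + 1]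
        (fun p => (θ p).comp (frameForm R C k (j - 1) p)) p z =
        (j : ℝ) • (truncDeriv R C)^[r]
          (fun p => (truncDerivFun R θ p).comp (frameForm R C k (j - 1) p)) p z +
        (j : ℝ) • (truncDeriv R C)^[r] (fun p => (θ p).comp (frameForm R C k j p)) p z := by
      rcases Nat.eq_zero_or_pos j with rfl | h0
      · simp
      · rw [hstep, Pi.add_apply, _root_.add_apply, smul_add, Nat.sub_add_cancel h0]
    rw [h2]
    push_cast
    rw [add_smul, add_smul, h1]
    simp only [one_smul]
    abel

/-- The adapted frame is triangular. -/
theorem frameForm_apply_of_eq_zero {k : ℕ} (r : Fin (k + 1)) {p : EM × (Fin k → F)}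
    (hp : p ∈ W ×ˢ (univ : Set _)) {z : Fin (k + 1) → F} (hz : ∀ i < r, z i = 0) :
    frameForm R C k r p z = z r := by
  obtain ⟨r, hr⟩ := r
  induction r generalizing p z with
  | zero => rfl
  | succ r ih =>
    have hn := (hW.prod isOpen_univ).mem_nhds hp
    show truncDeriv R C (frameForm R C k r) p z = _
    simp only [truncDeriv]
    -- For this fixed `z` the induction hypothesis holds at all points near `p`, so `e_r(·) z` is
    -- locally constant and differentiating the coefficients contributes nothing.
    have h1 : fderiv ℝ (frameForm R C k r) p (truncField R p) z = 0 := by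
      have hd : DifferentiableAt ℝ (frameForm R C k r) p :=
        ((contDiffOn_frameForm hW hR hC k r).contDiffAt hn).differentiableAt (by simp)
      have h2 := (hd.hasFDerivAt.clm_apply (hasFDerivAt_const z p)).fderiv
      have h3 : (fun p => frameForm R C k r p z) =ᶠ[𝓝 p] fun _ => z ⟨r, by omega⟩ := by
        filter_upwards [hn] with q hq
        exact ih hq (by omega) fun i hi => hz i (hi.trans (by simp [Fin.lt_def]))
      rw [h3.fderiv_eq] at h2
      have h4 := congrArg (fun L => L (truncField R p)) h2
      simpa using h4.symm
    rw [_root_.add_apply, h1, zero_add, ContinuousLinearMap.comp_apply]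
    -- The structure function correction is linear in `z 0` and drops out. What remains is the plain
    -- shift, which moves the entry at `r + 1` to place `r`.
    have hz0 : z 0 = 0 := hz 0 (by simp [Fin.lt_def])
    rw [ih hp (by omega), truncShift_apply, hz0]
    · simp [extFam, hr]
    · intro i hi
      have hi' : (i : ℕ) < r := hi
      rw [truncShift_apply, hz0, extFam_of_lt _ (by omega), hz _ (by simp [Fin.lt_def]; omega)]
      simp

end

/-- The change to the adapted frame. -/
noncomputable def frameMap (R : EM × F → EM) (C : EM → F →L[ℝ] F →L[ℝ] F) {k : ℕ}
    (p : EM × (Fin k → F)) : (Fin (k + 1) → F) →L[ℝ] (Fin (k + 1) → F) :=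
  ContinuousLinearMap.pi fun r => frameForm R C k r p

theorem frameMap_apply {k : ℕ} (p : EM × (Fin k → F)) (z : Fin (k + 1) → F) (r : Fin (k + 1)) :
    frameMap R C p z r = frameForm R C k r p z := rfl

section

variable (hW : IsOpen W) (hR : ContDiffOn ℝ ∞ R (W ×ˢ univ)) (hC : ContDiffOn ℝ ∞ C W)
include hW hR hC

/-- The matrix of the frame is lower triangular with identities on the diagonal, so it preserves the
filtration by vanishing of initial entries. The case `l = k + 1` is injectivity; the other cases
describe the kernels of the projections in the frame. -/
theorem frameMap_eq_zero_iff {k : ℕ} {p : EM × (Fin k → F)} (hp : p ∈ W ×ˢ (univ : Set _))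
    (z : Fin (k + 1) → F) (l : ℕ) :
    (∀ i : Fin (k + 1), (i : ℕ) < l → frameMap R C p z i = 0) ↔
      ∀ i : Fin (k + 1), (i : ℕ) < l → z i = 0 := by
  constructor
  · intro h i hi
    induction i using WellFoundedLT.induction with
    | _ i ih =>
      have h1 := h i hi
      rwa [frameMap_apply, frameForm_apply_of_eq_zero hW hR hC i hp] at h1
      exact fun j hj => ih j hj (lt_trans (Fin.lt_def.1 hj) hi)
  · intro h i hi
    rw [frameMap_apply, frameForm_apply_of_eq_zero hW hR hC i hp, h i hi]
    exact fun j hj => h j (lt_trans (Fin.lt_def.1 hj) hi)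

theorem contDiffOn_frameMap (k : ℕ) :
    ContDiffOn ℝ ∞ (frameMap R C : EM × (Fin k → F) → _) (W ×ˢ univ) := by
  have h : (frameMap R C : EM × (Fin k → F) → _) = fun p => ∑ r : Fin (k + 1),
      (ContinuousLinearMap.single ℝ (fun _ : Fin (k + 1) => F) r).comp (frameForm R C k r p) := by
    funext p
    refine ContinuousLinearMap.ext fun z => funext fun i => ?_
    simp [frameMap_apply, Finset.sum_apply, Pi.single_apply]
  rw [h]
  exact ContDiffOn.sum fun r _ => contDiffOn_const.clm_comp (contDiffOn_frameForm hW hR hC k r)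

variable [FiniteDimensional ℝ F]

theorem isInvertible_frameMap {k : ℕ} {p : EM × (Fin k → F)} (hp : p ∈ W ×ˢ (univ : Set _)) :
    (frameMap R C p).IsInvertible := by
  have hinj : Function.Injective (frameMap R C p) := by
    rw [injective_iff_map_eq_zero]
    intro z hz
    funext i
    exact (frameMap_eq_zero_iff hW hR hC hp z (k + 1)).1 (fun j _ => by rw [hz]; rfl) i i.2
  refine ⟨(LinearEquiv.ofInjectiveEndo (frameMap R C p).toLinearMap hinj).toContinuousLinearEquiv,
    ?_⟩
  ext z
  rfl

theorem contDiffOn_inverse_frameMap (k : ℕ) :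
    ContDiffOn ℝ ∞ (fun p : EM × (Fin k → F) => (frameMap R C p).inverse) (W ×ˢ univ) := by
  have : CompleteSpace F := FiniteDimensional.complete ℝ F
  intro p hp
  obtain ⟨e, he⟩ := isInvertible_frameMap hW hR hC hp
  have h1 := contDiffAt_map_inverse (n := ∞) (𝕜 := ℝ) e
  rw [he] at h1
  exact h1.comp_contDiffWithinAt p (contDiffOn_frameMap hW hR hC k p hp)

end

end

end JetCalculus

/-! ### Charts and vector fields -/

theorem two_le_infty : (2 : ℕ∞ω) ≤ ∞ := by
  have : ((2 : ℕ∞) : ℕ∞ω) ≤ ((⊤ : ℕ∞) : ℕ∞ω) := by exact_mod_cast (le_top : (2 : ℕ∞) ≤ ⊤)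
  exact this

section Charts

variable {E' N : Type*} [NormedAddCommGroup E'] [NormedSpace ℝ E'] [TopologicalSpace N]
  [ChartedSpace E' N] [IsManifold 𝓘(ℝ, E') ∞ N]

/-- The derivative of a map `g` from a manifold to its model space. -/
noncomputable def chartDeriv (g : N → E') (A : N) : TangentSpace 𝓘(ℝ, E') A →L[ℝ] E' :=
  mfderiv 𝓘(ℝ, E') 𝓘(ℝ, E') g A

/-- The components of the field are read off from the tangent map of `g`. The map `g` need not be
the preferred chart at `A`, since the coordinates at a fixed `x₀` are used over their whole domain.
-/
theorem contMDiffAt_mfderiv_vectorField {O : Set N} (hO : IsOpen O) {g : N → E'}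
    (hg : ContMDiffOn 𝓘(ℝ, E') 𝓘(ℝ, E') ∞ g O) {A : N} (hA : A ∈ O)
    {X : ∀ A : N, TangentSpace 𝓘(ℝ, E') A}
    (hX : ContMDiffAt 𝓘(ℝ, E') 𝓘(ℝ, E').tangent ∞
      (fun A => (⟨A, X A⟩ : TangentBundle 𝓘(ℝ, E') N)) A) :
    ContMDiffAt 𝓘(ℝ, E') 𝓘(ℝ, E') ∞
      (fun A => chartDeriv g A (X A)) A := by
  have h1 := hg.contMDiffOn_tangentMapWithin (m := ∞) (by simp) hO.uniqueMDiffOn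
  have h2 := (h1.contMDiffAt (x := (⟨A, X A⟩ : TangentBundle 𝓘(ℝ, E') N))
    ((hO.preimage (FiberBundle.continuous_proj E' (TangentSpace 𝓘(ℝ, E')))).mem_nhds hA)).comp A hX
  have h3 := (contMDiff_snd_tangentBundle_modelSpace (n := ∞) E' 𝓘(ℝ, E')).contMDiffAt.comp A h2
  refine h3.congr_of_eventuallyEq ?_
  filter_upwards [hO.mem_nhds hA] with B hB
  show mfderiv 𝓘(ℝ, E') 𝓘(ℝ, E') g B (X B) = mfderivWithin 𝓘(ℝ, E') 𝓘(ℝ, E') g O B (X B)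
  rw [mfderivWithin_of_isOpen hO hB]

/-- The field is recovered by applying the tangent map of the inverse coordinates `f` to its
expression in the coordinates `g`. -/
theorem contMDiffAt_vectorField_of_mfderiv {O : Set N} {D : Set E'} (hO : IsOpen O)
    (hD : IsOpen D) {g : N → E'} {f : E' → N} (hg : ContMDiffOn 𝓘(ℝ, E') 𝓘(ℝ, E') ∞ g O)
    (hf : ContMDiffOn 𝓘(ℝ, E') 𝓘(ℝ, E') ∞ f D) (hgD : MapsTo g O D)
    (hfg : ∀ A ∈ O, f (g A) = A) {A : N} (hA : A ∈ O)
    {X : ∀ A : N, TangentSpace 𝓘(ℝ, E') A}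
    (hX : ContMDiffAt 𝓘(ℝ, E') 𝓘(ℝ, E') ∞
      (fun A => chartDeriv g A (X A)) A) :
    ContMDiffAt 𝓘(ℝ, E') 𝓘(ℝ, E').tangent ∞
      (fun A => (⟨A, X A⟩ : TangentBundle 𝓘(ℝ, E') N)) A := by
  have h1 := hf.contMDiffOn_tangentMapWithin (m := ∞) (by simp) hD.uniqueMDiffOn
  let Y : N → TangentBundle 𝓘(ℝ, E') E' :=
    fun A => ⟨g A, mfderiv 𝓘(ℝ, E') 𝓘(ℝ, E') g A (X A)⟩
  have hY : ContMDiffAt 𝓘(ℝ, E') 𝓘(ℝ, E').tangent ∞ Y A := by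
    have h3 : ContMDiff 𝓘(ℝ, E' × E') 𝓘(ℝ, E').tangent ∞
        (fun p : E' × E' => (⟨p.1, p.2⟩ : TangentBundle 𝓘(ℝ, E') E')) := by
      intro p
      refine contMDiffAt_totalSpace.2 ⟨contDiff_fst.contMDiff p, ?_⟩
      refine (contDiff_snd.contMDiff p).congr_of_eventuallyEq (Eventually.of_forall fun q => ?_)
      simp
    exact h3.contMDiffAt.comp A ((hg.contMDiffAt (hO.mem_nhds hA)).prodMk_space hX)
  have h2 := (h1.contMDiffAt (x := Y A)
    ((hD.preimage (FiberBundle.continuous_proj E' (TangentSpace 𝓘(ℝ, E')))).mem_nhds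
      (hgD hA))).comp A hY
  refine h2.congr_of_eventuallyEq ?_
  filter_upwards [hO.mem_nhds hA] with B hB
  have hBD := hgD hB
  simp only [Function.comp_apply, tangentMapWithin, Y]
  rw [mfderivWithin_of_isOpen hD hBD]
  have h3 := (((hf.contMDiffAt (hD.mem_nhds hBD)).mdifferentiableAt (by simp)).hasMFDerivAt).comp B
    ((hg.contMDiffAt (hO.mem_nhds hB)).mdifferentiableAt (by simp)).hasMFDerivAt
  have h4 : f ∘ g =ᶠ[𝓝 B] id := by
    filter_upwards [hO.mem_nhds hB] with B' hB' using hfg B' hB'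
  have h5 := hasMFDerivAt_unique (h3.congr_of_eventuallyEq h4.symm) (hasMFDerivAt_id B)
  have h6 := congrArg (fun L : E' →L[ℝ] E' => L (X B)) h5
  -- The points `f (g B)` and `B` are equal but not by definition, so base point and vector are
  -- replaced simultaneously.
  have h7 : ∀ (B' : N) (v : E'), B' = B → v = X B →
      (⟨B, X B⟩ : TangentBundle 𝓘(ℝ, E') N) = ⟨B', v⟩ := by
    rintro _ _ rfl rfl; rfl
  exact h7 _ _ (hfg B hB) h6

/-- Naturality of the Lie bracket under pullback by `f`. The pullback of a field is its coordinate
expression because the derivatives of `f` and `g` are mutually inverse, and on a vector space the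
manifold bracket is the usual one. -/
theorem mfderiv_chart_mlieBracket [CompleteSpace E'] {O : Set N} {D : Set E'} (hO : IsOpen O)
    (hD : IsOpen D) {g : N → E'} {f : E' → N} (hg : ContMDiffOn 𝓘(ℝ, E') 𝓘(ℝ, E') ∞ g O)
    (hf : ContMDiffOn 𝓘(ℝ, E') 𝓘(ℝ, E') ∞ f D) (hfO : MapsTo f D O) (hgf : ∀ p ∈ D, g (f p) = p)
    (hfg : ∀ A ∈ O, f (g A) = A) {p : E'} (hp : p ∈ D)
    {X Y : ∀ A : N, TangentSpace 𝓘(ℝ, E') A}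
    (hX : ContMDiff 𝓘(ℝ, E') 𝓘(ℝ, E').tangent ∞ (fun A => (⟨A, X A⟩ : TangentBundle 𝓘(ℝ, E') N)))
    (hY : ContMDiff 𝓘(ℝ, E') 𝓘(ℝ, E').tangent ∞
      (fun A => (⟨A, Y A⟩ : TangentBundle 𝓘(ℝ, E') N))) :
    chartDeriv g (f p) (VectorField.mlieBracket 𝓘(ℝ, E') X Y (f p)) =
      VectorField.lieBracket ℝ
        (fun q => chartDeriv g (f q) (X (f q)))
        (fun q => chartDeriv g (f q) (Y (f q))) p := by
  have hinv : ∀ q ∈ D, (mfderiv 𝓘(ℝ, E') 𝓘(ℝ, E') f q).inverse =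
      mfderiv 𝓘(ℝ, E') 𝓘(ℝ, E') g (f q) := by
    intro q hq
    have hfq := ((hf.contMDiffAt (hD.mem_nhds hq)).mdifferentiableAt (by simp)).hasMFDerivAt
    have hgq := ((hg.contMDiffAt (hO.mem_nhds (hfO hq))).mdifferentiableAt (by simp)).hasMFDerivAt
    have h1 := hgq.comp q hfq
    have h2 : g ∘ f =ᶠ[𝓝 q] id := by
      filter_upwards [hD.mem_nhds hq] with q' hq' using hgf q' hq'
    have h3 := hasMFDerivAt_unique (h1.congr_of_eventuallyEq h2.symm) (hasMFDerivAt_id q)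
    have hfq' : HasMFDerivAt 𝓘(ℝ, E') 𝓘(ℝ, E') f (g (f q)) (mfderiv 𝓘(ℝ, E') 𝓘(ℝ, E') f q) := by
      rw [hgf q hq]; exact hfq
    have h4 := hfq'.comp (f q) hgq
    have h5 : f ∘ g =ᶠ[𝓝 (f q)] id := by
      filter_upwards [hO.mem_nhds (hfO hq)] with q' hq' using hfg q' hq'
    have h6 := hasMFDerivAt_unique (h4.congr_of_eventuallyEq h5.symm) (hasMFDerivAt_id (f q))
    exact ContinuousLinearMap.inverse_eq h6 h3
  have : IsManifold 𝓘(ℝ, E') (minSmoothness ℝ 2) N := by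
    rw [minSmoothness_of_isRCLikeNormedField]
    exact IsManifold.of_le (n := ∞) (by exact two_le_infty)
  have h1 := VectorField.mpullback_mlieBracket (𝕜 := ℝ) (I := 𝓘(ℝ, E')) (I' := 𝓘(ℝ, E'))
    (n := ∞) (f := f) (V := X) (W := Y) (x₀ := p)
    ((hX (f p)).mdifferentiableAt (by simp)) ((hY (f p)).mdifferentiableAt (by simp))
    (hf.contMDiffAt (hD.mem_nhds hp)) 
      (by rw [minSmoothness_of_isRCLikeNormedField]; exact two_le_infty)
  have hpb : ∀ X : ∀ A : N, TangentSpace 𝓘(ℝ, E') A,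
      VectorField.mpullback 𝓘(ℝ, E') 𝓘(ℝ, E') f X =ᶠ[𝓝 p]
        fun q => chartDeriv g (f q) (X (f q)) := by
    intro X
    filter_upwards [hD.mem_nhds hp] with q hq
    rw [VectorField.mpullback_apply, hinv q hq]
    rfl
  rw [(hpb _).self_of_nhds] at h1
  refine h1.trans ?_
  refine (Filter.EventuallyEq.mlieBracket_vectorField_eq (hpb X) (hpb Y)).trans ?_
  have h2 := fun X Y : E' → E' => congrFun (VectorField.mlieBracketWithin_eq_lieBracketWithin
    (𝕜 := ℝ) (V := X) (W := Y) (s := univ)) p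
  simp only [VectorField.lieBracketWithin_univ] at h2
  exact h2 _ _

theorem tangentDeriv_eq_fderiv {O : Set N} (hO : IsOpen O) {g : N → E'}
    (hg : ContMDiffOn 𝓘(ℝ, E') 𝓘(ℝ, E') ∞ g O) {A : N} (hA : A ∈ O) {h : N → ℝ} {H : E' → ℝ}
    (hH : DifferentiableAt ℝ H (g A)) (heq : h =ᶠ[𝓝 A] fun B => H (g B))
    (v : TangentSpace 𝓘(ℝ, E') A) :
    tangentDeriv 𝓘(ℝ, E') h A v =
      fderiv ℝ H (g A) (chartDeriv g A v) := by
  have h1 := hH.hasFDerivAt.hasMFDerivAt.comp A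
    ((hg.contMDiffAt (hO.mem_nhds hA)).mdifferentiableAt (by simp)).hasMFDerivAt
  have h2 := (h1.congr_of_eventuallyEq heq).mfderiv
  rw [tangentDeriv, h2]
  rfl

end Charts

namespace LieAlgebroid

section

variable {EM F : Type*} {M : Type*} {V : M → Type*}
  [NormedAddCommGroup EM] [NormedSpace ℝ EM]
  [NormedAddCommGroup F] [NormedSpace ℝ F]
  [TopologicalSpace M] [ChartedSpace EM M] [IsManifold 𝓘(ℝ, EM) ∞ M]
  [TopologicalSpace (TotalSpace F V)] [∀ x, TopologicalSpace (V x)] [FiberBundle F V]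
  [∀ x, AddCommGroup (V x)] [∀ x, Module ℝ (V x)] [VectorBundle ℝ F V]
  [ContMDiffVectorBundle ∞ F V 𝓘(ℝ, EM)]
  (𝒜 : LieAlgebroid EM F V) [FiniteDimensional ℝ EM] [FiniteDimensional ℝ F]

open JetCalculus

/-! ### Coordinates on the `E`-tangent -/

theorem jetCoord_fst (k : ℕ) (x₀ : M) (A : 𝒜.JetSpace k) :
    (𝒜.jetCoord k x₀ A).1 = chartAt EM x₀ A.base := rfl

theorem jetCoord_mem {k : ℕ} {x₀ : M} {A : 𝒜.JetSpace k} (hA : A ∈ 𝒜.jetDom k x₀) :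
    𝒜.jetCoord k x₀ A ∈ 𝒜.cdom x₀ ×ˢ (univ : Set (Fin k → F)) :=
  ⟨𝒜.chart_mem_cdom hA, mem_univ _⟩

theorem jetChart_symm_mem {k : ℕ} {x₀ : M} {p : EM × (Fin k → F)} (hp : p.1 ∈ 𝒜.cdom x₀) :
    (𝒜.jetChart k x₀).symm p ∈ 𝒜.jetDom k x₀ :=
  (𝒜.jetChart k x₀).map_target ⟨hp, mem_univ _⟩

theorem jetCoord_jetChart_symm {k : ℕ} {x₀ : M} {p : EM × (Fin k → F)} (hp : p.1 ∈ 𝒜.cdom x₀) :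
    𝒜.jetCoord k x₀ ((𝒜.jetChart k x₀).symm p) = p :=
  (𝒜.jetChart k x₀).right_inv ⟨hp, mem_univ _⟩

theorem jetChart_symm_jetCoord {k : ℕ} {x₀ : M} {A : 𝒜.JetSpace k} (hA : A ∈ 𝒜.jetDom k x₀) :
    (𝒜.jetChart k x₀).symm (𝒜.jetCoord k x₀ A) = A :=
  (𝒜.jetChart k x₀).left_inv hA

theorem jetChart_symm_base {k : ℕ} {x₀ : M} {p : EM × (Fin k → F)} (hp : p.1 ∈ 𝒜.cdom x₀) :
    ((𝒜.jetChart k x₀).symm p).base = (chartAt EM x₀).symm p.1 := by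
  have h := congrArg Prod.fst (𝒜.jetCoord_jetChart_symm (k := k) hp)
  rw [jetCoord_fst] at h
  rw [← h, (chartAt EM x₀).left_inv (And.left (𝒜.jetChart_symm_mem hp))]

theorem isOpen_coordImage (k : ℕ) (x₀ : M) : IsOpen (𝒜.cdom x₀ ×ˢ (univ : Set (Fin k → F))) :=
  (𝒜.isOpen_cdom x₀).prod isOpen_univ

/-- The derivative of the coordinates on `Eᵏ`. -/
noncomputable def jetDeriv (k : ℕ) (x₀ : M) (A : 𝒜.JetSpace k) :
    TangentSpace 𝓘(ℝ, EM × (Fin k → F)) A →L[ℝ] EM × (Fin k → F) :=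
  chartDeriv (𝒜.jetCoord k x₀) A

theorem hasMFDerivAt_jetCoord {k : ℕ} {x₀ : M} {A : 𝒜.JetSpace k} (hA : A ∈ 𝒜.jetDom k x₀) :
    HasMFDerivAt 𝓘(ℝ, EM × (Fin k → F)) 𝓘(ℝ, EM × (Fin k → F)) (𝒜.jetCoord k x₀) A
      (𝒜.jetDeriv k x₀ A) :=
  (((𝒜.contMDiffOn_jetCoord k x₀).contMDiffAt
    ((𝒜.isOpen_jetDom k x₀).mem_nhds hA)).mdifferentiableAt (by simp)).hasMFDerivAt

theorem bijective_jetDeriv {k : ℕ} {x₀ : M} {A : 𝒜.JetSpace k} (hA : A ∈ 𝒜.jetDom k x₀) :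
    Function.Bijective (𝒜.jetDeriv k x₀ A) := by
  let q := 𝒜.jetCoord k x₀ A
  have hq : q ∈ 𝒜.cdom x₀ ×ˢ (univ : Set (Fin k → F)) := 𝒜.jetCoord_mem hA
  have hf : HasMFDerivAt 𝓘(ℝ, EM × (Fin k → F)) 𝓘(ℝ, EM × (Fin k → F)) (𝒜.jetChart k x₀).symm q
      (mfderiv 𝓘(ℝ, EM × (Fin k → F)) 𝓘(ℝ, EM × (Fin k → F)) (𝒜.jetChart k x₀).symm q) :=
    (((𝒜.contMDiffOn_jetChart_symm k x₀).contMDiffAt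
      ((𝒜.isOpen_coordImage k x₀).mem_nhds hq)).mdifferentiableAt (by simp)).hasMFDerivAt
  have hg : HasMFDerivAt 𝓘(ℝ, EM × (Fin k → F)) 𝓘(ℝ, EM × (Fin k → F)) (𝒜.jetCoord k x₀)
      ((𝒜.jetChart k x₀).symm q) (𝒜.jetDeriv k x₀ A) := by
    rw [𝒜.jetChart_symm_jetCoord hA]; exact 𝒜.hasMFDerivAt_jetCoord hA
  have h1 : (𝒜.jetCoord k x₀) ∘ (𝒜.jetChart k x₀).symm =ᶠ[𝓝 q] id := by
    filter_upwards [(𝒜.isOpen_coordImage k x₀).mem_nhds hq] with q' hq'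
      using 𝒜.jetCoord_jetChart_symm hq'.1
  have h2 : (𝒜.jetChart k x₀).symm ∘ (𝒜.jetCoord k x₀) =ᶠ[𝓝 A] id := by
    filter_upwards [(𝒜.isOpen_jetDom k x₀).mem_nhds hA] with A' hA'
      using 𝒜.jetChart_symm_jetCoord hA'
  have h3 := hasMFDerivAt_unique ((hg.comp q hf).congr_of_eventuallyEq h1.symm)
    (hasMFDerivAt_id q)
  have h4 := hasMFDerivAt_unique
    ((hf.comp A (𝒜.hasMFDerivAt_jetCoord hA)).congr_of_eventuallyEq h2.symm)
    (hasMFDerivAt_id A)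
  constructor
  · intro v w hvw
    have hv := congrArg (fun L : (EM × (Fin k → F)) →L[ℝ] (EM × (Fin k → F)) => L v) h4
    have hw := congrArg (fun L : (EM × (Fin k → F)) →L[ℝ] (EM × (Fin k → F)) => L w) h4
    refine hv.symm.trans (Eq.trans ?_ hw)
    exact congrArg (fun v => mfderiv 𝓘(ℝ, EM × (Fin k → F)) 𝓘(ℝ, EM × (Fin k → F))
      (𝒜.jetChart k x₀).symm q v) hvw
  · intro v
    exact ⟨_, congrArg (fun L : (EM × (Fin k → F)) →L[ℝ] (EM × (Fin k → F)) => L v) h3⟩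

theorem jetDeriv_fst {k : ℕ} {x₀ : M} {A : 𝒜.JetSpace k} (hA : A ∈ 𝒜.jetDom k x₀)
    (v : TangentSpace 𝓘(ℝ, EM × (Fin k → F)) A) :
    (𝒜.jetDeriv k x₀ A v).1 = chartDeriv (chartAt EM x₀) A.base
      (mfderiv 𝓘(ℝ, EM × (Fin k → F)) 𝓘(ℝ, EM) (𝒜.proj k) A v) := by
  have h1 : HasMFDerivAt 𝓘(ℝ, EM × (Fin k → F)) 𝓘(ℝ, EM) (fun A => (𝒜.jetCoord k x₀ A).1) A
      ((ContinuousLinearMap.fst ℝ EM (Fin k → F)).comp (𝒜.jetDeriv k x₀ A)) :=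
    (ContinuousLinearMap.fst ℝ EM (Fin k → F)).hasFDerivAt.hasMFDerivAt.comp A
      (𝒜.hasMFDerivAt_jetCoord hA)
  have h2 : HasMFDerivAt 𝓘(ℝ, EM) 𝓘(ℝ, EM) (chartAt EM x₀) (𝒜.proj k A)
      (chartDeriv (chartAt EM x₀) A.base) :=
    (((contMDiffOn_chart (I := 𝓘(ℝ, EM)) (n := ∞) (x := x₀)).contMDiffAt
      ((chartAt EM x₀).open_source.mem_nhds (And.left hA))).mdifferentiableAt
        (by simp)).hasMFDerivAt
  have h3 := h2.comp A ((𝒜.contMDiff_proj k).mdifferentiable (by simp) A).hasMFDerivAt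
  exact congrArg (fun L : (EM × (Fin k → F)) →L[ℝ] EM => L v) (hasMFDerivAt_unique h1 h3)

theorem chartDeriv_chartAt_anchor {x₀ x : M} (hx : x ∈ 𝒜.dom x₀) (b : V x) :
    chartDeriv (chartAt EM x₀) x (𝒜.anchor x b) =
      𝒜.localAnchor x₀ (chartAt EM x₀ x, 𝒜.fibMap x₀ x b) :=
  (𝒜.localAnchor_eq hx b).symm

theorem injective_chartDeriv_chartAt {x₀ x : M} (hx : x ∈ 𝒜.dom x₀) :
    Function.Injective (chartDeriv (chartAt EM x₀) x) := by
  have := isInvertible_mfderiv_extChartAt (I := 𝓘(ℝ, EM)) (x := x₀) (y := x)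
    (by simpa using hx.1)
  exact this.injective

/-- The compatibility `ρ(b) = Tτ_{k,0}(v)` is solved for the base component of `v`; the derivative
of the chart of `M` is injective, so nothing is lost. Hence `b` and the `k` fibre components of `v`
are free, and they will be the `k + 1` coordinates of the fibre. -/
theorem mem_ETangent_iff {k : ℕ} {x₀ : M} {A : 𝒜.JetSpace k} (hA : A ∈ 𝒜.jetDom k x₀)
    (b : V A.base) (v : TangentSpace 𝓘(ℝ, EM × (Fin k → F)) A) :
    (b, v) ∈ 𝒜.ETangent k A ↔
      (𝒜.jetDeriv k x₀ A v).1 =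
        𝒜.localAnchor x₀ (chartAt EM x₀ A.base, 𝒜.fibMap x₀ A.base b) := by
  rw [𝒜.jetDeriv_fst hA, ← 𝒜.chartDeriv_chartAt_anchor hA]
  constructor
  · intro h
    exact congrArg _ (Eq.symm h)
  · intro h
    exact (𝒜.injective_chartDeriv_chartAt hA h).symm

/-- The fibre coordinates on `𝒯ᴱEᵏ`. -/
noncomputable def fibCoord {k : ℕ} (x₀ : M) (A : 𝒜.JetSpace k) :
    𝒜.ETangent k A →ₗ[ℝ] (Fin (k + 1) → F) :=
  LinearMap.pi fun i => Fin.cases (motive := fun _ => 𝒜.ETangent k A →ₗ[ℝ] F)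
    ((𝒜.fibMap x₀ A.base).comp ((LinearMap.fst ℝ _ _).comp (𝒜.ETangent k A).subtype))
    (fun i => (LinearMap.proj i).comp ((LinearMap.snd ℝ EM (Fin k → F)).comp
      ((𝒜.jetDeriv k x₀ A).toLinearMap.comp
        ((LinearMap.snd ℝ _ _).comp (𝒜.ETangent k A).subtype)))) i

theorem fibCoord_zero {k : ℕ} (x₀ : M) (A : 𝒜.JetSpace k) (z : 𝒜.ETangent k A) :
    𝒜.fibCoord x₀ A z 0 = 𝒜.fibMap x₀ A.base z.1.1 := rfl

theorem fibCoord_succ {k : ℕ} (x₀ : M) (A : 𝒜.JetSpace k) (z : 𝒜.ETangent k A) (i : Fin k) :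
    𝒜.fibCoord x₀ A z i.succ = (𝒜.jetDeriv k x₀ A z.1.2).2 i := rfl

theorem jetDeriv_eq_coVec {k : ℕ} {x₀ : M} {A : 𝒜.JetSpace k} (hA : A ∈ 𝒜.jetDom k x₀)
    (z : 𝒜.ETangent k A) :
    𝒜.jetDeriv k x₀ A z.1.2 =
      coVec (𝒜.localAnchor x₀) (𝒜.jetCoord k x₀ A).1 (𝒜.fibCoord x₀ A z) :=
  Prod.ext ((𝒜.mem_ETangent_iff hA z.1.1 z.1.2).1 z.2) rfl

theorem bijective_fibCoord {k : ℕ} {x₀ : M} {A : 𝒜.JetSpace k} (hA : A ∈ 𝒜.jetDom k x₀) :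
    Function.Bijective (𝒜.fibCoord x₀ A) := by
  constructor
  · intro z w h
    have h1 := 𝒜.jetDeriv_eq_coVec hA z
    rw [h, ← 𝒜.jetDeriv_eq_coVec hA w] at h1
    have h2 := (𝒜.bijective_jetDeriv hA).1 h1
    have h3 := congrFun h 0
    rw [fibCoord_zero, fibCoord_zero] at h3
    have h4 := congrArg (𝒜.fibInv x₀ A.base) h3
    rw [𝒜.fibInv_fibMap hA, 𝒜.fibInv_fibMap hA] at h4
    exact Subtype.ext (Prod.ext h4 h2)
  · intro y
    obtain ⟨v, hv⟩ := (𝒜.bijective_jetDeriv hA).2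
      (coVec (𝒜.localAnchor x₀) (𝒜.jetCoord k x₀ A).1 y)
    refine ⟨⟨(𝒜.fibInv x₀ A.base (y 0), v), (𝒜.mem_ETangent_iff hA _ _).2 ?_⟩, ?_⟩
    · rw [hv, 𝒜.fibMap_fibInv hA]
      rfl
    · funext i
      rcases Fin.eq_zero_or_eq_succ i with rfl | ⟨j, rfl⟩
      · rw [fibCoord_zero]
        exact 𝒜.fibMap_fibInv hA _
      · rw [fibCoord_succ]
        exact congrFun (congrArg Prod.snd hv) j

/-- The fibre coordinates on `𝒯ᴱEᵏ`, as a linear equivalence. -/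
noncomputable def fibEquiv {k : ℕ} {x₀ : M} {A : 𝒜.JetSpace k} (hA : A ∈ 𝒜.jetDom k x₀) :
    𝒜.ETangent k A ≃ₗ[ℝ] (Fin (k + 1) → F) :=
  LinearEquiv.ofBijective (𝒜.fibCoord x₀ A) (𝒜.bijective_fibCoord hA)

theorem fibEquiv_apply {k : ℕ} {x₀ : M} {A : 𝒜.JetSpace k} (hA : A ∈ 𝒜.jetDom k x₀)
    (z : 𝒜.ETangent k A) : 𝒜.fibEquiv hA z = 𝒜.fibCoord x₀ A z := rfl

theorem fibCoord_fibEquiv_symm {k : ℕ} {x₀ : M} {A : 𝒜.JetSpace k} (hA : A ∈ 𝒜.jetDom k x₀)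
    (y : Fin (k + 1) → F) : 𝒜.fibCoord x₀ A ((𝒜.fibEquiv hA).symm y) = y :=
  (𝒜.fibEquiv hA).apply_symm_apply y

/-- In jet coordinates `τ_{k,l}` is a linear restriction, so its derivative merely forgets the last
`k - l` fibre coordinates. -/
theorem fibCoord_map {l k : ℕ} (h : l ≤ k) {x₀ : M} {A : 𝒜.JetSpace k} (hA : A ∈ 𝒜.jetDom k x₀)
    (z : 𝒜.ETangent k A) :
    𝒜.fibCoord x₀ (𝒜.trunc h A) (ETangent.map 𝒜 h A z) =
      reindex F (Fin.castLE (Nat.succ_le_succ h)) (𝒜.fibCoord x₀ A z) := by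
  have hA' : 𝒜.trunc h A ∈ 𝒜.jetDom l x₀ := hA
  have h1 := (𝒜.hasMFDerivAt_jetCoord hA').comp A
    ((𝒜.contMDiff_trunc h).mdifferentiable (by simp) A).hasMFDerivAt
  have h2 := (restrJet EM F h).hasFDerivAt.hasMFDerivAt.comp A (𝒜.hasMFDerivAt_jetCoord hA)
  have h3 : 𝒜.jetCoord l x₀ ∘ 𝒜.trunc h =ᶠ[𝓝 A] restrJet EM F h ∘ 𝒜.jetCoord k x₀ := by
    filter_upwards [(𝒜.isOpen_jetDom k x₀).mem_nhds hA] with B hB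
      using 𝒜.jetCoord_trunc h hB
  have h4 := congrArg (fun L : (EM × (Fin k → F)) →L[ℝ] (EM × (Fin l → F)) => L z.1.2)
    (hasMFDerivAt_unique h1 (h2.congr_of_eventuallyEq h3))
  funext i
  rcases Fin.eq_zero_or_eq_succ i with rfl | ⟨j, rfl⟩
  · rfl
  · exact congrFun (congrArg Prod.snd h4) j

/-- The value `a(0)` has fibre coordinate `y₀`, and the velocity of the prolonged curve has
components `y₁, …, y_k`, the next derivatives. So `𝐓` is tautological in coordinates. -/
theorem fibCoord_canonicalInclusion {k : ℕ} {x₀ : M} {A : 𝒜.JetSpace (k + 1)}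
    (hA : A ∈ 𝒜.jetDom (k + 1) x₀) :
    𝒜.fibCoord x₀ (𝒜.trunc k.le_succ A) (𝒜.canonicalInclusion k A) =
      (𝒜.jetCoord (k + 1) x₀ A).2 := by
  obtain ⟨x, q⟩ := A
  induction q using Quotient.inductionOn with | _ a
  have hx : x ∈ 𝒜.dom x₀ := hA
  have hx' : (a.toFun 0).proj ∈ 𝒜.dom x₀ := by rw [a.proj_zero]; exact hx
  show _ = (𝒜.jetCoord (k + 1) x₀ (a.toJet (k + 1))).2
  rw [jetCoord_mk hx]
  funext i
  rcases Fin.eq_zero_or_eq_succ i with rfl | ⟨j, rfl⟩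
  · show 𝒜.fibMap x₀ x a.value = iteratedDeriv 0 (fun t => (𝒜.bundleChart x₀ (a.toFun t)).2) 0
    rw [iteratedDeriv_zero, ← a.mk_value, 𝒜.bundleChart_mk hx]
  · show (𝒜.jetDeriv k x₀ (a.toJet k) (𝒜.prolongVelocity k a)).2 j = a.fib x₀ (j + 1)
    have h1 := ((𝒜.contMDiffAt_prolong k a).mdifferentiableAt (by simp)).hasMFDerivAt
    have hg : HasMFDerivAt 𝓘(ℝ, EM × (Fin k → F)) 𝓘(ℝ, EM × (Fin k → F)) (𝒜.jetCoord k x₀)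
        (𝒜.prolong k a 0) (𝒜.jetDeriv k x₀ (a.toJet k)) := by
      rw [𝒜.prolong_zero]; exact 𝒜.hasMFDerivAt_jetCoord (A := a.toJet k) hx
    have h2 := hg.comp (0 : ℝ) h1
    have h0 := a.admissible.self_of_nhds.coord hx'
    have h3 : HasDerivAt (fun t => ((𝒜.bundleChart x₀ (a.toFun t)).1,
        fun i : Fin k => iteratedDeriv i (fun s => (𝒜.bundleChart x₀ (a.toFun s)).2) t))
        (𝒜.localAnchor x₀ (𝒜.bundleChart x₀ (a.toFun 0)), fun i : Fin k => a.fib x₀ (i + 1))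
        0 := by
      refine h0.2.1.prodMk (hasDerivAt_pi.2 fun i => ?_)
      rw [EPath.fib, iteratedDeriv_succ]
      exact ((contDiffAt_iteratedDeriv h0.1.snd i).differentiableAt (by simp)).hasDerivAt
    have h4 : 𝒜.jetCoord k x₀ ∘ 𝒜.prolong k a =ᶠ[𝓝 0]
        fun t => ((𝒜.bundleChart x₀ (a.toFun t)).1,
          fun i : Fin k => iteratedDeriv i (fun s => (𝒜.bundleChart x₀ (a.toFun s)).2) t) := by
      filter_upwards [𝒜.eventually_jetCoord_prolong k a hx] with t ht
      exact ht.2.2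
    have h5 := hasMFDerivAt_unique (h2.congr_of_eventuallyEq h4.symm)
      h3.hasFDerivAt.hasMFDerivAt
    have h6 := congrArg (fun L : ℝ →L[ℝ] EM × (Fin k → F) => L 1) h5
    refine (congrFun (congrArg Prod.snd h6) j).trans ?_
    simp [ContinuousLinearMap.toSpanSingleton_apply]

/-! ### Smooth sections in coordinates -/

/-- Smoothness at a point of a section of `𝒯ᴱEᵏ`. -/
def IsSmoothSectionAt {k : ℕ} (Z : ∀ A : 𝒜.JetSpace k, 𝒜.ETangent k A) (A : 𝒜.JetSpace k) :
    Prop :=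
  ContMDiffAt 𝓘(ℝ, EM × (Fin k → F)) (𝓘(ℝ, EM).prod 𝓘(ℝ, F)) ∞
    (fun A => (⟨A.base, (Z A).1.1⟩ : TotalSpace F V)) A ∧
  ContMDiffAt 𝓘(ℝ, EM × (Fin k → F)) 𝓘(ℝ, EM × (Fin k → F)).tangent ∞
    (fun A => (⟨A, (Z A).1.2⟩ : TangentBundle 𝓘(ℝ, EM × (Fin k → F)) (𝒜.JetSpace k))) A

theorem isSmoothSection_iff {k : ℕ} (Z : ∀ A : 𝒜.JetSpace k, 𝒜.ETangent k A) :
    𝒜.IsSmoothSection k Z ↔ ∀ A, 𝒜.IsSmoothSectionAt Z A :=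
  ⟨fun h A => ⟨h.1 A, h.2 A⟩, fun h => ⟨fun A => (h A).1, fun A => (h A).2⟩⟩

/-- The base component of the vector part is a smooth function, the local anchor, of the base point
and the zeroth coordinate. It imposes no smoothness condition of its own. -/
theorem isSmoothSectionAt_iff {k : ℕ} {x₀ : M} (Z : ∀ A : 𝒜.JetSpace k, 𝒜.ETangent k A)
    {A : 𝒜.JetSpace k} (hA : A ∈ 𝒜.jetDom k x₀) :
    𝒜.IsSmoothSectionAt Z A ↔ ContMDiffAt 𝓘(ℝ, EM × (Fin k → F)) 𝓘(ℝ, Fin (k + 1) → F) ∞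
      (fun A => 𝒜.fibCoord x₀ A (Z A)) A := by
  have hbase : ContMDiffAt 𝓘(ℝ, EM × (Fin k → F)) (𝓘(ℝ, EM).prod 𝓘(ℝ, F)) ∞
      (fun A => (⟨A.base, (Z A).1.1⟩ : TotalSpace F V)) A ↔
      ContMDiffAt 𝓘(ℝ, EM × (Fin k → F)) 𝓘(ℝ, F) ∞
        (fun A => 𝒜.fibMap x₀ A.base (Z A).1.1) A := by
    have hs : (⟨A.base, (Z A).1.1⟩ : TotalSpace F V) ∈ (trivializationAt F V x₀).source :=
      (trivializationAt F V x₀).mem_source.2 hA.2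
    refine (Bundle.Trivialization.contMDiffAt_iff (e := trivializationAt F V x₀) (n := ∞)
      (f := fun A : 𝒜.JetSpace k => (⟨A.base, (Z A).1.1⟩ : TotalSpace F V)) hs).trans ?_
    have h1 : ContMDiffAt 𝓘(ℝ, EM × (Fin k → F)) 𝓘(ℝ, EM) ∞
        (fun A : 𝒜.JetSpace k => A.base) A := 𝒜.contMDiff_proj k A
    rw [and_iff_right h1]
    refine Filter.EventuallyEq.contMDiffAt_iff ?_
    filter_upwards [(𝒜.isOpen_jetDom k x₀).mem_nhds hA] with B hB
    rw [fibMap, Trivialization.linearMapAt_apply, if_pos hB.2]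
  constructor
  · rintro ⟨h1, h2⟩
    have h3 := contMDiffAt_mfderiv_vectorField (𝒜.isOpen_jetDom k x₀)
      (𝒜.contMDiffOn_jetCoord k x₀) hA h2
    rw [contMDiffAt_pi_space]
    intro i
    rcases Fin.eq_zero_or_eq_succ i with rfl | ⟨j, rfl⟩
    · exact hbase.1 h1
    · have h4 : ContDiff ℝ ∞ (fun p : EM × (Fin k → F) => p.2 j) := by fun_prop
      exact h4.contMDiff.contMDiffAt.comp A h3
  · intro h
    have h0 := contMDiffAt_pi_space.1 h
    refine ⟨hbase.2 (h0 0), ?_⟩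
    refine contMDiffAt_vectorField_of_mfderiv (𝒜.isOpen_jetDom k x₀) (𝒜.isOpen_coordImage k x₀)
      (𝒜.contMDiffOn_jetCoord k x₀) (𝒜.contMDiffOn_jetChart_symm k x₀)
      (fun A hA => 𝒜.jetCoord_mem hA) (fun A hA => 𝒜.jetChart_symm_jetCoord hA) hA ?_
    have h1 : ContMDiffAt 𝓘(ℝ, EM × (Fin k → F)) 𝓘(ℝ, EM × (Fin k → F)) ∞
        (fun A => coVec (𝒜.localAnchor x₀) (𝒜.jetCoord k x₀ A).1 (𝒜.fibCoord x₀ A (Z A))) A := by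
      have hg := (𝒜.contMDiffOn_jetCoord k x₀).contMDiffAt ((𝒜.isOpen_jetDom k x₀).mem_nhds hA)
      have hg1 := (contDiff_fst (n := ∞) (𝕜 := ℝ) (E := EM)
        (F := Fin k → F)).contMDiff.contMDiffAt.comp A hg
      have hR : ContDiffAt ℝ ∞ (𝒜.localAnchor x₀)
          ((𝒜.jetCoord k x₀ A).1, 𝒜.fibCoord x₀ A (Z A) 0) :=
        (𝒜.contDiffOn_localAnchor x₀).contDiffAt
          (((𝒜.isOpen_cdom x₀).prod isOpen_univ).mem_nhds ⟨𝒜.chart_mem_cdom hA, mem_univ _⟩)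
      have hpair : ContMDiffAt 𝓘(ℝ, EM × (Fin k → F)) 𝓘(ℝ, EM × F) ∞
          (fun A => ((𝒜.jetCoord k x₀ A).1, 𝒜.fibCoord x₀ A (Z A) 0)) A :=
        hg1.prodMk_space (h0 0)
      have hRc : ContMDiffAt 𝓘(ℝ, EM × F) 𝓘(ℝ, EM) ∞ (𝒜.localAnchor x₀)
          ((𝒜.jetCoord k x₀ A).1, 𝒜.fibCoord x₀ A (Z A) 0) := hR.contMDiffAt
      have hcomp := ContMDiffAt.comp (g := 𝒜.localAnchor x₀)
        (f := fun A => ((𝒜.jetCoord k x₀ A).1, 𝒜.fibCoord x₀ A (Z A) 0)) A hRc hpair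
      refine ContMDiffAt.prodMk_space hcomp ?_
      exact contMDiffAt_pi_space.2 fun i => h0 i.succ
    refine h1.congr_of_eventuallyEq ?_
    filter_upwards [(𝒜.isOpen_jetDom k x₀).mem_nhds hA] with B hB
    exact 𝒜.jetDeriv_eq_coVec hB (Z B)

end

end LieAlgebroid

namespace LieAlgebroid

section

variable {EM F : Type*} {M : Type*} {V : M → Type*}
  [NormedAddCommGroup EM] [NormedSpace ℝ EM]
  [NormedAddCommGroup F] [NormedSpace ℝ F]
  [TopologicalSpace M] [ChartedSpace EM M] [IsManifold 𝓘(ℝ, EM) ∞ M]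
  [TopologicalSpace (TotalSpace F V)] [∀ x, TopologicalSpace (V x)] [FiberBundle F V]
  [∀ x, AddCommGroup (V x)] [∀ x, Module ℝ (V x)] [VectorBundle ℝ F V]
  [ContMDiffVectorBundle ∞ F V 𝓘(ℝ, EM)]
  (𝒜 : LieAlgebroid EM F V) [FiniteDimensional ℝ EM] [FiniteDimensional ℝ F] [T2Space M]

open JetCalculus


/-! ### Projectable sections -/

theorem isSmoothSection_of_support {k : ℕ} {Z : ∀ A : 𝒜.JetSpace k, 𝒜.ETangent k A}
    {O K : Set M} (hK : IsClosed K) (hKO : K ⊆ O)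
    (hZ : ∀ A : 𝒜.JetSpace k, A.base ∈ O → 𝒜.IsSmoothSectionAt Z A)
    (h0 : ∀ A : 𝒜.JetSpace k, A.base ∉ K → Z A = 0) : 𝒜.IsSmoothSection k Z := by
  refine (𝒜.isSmoothSection_iff Z).2 fun A => ?_
  by_cases hA : A.base ∈ O
  · exact hZ A hA
  · refine (𝒜.isSmoothSectionAt_iff (x₀ := A.base) Z (𝒜.mem_dom _)).2 ?_
    refine (contMDiffAt_const (c := (0 : Fin (k + 1) → F))).congr_of_eventuallyEq ?_
    have hc : Continuous (fun A : 𝒜.JetSpace k => A.base) := (𝒜.contMDiff_proj k).continuous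
    filter_upwards [(hK.isOpen_compl.preimage hc).mem_nhds fun h => hA (hKO h)] with B hB
    rw [h0 B hB, map_zero]

theorem ProjectableSection.isSmoothSection {𝒜 : LieAlgebroid EM F V} {k : ℕ}
    (Z : 𝒜.ProjectableSection k) : 𝒜.IsSmoothSection k Z.toSection :=
  ⟨Z.sec.contMDiff.comp (𝒜.contMDiff_proj k), Z.contMDiff_vec⟩

/-- Extend `z` with constant fibre coordinates, multiplied by a cutoff pulled back from `M`. These
sections are what makes the formula for `dλ` on projectable sections determine `dλ` pointwise. -/
theorem exists_projectableSection {k : ℕ} (A : 𝒜.JetSpace k) (z : 𝒜.ETangent k A) :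
    ∃ Z : 𝒜.ProjectableSection k, Z.toSection A = z := by
  classical
  let x₀ := A.base
  have hA : A ∈ 𝒜.jetDom k x₀ := 𝒜.mem_dom x₀
  obtain ⟨φ, hφ, hs, h1⟩ := exists_cutoff EM (𝒜.isOpen_dom x₀) (𝒜.mem_dom x₀)
  let y := 𝒜.fibCoord x₀ A z
  let Z : ∀ B : 𝒜.JetSpace k, 𝒜.ETangent k B := fun B =>
    if hB : B ∈ 𝒜.jetDom k x₀ then φ B.base • (𝒜.fibEquiv hB).symm y else 0
  have hZ : ∀ B ∈ 𝒜.jetDom k x₀, 𝒜.fibCoord x₀ B (Z B) = φ B.base • y := by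
    intro B hB
    simp only [Z, dif_pos hB, map_smul, 𝒜.fibCoord_fibEquiv_symm hB]
  have hZs : 𝒜.IsSmoothSection k Z := by
    refine 𝒜.isSmoothSection_of_support (isClosed_tsupport φ) hs (fun B hB => ?_) fun B hB => ?_
    · refine (𝒜.isSmoothSectionAt_iff Z hB).2 ?_
      have h2 : ContMDiffAt 𝓘(ℝ, EM × (Fin k → F)) 𝓘(ℝ, ℝ) ∞
          (fun B : 𝒜.JetSpace k => φ B.base) B := (hφ.comp (𝒜.contMDiff_proj k)).contMDiffAt
      refine (h2.smul (contMDiffAt_const (c := y))).congr_of_eventuallyEq ?_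
      filter_upwards [(𝒜.isOpen_jetDom k x₀).mem_nhds hB] with B' hB' using hZ B' hB'
    · simp only [Z, image_eq_zero_of_notMem_tsupport hB, zero_smul, dite_eq_ite, ite_self]
  -- Since the cutoff and the zeroth coordinate depend on the base point only, the `E`-component
  -- comes from a section over `M`. This is projectability.
  have hsec : ∀ B : 𝒜.JetSpace k, 𝒜.cutoffSection hφ hs (y 0) B.base = (Z B).1.1 := by
    intro B
    by_cases hB : B ∈ 𝒜.jetDom k x₀
    · have h2 := 𝒜.fibInv_fibMap hB (Z B).1.1
      rw [← fibCoord_zero, hZ B hB, Pi.smul_apply, map_smul] at h2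
      exact h2
    · rw [cutoffSection_apply, image_eq_zero_of_notMem_tsupport fun h => hB (hs h), zero_smul]
      simp only [Z, dif_neg hB]
      rfl
  refine ⟨⟨𝒜.cutoffSection hφ hs (y 0), fun B => (Z B).1.2, hZs.2, fun B => ?_⟩, ?_⟩
  · rw [hsec]; exact (Z B).2
  · have h2 : Z A = z := by
      apply (𝒜.bijective_fibCoord hA).1
      rw [hZ A hA, h1.self_of_nhds, Pi.one_apply, one_smul]
    refine Subtype.ext (Prod.ext ?_ ?_)
    · exact (hsec A).trans (by rw [h2])
    · have h3 : (Z A).1.2 = z.1.2 := by rw [h2]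
      exact h3

/-! ### Brackets of projectable sections in coordinates -/

/-- The coordinate expression of a section of `𝒯ᴱEᵏ`. -/
noncomputable def sectionLoc {k : ℕ} (x₀ : M) (Z : ∀ A : 𝒜.JetSpace k, 𝒜.ETangent k A)
    (p : EM × (Fin k → F)) : Fin (k + 1) → F :=
  𝒜.fibCoord x₀ ((𝒜.jetChart k x₀).symm p) (Z ((𝒜.jetChart k x₀).symm p))

theorem sectionLoc_jetCoord {k : ℕ} {x₀ : M} {A : 𝒜.JetSpace k} (hA : A ∈ 𝒜.jetDom k x₀)
    (Z : ∀ A : 𝒜.JetSpace k, 𝒜.ETangent k A) :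
    𝒜.sectionLoc x₀ Z (𝒜.jetCoord k x₀ A) = 𝒜.fibCoord x₀ A (Z A) := by
  rw [sectionLoc, 𝒜.jetChart_symm_jetCoord hA]

theorem contDiffOn_sectionLoc {k : ℕ} (x₀ : M) {Z : ∀ A : 𝒜.JetSpace k, 𝒜.ETangent k A}
    (hZ : 𝒜.IsSmoothSection k Z) :
    ContDiffOn ℝ ∞ (𝒜.sectionLoc x₀ Z) (𝒜.cdom x₀ ×ˢ (univ : Set (Fin k → F))) := by
  rw [← contMDiffOn_iff_contDiffOn]
  have h1 : ContMDiffOn 𝓘(ℝ, EM × (Fin k → F)) 𝓘(ℝ, Fin (k + 1) → F) ∞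
      (fun A => 𝒜.fibCoord x₀ A (Z A)) (𝒜.jetDom k x₀) := fun A hA =>
    ((𝒜.isSmoothSectionAt_iff Z hA).1 ((𝒜.isSmoothSection_iff Z).1 hZ A)).contMDiffWithinAt
  exact h1.comp (𝒜.contMDiffOn_jetChart_symm k x₀) fun p hp => 𝒜.jetChart_symm_mem hp.1

theorem differentiableAt_sectionLoc {k : ℕ} {x₀ : M} {Z : ∀ A : 𝒜.JetSpace k, 𝒜.ETangent k A}
    (hZ : 𝒜.IsSmoothSection k Z) {p : EM × (Fin k → F)} (hp : p.1 ∈ 𝒜.cdom x₀) :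
    DifferentiableAt ℝ (𝒜.sectionLoc x₀ Z) p :=
  ((𝒜.contDiffOn_sectionLoc x₀ hZ).contDiffAt
    ((𝒜.isOpen_coordImage k x₀).mem_nhds ⟨hp, mem_univ _⟩)).differentiableAt (by simp)

theorem sectionLoc_zero {k : ℕ} {x₀ : M} (Z : 𝒜.ProjectableSection k)
    {p : EM × (Fin k → F)} (hp : p.1 ∈ 𝒜.cdom x₀) :
    𝒜.sectionLoc x₀ Z.toSection p 0 = 𝒜.secLoc x₀ Z.sec p.1 := by
  show 𝒜.fibMap x₀ _ (Z.sec ((𝒜.jetChart k x₀).symm p).base) = _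
  rw [secLoc, ← 𝒜.jetChart_symm_base hp]

theorem jetDeriv_vec {k : ℕ} {x₀ : M} (Z : 𝒜.ProjectableSection k)
    {p : EM × (Fin k → F)} (hp : p.1 ∈ 𝒜.cdom x₀) :
    𝒜.jetDeriv k x₀ ((𝒜.jetChart k x₀).symm p) (Z.vec ((𝒜.jetChart k x₀).symm p)) =
      coVec (𝒜.localAnchor x₀) p.1 (𝒜.sectionLoc x₀ Z.toSection p) := by
  refine (𝒜.jetDeriv_eq_coVec (𝒜.jetChart_symm_mem hp) (Z.toSection _)).trans ?_
  rw [𝒜.jetCoord_jetChart_symm hp]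
  rfl

theorem differentiableAt_coVec {k : ℕ} {x₀ : M} {Z : ∀ A : 𝒜.JetSpace k, 𝒜.ETangent k A}
    (hZ : 𝒜.IsSmoothSection k Z) {p : EM × (Fin k → F)} (hp : p.1 ∈ 𝒜.cdom x₀) :
    DifferentiableAt ℝ (fun q : EM × (Fin k → F) =>
      coVec (𝒜.localAnchor x₀) q.1 (𝒜.sectionLoc x₀ Z q)) p := by
  have h1 := 𝒜.differentiableAt_sectionLoc hZ hp
  have h2 := differentiableAt_pi.1 h1
  have h3 : DifferentiableAt ℝ (𝒜.localAnchor x₀) (p.1, 𝒜.sectionLoc x₀ Z p 0) :=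
    ((𝒜.contDiffOn_localAnchor x₀).contDiffAt
      (((𝒜.isOpen_cdom x₀).prod isOpen_univ).mem_nhds ⟨hp, mem_univ _⟩)).differentiableAt (by simp)
  refine DifferentiableAt.prodMk ?_ (differentiableAt_pi.2 fun i => h2 i.succ)
  exact DifferentiableAt.comp (g := 𝒜.localAnchor x₀)
    (f := fun q : EM × (Fin k → F) => (q.1, 𝒜.sectionLoc x₀ Z q 0)) p h3
    (differentiableAt_fst.prodMk (h2 0))

theorem jetDeriv_mlieBracket {k : ℕ} {x₀ : M} (Z W : 𝒜.ProjectableSection k)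
    {p : EM × (Fin k → F)} (hp : p.1 ∈ 𝒜.cdom x₀) :
    𝒜.jetDeriv k x₀ ((𝒜.jetChart k x₀).symm p)
        (VectorField.mlieBracket 𝓘(ℝ, EM × (Fin k → F)) Z.vec W.vec
          ((𝒜.jetChart k x₀).symm p)) =
      fderiv ℝ (fun q => coVec (𝒜.localAnchor x₀) q.1 (𝒜.sectionLoc x₀ W.toSection q)) p
        (coVec (𝒜.localAnchor x₀) p.1 (𝒜.sectionLoc x₀ Z.toSection p)) -
      fderiv ℝ (fun q => coVec (𝒜.localAnchor x₀) q.1 (𝒜.sectionLoc x₀ Z.toSection q)) p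
        (coVec (𝒜.localAnchor x₀) p.1 (𝒜.sectionLoc x₀ W.toSection p)) := by
  have h1 : ∀ Z : 𝒜.ProjectableSection k,
      (fun q => chartDeriv (𝒜.jetCoord k x₀) ((𝒜.jetChart k x₀).symm q)
        (Z.vec ((𝒜.jetChart k x₀).symm q))) =ᶠ[𝓝 p]
      fun q => coVec (𝒜.localAnchor x₀) q.1 (𝒜.sectionLoc x₀ Z.toSection q) := by
    intro Z
    filter_upwards [(𝒜.isOpen_coordImage k x₀).mem_nhds ⟨hp, mem_univ _⟩] with q hq
      using 𝒜.jetDeriv_vec Z hq.1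
  have h2 := mfderiv_chart_mlieBracket (𝒜.isOpen_jetDom k x₀) (𝒜.isOpen_coordImage k x₀)
    (𝒜.contMDiffOn_jetCoord k x₀) (𝒜.contMDiffOn_jetChart_symm k x₀)
    (fun q hq => 𝒜.jetChart_symm_mem hq.1) (fun q hq => 𝒜.jetCoord_jetChart_symm hq.1)
    (fun A hA => 𝒜.jetChart_symm_jetCoord hA) (p := p) ⟨hp, mem_univ _⟩
    Z.contMDiff_vec W.contMDiff_vec
  refine h2.trans ?_
  have h3 : ∀ Z : 𝒜.ProjectableSection k,
      chartDeriv (𝒜.jetCoord k x₀) ((𝒜.jetChart k x₀).symm p)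
        (Z.vec ((𝒜.jetChart k x₀).symm p)) =
      coVec (𝒜.localAnchor x₀) p.1 (𝒜.sectionLoc x₀ Z.toSection p) := fun Z =>
    𝒜.jetDeriv_vec Z hp
  rw [VectorField.lieBracket, (h1 Z).fderiv_eq, (h1 W).fderiv_eq, h3, h3]

theorem fderiv_coVec_fst {k : ℕ} {x₀ : M} (Z : 𝒜.ProjectableSection k)
    {p : EM × (Fin k → F)} (hp : p.1 ∈ 𝒜.cdom x₀) (v : EM × (Fin k → F)) :
    (fderiv ℝ (fun q => coVec (𝒜.localAnchor x₀) q.1 (𝒜.sectionLoc x₀ Z.toSection q)) p v).1 =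
      fderiv ℝ (fun u => 𝒜.localAnchor x₀ (u, 𝒜.secLoc x₀ Z.sec u)) p.1 v.1 := by
  have h1 := (𝒜.differentiableAt_coVec Z.isSmoothSection hp).hasFDerivAt.fst
  have h2 : DifferentiableAt ℝ (fun u => 𝒜.localAnchor x₀ (u, 𝒜.secLoc x₀ Z.sec u)) p.1 := by
    have h3 : DifferentiableAt ℝ (𝒜.localAnchor x₀) (p.1, 𝒜.secLoc x₀ Z.sec p.1) :=
      ((𝒜.contDiffOn_localAnchor x₀).contDiffAt
        (((𝒜.isOpen_cdom x₀).prod isOpen_univ).mem_nhds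
          ⟨hp, mem_univ _⟩)).differentiableAt (by simp)
    exact DifferentiableAt.comp (g := 𝒜.localAnchor x₀)
      (f := fun u => (u, 𝒜.secLoc x₀ Z.sec u)) p.1 h3
      (differentiableAt_id.prodMk (𝒜.differentiableAt_secLoc hp Z.sec))
  have h4 := h2.hasFDerivAt.comp p (ContinuousLinearMap.fst ℝ EM (Fin k → F)).hasFDerivAt
  have h5 : (fun q => (coVec (𝒜.localAnchor x₀) q.1 (𝒜.sectionLoc x₀ Z.toSection q)).1) =ᶠ[𝓝 p]
      (fun u => 𝒜.localAnchor x₀ (u, 𝒜.secLoc x₀ Z.sec u)) ∘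
        (ContinuousLinearMap.fst ℝ EM (Fin k → F)) := by
    filter_upwards [(𝒜.isOpen_coordImage k x₀).mem_nhds ⟨hp, mem_univ _⟩] with q hq
    simp only [coVec, 𝒜.sectionLoc_zero Z hq.1]
    rfl
  exact congrArg (fun L : (EM × (Fin k → F)) →L[ℝ] EM => L v)
    (h1.unique (h4.congr_of_eventuallyEq h5))

/-- The pair of brackets again satisfies the compatibility with the anchor: the base component of
the bracket of the vector fields is the bracket of the anchored sections, and the anchor preserves
brackets (`localAnchor_bracket`). -/
theorem exists_isBracket {k : ℕ} (Z W : 𝒜.ProjectableSection k) :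
    ∃ B, 𝒜.IsBracket Z W B := by
  refine ⟨⟨𝒜.bracket Z.sec W.sec,
    VectorField.mlieBracket 𝓘(ℝ, EM × (Fin k → F)) Z.vec W.vec, fun A => ?_, fun A => ?_⟩, rfl, rfl⟩
  · have : IsManifold 𝓘(ℝ, EM × (Fin k → F)) (minSmoothness ℝ 2) (𝒜.JetSpace k) := by
      rw [minSmoothness_of_isRCLikeNormedField]
      exact IsManifold.of_le two_le_infty
    have : IsManifold 𝓘(ℝ, EM × (Fin k → F)) (((⊤ : ℕ∞) : ℕ∞ω) + 1) (𝒜.JetSpace k) :=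
      𝒜.instIsManifoldJetSpace k
    exact ContMDiffAt.mlieBracket_vectorField (m := ⊤) (n := ⊤) Z.contMDiff_vec.contMDiffAt
      W.contMDiff_vec.contMDiffAt (by simp)
  · let x₀ := A.base
    have hA : A ∈ 𝒜.jetDom k x₀ := 𝒜.mem_dom x₀
    have hp : (𝒜.jetCoord k x₀ A).1 ∈ 𝒜.cdom x₀ := 𝒜.chart_mem_cdom hA
    rw [𝒜.mem_ETangent_iff hA]
    have h1 := congrArg Prod.fst (𝒜.jetDeriv_mlieBracket Z W hp)
    rw [Prod.fst_sub, 𝒜.fderiv_coVec_fst W hp, 𝒜.fderiv_coVec_fst Z hp] at h1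
    simp only [coVec, 𝒜.sectionLoc_zero Z hp, 𝒜.sectionLoc_zero W hp] at h1
    rw [← 𝒜.localAnchor_bracket hp, 𝒜.jetChart_symm_jetCoord hA] at h1
    rw [h1, jetCoord_fst, secLoc, (chartAt EM x₀).left_inv hA.1]

/-- The structure functions enter only in slot `0`, which carries the bracket of `E`; the other
slots are components of an ordinary bracket of vector fields. -/
theorem sectionLoc_bracket {k : ℕ} {x₀ : M} {Z W B : 𝒜.ProjectableSection k}
    (hB : 𝒜.IsBracket Z W B) {p : EM × (Fin k → F)} (hp : p.1 ∈ 𝒜.cdom x₀) :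
    𝒜.sectionLoc x₀ B.toSection p =
      fderiv ℝ (𝒜.sectionLoc x₀ W.toSection) p
        (coVec (𝒜.localAnchor x₀) p.1 (𝒜.sectionLoc x₀ Z.toSection p)) -
      fderiv ℝ (𝒜.sectionLoc x₀ Z.toSection) p
        (coVec (𝒜.localAnchor x₀) p.1 (𝒜.sectionLoc x₀ W.toSection p)) +
      Pi.single 0 (𝒜.structureFun x₀ p.1 (𝒜.sectionLoc x₀ Z.toSection p 0)
        (𝒜.sectionLoc x₀ W.toSection p 0)) := by
  have hpi : ∀ (Z : 𝒜.ProjectableSection k) (v : EM × (Fin k → F)) (i : Fin (k + 1)),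
      fderiv ℝ (𝒜.sectionLoc x₀ Z.toSection) p v i =
        fderiv ℝ (fun q => 𝒜.sectionLoc x₀ Z.toSection q i) p v := by
    intro Z v i
    have h1 := (hasFDerivAt_pi'.1
      (𝒜.differentiableAt_sectionLoc Z.isSmoothSection hp).hasFDerivAt) i
    rw [h1.fderiv]
    rfl
  -- By projectability the zeroth component is a function on the base, so only the base part of `v`
  -- differentiates it. This matches the derivatives in `secLoc_bracket`.
  have hzero : ∀ (Z : 𝒜.ProjectableSection k) (v : EM × (Fin k → F)),
      fderiv ℝ (fun q => 𝒜.sectionLoc x₀ Z.toSection q 0) p v =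
        fderiv ℝ (𝒜.secLoc x₀ Z.sec) p.1 v.1 := by
    intro Z v
    have h4 := (𝒜.differentiableAt_secLoc hp Z.sec).hasFDerivAt.comp p
      (ContinuousLinearMap.fst ℝ EM (Fin k → F)).hasFDerivAt
    have h5 : (fun q => 𝒜.sectionLoc x₀ Z.toSection q 0) =ᶠ[𝓝 p]
        𝒜.secLoc x₀ Z.sec ∘ (ContinuousLinearMap.fst ℝ EM (Fin k → F)) := by
      filter_upwards [(𝒜.isOpen_coordImage k x₀).mem_nhds ⟨hp, mem_univ _⟩] with q hq
        using 𝒜.sectionLoc_zero Z hq.1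
    rw [(h4.congr_of_eventuallyEq h5).fderiv]
    rfl
  funext i
  rcases Fin.eq_zero_or_eq_succ i with rfl | ⟨j, rfl⟩
  · rw [𝒜.sectionLoc_zero B hp, hB.1, 𝒜.secLoc_bracket hp]
    simp only [Pi.add_apply, Pi.sub_apply, Pi.single_eq_same, hpi, hzero]
    simp only [coVec, 𝒜.sectionLoc_zero Z hp, 𝒜.sectionLoc_zero W hp]
  · simp only [Pi.add_apply, Pi.sub_apply, hpi, Pi.single_eq_of_ne (Fin.succ_ne_zero j), add_zero]
    have h1 : 𝒜.sectionLoc x₀ B.toSection p j.succ =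
        (𝒜.jetDeriv k x₀ ((𝒜.jetChart k x₀).symm p)
          (VectorField.mlieBracket 𝓘(ℝ, EM × (Fin k → F)) Z.vec W.vec
            ((𝒜.jetChart k x₀).symm p))).2 j := by
      rw [← hB.2]
      rfl
    have h2 : ∀ (Z : 𝒜.ProjectableSection k) (v : EM × (Fin k → F)),
        (fderiv ℝ (fun q => coVec (𝒜.localAnchor x₀) q.1
          (𝒜.sectionLoc x₀ Z.toSection q)) p v).2 j =
        fderiv ℝ (fun q => 𝒜.sectionLoc x₀ Z.toSection q j.succ) p v := by
      intro Z v
      have h3 := (hasFDerivAt_pi'.1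
        (𝒜.differentiableAt_coVec Z.isSmoothSection hp).hasFDerivAt.snd) j
      have h4 : fderiv ℝ (fun q => 𝒜.sectionLoc x₀ Z.toSection q j.succ) p = _ := h3.fderiv
      rw [h4]
      rfl
    rw [h1, 𝒜.jetDeriv_mlieBracket Z W hp, Prod.snd_sub, Pi.sub_apply, h2, h2]

/-! ### Coordinate expressions of one-forms -/

/-- The image in the model space of a subset of the coordinate domain at `x₀`. -/
def chartImage (_ : LieAlgebroid EM F V) (x₀ : M) (U : Set M) : Set EM :=
  (chartAt EM x₀).target ∩ (chartAt EM x₀).symm ⁻¹' U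

/-- The one-form `lam` is smooth over the open set `U`, with coordinate expression `Λ` at `x₀`. -/
structure HasCoordExpr {k : ℕ} (x₀ : M) (U : Set M) (lam : 𝒜.OneForm k)
    (Λ : EM × (Fin k → F) → (Fin (k + 1) → F) →L[ℝ] ℝ) : Prop where
  isOpen : IsOpen U
  subset_dom : U ⊆ 𝒜.dom x₀
  contDiffOn : ContDiffOn ℝ ∞ Λ (𝒜.chartImage x₀ U ×ˢ univ)
  apply_eq : ∀ A : 𝒜.JetSpace k, A.base ∈ U → ∀ z,
    lam A z = Λ (𝒜.jetCoord k x₀ A) (𝒜.fibCoord x₀ A z)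

theorem isOpen_chartImage (x₀ : M) {U : Set M} (hU : IsOpen U) : IsOpen (𝒜.chartImage x₀ U) :=
  (chartAt EM x₀).isOpen_inter_preimage_symm hU

theorem chartImage_subset {x₀ : M} {U : Set M} (hU : U ⊆ 𝒜.dom x₀) :
    𝒜.chartImage x₀ U ⊆ 𝒜.cdom x₀ :=
  inter_subset_inter_right _ (preimage_mono hU)

theorem chart_mem_chartImage {x₀ x : M} {U : Set M} (hU : U ⊆ 𝒜.dom x₀) (hx : x ∈ U) :
    chartAt EM x₀ x ∈ 𝒜.chartImage x₀ U :=
  ⟨(chartAt EM x₀).map_source (hU hx).1, by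
    rw [mem_preimage, (chartAt EM x₀).left_inv (hU hx).1]; exact hx⟩

/-- The exterior differential of a one-form, in coordinates. -/
noncomputable def differentialLoc (x₀ : M) {k : ℕ}
    (Λ : EM × (Fin k → F) → (Fin (k + 1) → F) →L[ℝ] ℝ) (p : EM × (Fin k → F))
    (z w : Fin (k + 1) → F) : ℝ :=
  fderiv ℝ Λ p (coVec (𝒜.localAnchor x₀) p.1 z) w -
    fderiv ℝ Λ p (coVec (𝒜.localAnchor x₀) p.1 w) z -
    Λ p (Pi.single 0 (𝒜.structureFun x₀ p.1 (z 0) (w 0)))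

theorem coVec_localAnchor_add {k : ℕ} {x₀ : M} {u : EM} (hu : u ∈ 𝒜.cdom x₀)
    (z w : Fin (k + 1) → F) :
    coVec (𝒜.localAnchor x₀) u (z + w) =
      coVec (𝒜.localAnchor x₀) u z + coVec (𝒜.localAnchor x₀) u w :=
  Prod.ext (𝒜.localAnchor_add hu _ _) rfl

theorem coVec_localAnchor_smul {k : ℕ} {x₀ : M} {u : EM} (hu : u ∈ 𝒜.cdom x₀) (c : ℝ)
    (z : Fin (k + 1) → F) :
    coVec (𝒜.localAnchor x₀) u (c • z) = c • coVec (𝒜.localAnchor x₀) u z :=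
  Prod.ext (𝒜.localAnchor_smul hu _ _) rfl

theorem exists_differentialLoc_eq {k : ℕ} {x₀ : M} {A : 𝒜.JetSpace k} (hA : A ∈ 𝒜.jetDom k x₀)
    (Λ : EM × (Fin k → F) → (Fin (k + 1) → F) →L[ℝ] ℝ) :
    ∃ om : 𝒜.ETangent k A →ₗ[ℝ] 𝒜.ETangent k A →ₗ[ℝ] ℝ, ∀ z w, om z w =
      𝒜.differentialLoc x₀ Λ (𝒜.jetCoord k x₀ A) (𝒜.fibCoord x₀ A z) (𝒜.fibCoord x₀ A w) := by
  have hu : (𝒜.jetCoord k x₀ A).1 ∈ 𝒜.cdom x₀ := 𝒜.chart_mem_cdom hA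
  refine ⟨LinearMap.mk₂ ℝ (fun z w => 𝒜.differentialLoc x₀ Λ (𝒜.jetCoord k x₀ A)
    (𝒜.fibCoord x₀ A z) (𝒜.fibCoord x₀ A w)) ?_ ?_ ?_ ?_, fun z w => rfl⟩
  all_goals
    intros
    simp only [differentialLoc, map_add, map_smul, 𝒜.coVec_localAnchor_add hu,
      𝒜.coVec_localAnchor_smul hu, Pi.add_apply, Pi.smul_apply, _root_.add_apply,
      _root_.smul_apply, Pi.single_add, Pi.single_smul, smul_eq_mul]
    ring

/-! ### Exterior differential and total time derivative in coordinates -/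

section

variable {𝒜} {k : ℕ} {x₀ : M} {U : Set M} {lam : 𝒜.OneForm k}
  {Λ : EM × (Fin k → F) → (Fin (k + 1) → F) →L[ℝ] ℝ}

theorem HasCoordExpr.differentiableAt (h : 𝒜.HasCoordExpr x₀ U lam Λ) {x : M} (hx : x ∈ U)
    (y : Fin k → F) : DifferentiableAt ℝ Λ (chartAt EM x₀ x, y) :=
  (h.contDiffOn.contDiffAt (((𝒜.isOpen_chartImage x₀ h.isOpen).prod isOpen_univ).mem_nhds
    ⟨𝒜.chart_mem_chartImage h.subset_dom hx, mem_univ _⟩)).differentiableAt (by simp)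

theorem isOpen_base_preimage {U : Set M} (hU : IsOpen U) :
    IsOpen {A : 𝒜.JetSpace k | A.base ∈ U} :=
  hU.preimage (𝒜.contMDiff_proj k).continuous

theorem HasCoordExpr.tangentDeriv_apply (h : 𝒜.HasCoordExpr x₀ U lam Λ) {A : 𝒜.JetSpace k}
    (hA : A.base ∈ U) {W : ∀ A : 𝒜.JetSpace k, 𝒜.ETangent k A} (hW : 𝒜.IsSmoothSection k W)
    (z : 𝒜.ETangent k A) :
    tangentDeriv 𝓘(ℝ, EM × (Fin k → F)) (fun A' => lam A' (W A')) A z.1.2 =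
      fderiv ℝ Λ (𝒜.jetCoord k x₀ A)
        (coVec (𝒜.localAnchor x₀) (𝒜.jetCoord k x₀ A).1 (𝒜.fibCoord x₀ A z))
        (𝒜.fibCoord x₀ A (W A)) +
      Λ (𝒜.jetCoord k x₀ A) (fderiv ℝ (𝒜.sectionLoc x₀ W) (𝒜.jetCoord k x₀ A)
        (coVec (𝒜.localAnchor x₀) (𝒜.jetCoord k x₀ A).1 (𝒜.fibCoord x₀ A z))) := by
  have hA' : A ∈ 𝒜.jetDom k x₀ := h.subset_dom hA
  have h1 : HasFDerivAt Λ _ (𝒜.jetCoord k x₀ A) :=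
    (h.differentiableAt hA (𝒜.jetCoord k x₀ A).2).hasFDerivAt
  have h2 := (𝒜.differentiableAt_sectionLoc hW
    (p := 𝒜.jetCoord k x₀ A) (𝒜.chart_mem_cdom hA')).hasFDerivAt
  have h3 := h1.clm_apply h2
  have h4 : (fun A' => lam A' (W A')) =ᶠ[𝓝 A]
      fun B => (fun q => Λ q (𝒜.sectionLoc x₀ W q)) (𝒜.jetCoord k x₀ B) := by
    filter_upwards [(isOpen_base_preimage h.isOpen).mem_nhds hA] with B hB
    rw [h.apply_eq B hB, 𝒜.sectionLoc_jetCoord (h.subset_dom hB)]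
  rw [tangentDeriv_eq_fderiv (𝒜.isOpen_jetDom k x₀) (𝒜.contMDiffOn_jetCoord k x₀) hA'
    h3.differentiableAt h4, h3.fderiv]
  have h5 : chartDeriv (𝒜.jetCoord k x₀) A z.1.2 =
    coVec (𝒜.localAnchor x₀) (𝒜.jetCoord k x₀ A).1 (𝒜.fibCoord x₀ A z) :=
    𝒜.jetDeriv_eq_coVec hA' z
  rw [h5]
  simp only [_root_.add_apply, ContinuousLinearMap.comp_apply, ContinuousLinearMap.flip_apply,
    𝒜.sectionLoc_jetCoord hA']
  exact add_comm _ _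

/-- The derivatives of the components of `Z` and `W` produced by the product rule cancel against
those in the bracket. What is left depends only on the values of `Z` and `W` at `A`. -/
theorem HasCoordExpr.differential (h : 𝒜.HasCoordExpr x₀ U lam Λ) {A : 𝒜.JetSpace k}
    (hA : A.base ∈ U) {Z W B : 𝒜.ProjectableSection k} (hB : 𝒜.IsBracket Z W B) :
    _root_.tangentDeriv 𝓘(ℝ, EM × (Fin k → F)) (fun A' => lam A' (W.toSection A')) A (Z.vec A) -
      _root_.tangentDeriv 𝓘(ℝ, EM × (Fin k → F)) (fun A' => lam A' (Z.toSection A')) A (W.vec A) -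
      lam A (B.toSection A) =
    𝒜.differentialLoc x₀ Λ (𝒜.jetCoord k x₀ A) (𝒜.fibCoord x₀ A (Z.toSection A))
      (𝒜.fibCoord x₀ A (W.toSection A)) := by
  have hA' : A ∈ 𝒜.jetDom k x₀ := h.subset_dom hA
  have h1 := h.tangentDeriv_apply hA W.isSmoothSection (Z.toSection A)
  have h2 := h.tangentDeriv_apply hA Z.isSmoothSection (W.toSection A)
  have h3 := 𝒜.sectionLoc_bracket hB (p := 𝒜.jetCoord k x₀ A) (𝒜.chart_mem_cdom hA')
  simp only [𝒜.sectionLoc_jetCoord hA'] at h3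
  rw [h.apply_eq A hA, h3]
  refine (congrArg₂ (fun a b : ℝ => a - b - _) h1 h2).trans ?_
  simp only [differentialLoc, map_add, map_sub]
  ring

/-- Existence: the local expressions define a bilinear form at each point. Uniqueness: projectable
sections pass through every vector. The hypothesis is global because `exteriorDifferential` is `0`
unless a differential exists on the whole of `Eᵏ`. -/
theorem exteriorDifferential_apply
    (hlam : ∀ x : M, ∃ x₀ U Λ, x ∈ U ∧ 𝒜.HasCoordExpr x₀ U lam Λ)
    (h : 𝒜.HasCoordExpr x₀ U lam Λ) {A : 𝒜.JetSpace k} (hA : A.base ∈ U)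
    (z w : 𝒜.ETangent k A) :
    𝒜.exteriorDifferential lam A z w =
      𝒜.differentialLoc x₀ Λ (𝒜.jetCoord k x₀ A) (𝒜.fibCoord x₀ A z) (𝒜.fibCoord x₀ A w) := by
  have hex : ∃ om, 𝒜.IsExteriorDifferential lam om := by
    choose x₁ U₁ Λ₁ hx₁ h₁ using hlam
    choose om hom using fun A : 𝒜.JetSpace k =>
      𝒜.exists_differentialLoc_eq ((h₁ A.base).subset_dom (hx₁ A.base)) (Λ₁ A.base)
    refine ⟨om, fun Z W B hB A => ?_⟩
    rw [hom, (h₁ A.base).differential (hx₁ A.base) hB]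
  rw [exteriorDifferential, dif_pos hex]
  obtain ⟨Z, rfl⟩ := 𝒜.exists_projectableSection A z
  obtain ⟨W, rfl⟩ := 𝒜.exists_projectableSection A w
  obtain ⟨B, hB⟩ := 𝒜.exists_isBracket Z W
  rw [hex.choose_spec Z W B hB A, h.differential hA hB]

theorem HasCoordExpr.pullback (h : 𝒜.HasCoordExpr x₀ U lam Λ) {n : ℕ} (hk : k ≤ n) :
    𝒜.HasCoordExpr x₀ U (𝒜.pullback hk lam) (pullbackLoc hk Λ) where
  isOpen := h.isOpen
  subset_dom := h.subset_dom
  contDiffOn := by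
    have h1 : ContDiffOn ℝ ∞ (fun p => Λ (restrJet EM F hk p)) (𝒜.chartImage x₀ U ×ˢ univ) :=
      h.contDiffOn.comp (restrJet EM F hk).contDiff.contDiffOn fun p hp => ⟨hp.1, mem_univ _⟩
    exact h1.clm_comp contDiffOn_const
  apply_eq A hA z := by
    have hA' : A ∈ 𝒜.jetDom n x₀ := h.subset_dom hA
    show lam (𝒜.trunc hk A) (ETangent.map 𝒜 hk A z) = _
    rw [h.apply_eq _ hA, 𝒜.fibCoord_map hk hA', 𝒜.jetCoord_trunc hk hA']
    rfl

/-- The term of `d(i_𝐓 λ)` which differentiates `Λ` along `z` cancels with the corresponding term of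
`i_𝐓(dλ)`. There remain the derivative of `Λ` along `𝐓`, the shift coming from differentiating the
tautological coordinates of `𝐓`, and the structure function term. -/
theorem HasCoordExpr.totalTimeDeriv (h : 𝒜.HasCoordExpr x₀ U lam Λ)
    (hlam : ∀ x : M, ∃ x₀ U Λ, x ∈ U ∧ 𝒜.HasCoordExpr x₀ U lam Λ) :
    𝒜.HasCoordExpr x₀ U (𝒜.totalTimeDeriv lam)
      (totalDerivForm (𝒜.localAnchor x₀) (𝒜.structureFun x₀) Λ) where
  isOpen := h.isOpen
  subset_dom := h.subset_dom
  contDiffOn := contDiffOn_totalDerivForm (𝒜.isOpen_chartImage x₀ h.isOpen)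
    ((𝒜.contDiffOn_localAnchor x₀).mono
      (prod_mono_left (𝒜.chartImage_subset h.subset_dom)))
    ((𝒜.contDiffOn_structureFun x₀).mono (𝒜.chartImage_subset h.subset_dom)) h.contDiffOn
  apply_eq A hA z := by
    have hA' : A ∈ 𝒜.jetDom (k + 1) x₀ := h.subset_dom hA
    have hB : (𝒜.trunc k.le_succ A).base ∈ U := hA
    have hcoord : 𝒜.jetCoord k x₀ (𝒜.trunc k.le_succ A) =
        restrJet EM F k.le_succ (𝒜.jetCoord (k + 1) x₀ A) := 𝒜.jetCoord_trunc k.le_succ hA'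
    set p := 𝒜.jetCoord (k + 1) x₀ A with hp
    have h1 : HasFDerivAt Λ (fderiv ℝ Λ (restrJet EM F k.le_succ p)) (restrJet EM F k.le_succ p) :=
      (h.differentiableAt hA (fun i => p.2 (Fin.castLE k.le_succ i))).hasFDerivAt
    have h2 := (h1.comp p (restrJet EM F k.le_succ).hasFDerivAt).clm_apply
      (ContinuousLinearMap.snd ℝ EM (Fin (k + 1) → F)).hasFDerivAt
    have h3 : 𝒜.contractT lam =ᶠ[𝓝 A] fun B =>
        (fun q => (Λ ∘ restrJet EM F k.le_succ) q
          (ContinuousLinearMap.snd ℝ EM (Fin (k + 1) → F) q)) (𝒜.jetCoord (k + 1) x₀ B) := by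
      filter_upwards [(isOpen_base_preimage h.isOpen).mem_nhds hA] with B hB
      have hB' : B ∈ 𝒜.jetDom (k + 1) x₀ := h.subset_dom hB
      have hB2 : (𝒜.trunc k.le_succ B).base ∈ U := hB
      rw [contractT, h.apply_eq _ hB2, 𝒜.fibCoord_canonicalInclusion hB',
        𝒜.jetCoord_trunc k.le_succ hB']
      rfl
    have h4 := tangentDeriv_eq_fderiv (𝒜.isOpen_jetDom (k + 1) x₀)
      (𝒜.contMDiffOn_jetCoord (k + 1) x₀) hA' h2.differentiableAt h3 z.1.2
    have h5 : chartDeriv (𝒜.jetCoord (k + 1) x₀) A z.1.2 =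
      coVec (𝒜.localAnchor x₀) p.1 (𝒜.fibCoord x₀ A z) := 𝒜.jetDeriv_eq_coVec hA' z
    rw [h5, h2.fderiv] at h4
    have h6 := exteriorDifferential_apply hlam h hB (𝒜.canonicalInclusion k A)
      (ETangent.map 𝒜 k.le_succ A z)
    rw [𝒜.fibCoord_canonicalInclusion hA', 𝒜.fibCoord_map k.le_succ hA', hcoord] at h6
    refine (congrArg₂ (fun a b : ℝ => a + b) h4 h6).trans ?_
    set y := 𝒜.fibCoord x₀ A z with hy
    have h7 : restrJet EM F k.le_succ (coVec (𝒜.localAnchor x₀) p.1 y) =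
        coVec (𝒜.localAnchor x₀) p.1
          (reindex F (Fin.castLE (Nat.succ_le_succ k.le_succ)) y) := rfl
    have h8 : shiftFib (𝒜.structureFun x₀ p.1 (p.2 0)) y =
        (fun i : Fin (k + 1) => y i.succ) -
          Pi.single 0 (𝒜.structureFun x₀ p.1 (p.2 0) (y 0)) := by
      funext i
      rw [shiftFib_apply, Pi.sub_apply, Pi.single_apply]
    simp only [differentialLoc, totalDerivForm, _root_.add_apply, ContinuousLinearMap.comp_apply,
      ContinuousLinearMap.flip_apply, Function.comp_apply, restrJet_fst, h7, h8, map_sub]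
    show _ + _ + _ = _
    have h9 : (ContinuousLinearMap.snd ℝ EM (Fin (k + 1) → F))
      (coVec (𝒜.localAnchor x₀) p.1 y) = fun i : Fin (k + 1) => y i.succ := rfl
    have h10 : (ContinuousLinearMap.snd ℝ EM (Fin (k + 1) → F)) p = p.2 := rfl
    have h11 : reindex F (Fin.castLE (Nat.succ_le_succ k.le_succ)) y 0 = y 0 := rfl
    rw [h9, h10, h11]
    abel

end

/-! ### Iterated total time derivatives in coordinates -/

theorem bundleChart_symm_apply {x₀ : M} {u : EM} (hu : u ∈ 𝒜.cdom x₀) (v : F) :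
    (𝒜.bundleChart x₀).symm (u, v) =
      ⟨(chartAt EM x₀).symm u, 𝒜.fibInv x₀ ((chartAt EM x₀).symm u) v⟩ := by
  have h1 := 𝒜.bundleChart_mk (𝒜.symm_mem_dom hu) (𝒜.fibInv x₀ ((chartAt EM x₀).symm u) v)
  rw [𝒜.fibMap_fibInv (𝒜.symm_mem_dom hu), (chartAt EM x₀).right_inv hu.1] at h1
  rw [← h1]
  refine (𝒜.bundleChart x₀).left_inv ?_
  rw [bundleChart_source]
  exact 𝒜.symm_mem_dom hu

/-- The coordinate expression of a section of the dual bundle. -/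
noncomputable def dualLoc (x₀ : M) (θ : ∀ x, Module.Dual ℝ (V x)) (u : EM) : F →L[ℝ] ℝ :=
  LinearMap.toContinuousLinearMap
    ((θ ((chartAt EM x₀).symm u)).comp (𝒜.fibInv x₀ ((chartAt EM x₀).symm u)))

theorem dualLoc_apply {x₀ x : M} (hx : x ∈ 𝒜.dom x₀) (θ : ∀ x, Module.Dual ℝ (V x)) (b : V x) :
    𝒜.dualLoc x₀ θ (chartAt EM x₀ x) (𝒜.fibMap x₀ x b) = θ x b := by
  show θ ((chartAt EM x₀).symm (chartAt EM x₀ x))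
    (𝒜.fibInv x₀ ((chartAt EM x₀).symm (chartAt EM x₀ x)) (𝒜.fibMap x₀ x b)) = θ x b
  rw [(chartAt EM x₀).left_inv hx.1, 𝒜.fibInv_fibMap hx]

theorem contDiffOn_dualLoc (x₀ : M) {θ : ∀ x, Module.Dual ℝ (V x)}
    (hθ : 𝒜.IsSmoothDualSection θ) : ContDiffOn ℝ ∞ (𝒜.dualLoc x₀ θ) (𝒜.cdom x₀) := by
  rw [contDiffOn_clm_apply]
  intro v
  have h1 : ContMDiffOn 𝓘(ℝ, EM × F) 𝓘(ℝ, ℝ) ∞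
      ((fun p : TotalSpace F V => θ p.proj p.snd) ∘ (𝒜.bundleChart x₀).symm)
      (𝒜.cdom x₀ ×ˢ univ) := ContMDiff.comp_contMDiffOn hθ (𝒜.contMDiffOn_bundleChart_symm x₀)
  rw [contMDiffOn_iff_contDiffOn] at h1
  have h2 : ContDiffOn ℝ ∞ (fun u : EM => (u, v)) (𝒜.cdom x₀) :=
    ContDiff.contDiffOn (by fun_prop)
  refine (h1.comp h2 fun u hu => ⟨hu, mem_univ _⟩).congr fun u hu => ?_
  simp only [Function.comp_apply]
  rw [𝒜.bundleChart_symm_apply hu]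
  rfl

/-- The coordinate expression of the iterated total time derivatives of a section of the dual
bundle. -/
noncomputable def iterLoc (x₀ : M) (θ : ∀ x, Module.Dual ℝ (V x)) :
    (r : ℕ) → EM × (Fin r → F) → (Fin (r + 1) → F) →L[ℝ] ℝ
  | 0 => fun p => (𝒜.dualLoc x₀ θ p.1).comp (ContinuousLinearMap.proj 0)
  | r + 1 => totalDerivForm (𝒜.localAnchor x₀) (𝒜.structureFun x₀) (iterLoc x₀ θ r)

theorem hasCoordExpr_iterTotalTimeDeriv {θ : ∀ x, Module.Dual ℝ (V x)}
    (hθ : 𝒜.IsSmoothDualSection θ) (r : ℕ) (x₀ : M) :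
    𝒜.HasCoordExpr x₀ (𝒜.dom x₀) (𝒜.iterTotalTimeDeriv θ r) (𝒜.iterLoc x₀ θ r) := by
  induction r generalizing x₀ with
  | zero =>
    refine ⟨𝒜.isOpen_dom x₀, subset_rfl, ?_, fun A hA z => (𝒜.dualLoc_apply hA θ z.1.1).symm⟩
    have h1 : ContDiffOn ℝ ∞ (fun p : EM × (Fin 0 → F) => 𝒜.dualLoc x₀ θ p.1)
        (𝒜.chartImage x₀ (𝒜.dom x₀) ×ˢ univ) :=
      (𝒜.contDiffOn_dualLoc x₀ hθ).comp contDiff_fst.contDiffOn fun p hp => hp.1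
    exact h1.clm_comp contDiffOn_const
  | succ r ih =>
    -- The induction runs over all charts at once, since the exterior differential requires
    -- coordinate expressions around every point.
    exact (ih x₀).totalTimeDeriv fun x => ⟨x, _, _, 𝒜.mem_dom x, ih x⟩

/-- This moves the iterated derivatives, whose orders vary, to `Eᵏ`, where they are the iterates of
a single operator applied to `θ e₀`. -/
theorem pullbackLoc_iterLoc {θ : ∀ x, Module.Dual ℝ (V x)} (hθ : 𝒜.IsSmoothDualSection θ)
    (x₀ : M) {k : ℕ} (r : ℕ) (hr : r ≤ k) :
    EqOn (pullbackLoc hr (𝒜.iterLoc x₀ θ r))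
      ((truncDeriv (𝒜.localAnchor x₀) (𝒜.structureFun x₀))^[r]
        fun p => (𝒜.dualLoc x₀ θ p.1).comp
          (frameForm (𝒜.localAnchor x₀) (𝒜.structureFun x₀) k 0 p))
      (𝒜.cdom x₀ ×ˢ univ) := by
  induction r with
  | zero => exact fun p _ => rfl
  | succ r ih =>
    intro p hp
    rw [Function.iterate_succ_apply']
    have hd : DifferentiableAt ℝ (𝒜.iterLoc x₀ θ r)
        (restrJet EM F ((Nat.le_succ r).trans hr) p) :=
      ((𝒜.hasCoordExpr_iterTotalTimeDeriv hθ r x₀).contDiffOn.contDiffAt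
        ((𝒜.isOpen_coordImage r x₀).mem_nhds ⟨hp.1, mem_univ _⟩)).differentiableAt (by simp)
    exact (pullbackLoc_totalDerivForm _ _ hr (𝒜.iterLoc x₀ θ r) p hd).trans
      (truncDeriv_congr (𝒜.isOpen_cdom x₀) (ih ((Nat.le_succ r).trans hr)) hp)

theorem pullback_iterTotalTimeDeriv_apply {θ : ∀ x, Module.Dual ℝ (V x)}
    (hθ : 𝒜.IsSmoothDualSection θ) {x₀ : M} {k r : ℕ} (hr : r ≤ k) {A : 𝒜.JetSpace k}
    (hA : A ∈ 𝒜.jetDom k x₀) (z : 𝒜.ETangent k A) :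
    𝒜.pullback hr (𝒜.iterTotalTimeDeriv θ r) A z =
      ((truncDeriv (𝒜.localAnchor x₀) (𝒜.structureFun x₀))^[r]
        fun p => (𝒜.dualLoc x₀ θ p.1).comp
          (frameForm (𝒜.localAnchor x₀) (𝒜.structureFun x₀) k 0 p))
      (𝒜.jetCoord k x₀ A) (𝒜.fibCoord x₀ A z) := by
  rw [((𝒜.hasCoordExpr_iterTotalTimeDeriv hθ r x₀).pullback hr).apply_eq A hA,
    𝒜.pullbackLoc_iterLoc hθ x₀ r hr (𝒜.jetCoord_mem hA)]

/-- The dual section which is, in coordinates at `x₀`, the constant covector `β` times the cutoff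
function `φ`. -/
noncomputable def cutoffDual (x₀ : M) (φ : M → ℝ) (β : F →L[ℝ] ℝ) (x : M) : Module.Dual ℝ (V x) :=
  φ x • β.toLinearMap.comp (𝒜.fibMap x₀ x)

theorem isSmoothDualSection_cutoffDual {x₀ : M} {φ : M → ℝ}
    (hφ : ContMDiff 𝓘(ℝ, EM) 𝓘(ℝ, ℝ) ∞ φ) (hs : tsupport φ ⊆ 𝒜.dom x₀) (β : F →L[ℝ] ℝ) :
    𝒜.IsSmoothDualSection (𝒜.cutoffDual x₀ φ β) := by
  have hproj : Continuous (TotalSpace.proj : TotalSpace F V → M) :=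
    FiberBundle.continuous_proj F V
  intro p
  by_cases hp : p.proj ∈ 𝒜.dom x₀
  · have h1 : ContMDiffAt (𝓘(ℝ, EM).prod 𝓘(ℝ, F)) 𝓘(ℝ, EM × F) ∞ (𝒜.bundleChart x₀) p :=
      (𝒜.contMDiffOn_bundleChart x₀).contMDiffAt
        (((𝒜.isOpen_dom x₀).preimage hproj).mem_nhds hp)
    have h2 : ContMDiffAt (𝓘(ℝ, EM).prod 𝓘(ℝ, F)) 𝓘(ℝ, ℝ) ∞
        (fun p => β (𝒜.bundleChart x₀ p).2) p :=
      ((β.comp (ContinuousLinearMap.snd ℝ EM F)).contDiff (n := ∞)).contMDiff.contMDiffAt.comp p h1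
    have h3 : ContMDiffAt (𝓘(ℝ, EM).prod 𝓘(ℝ, F)) 𝓘(ℝ, ℝ) ∞
        (fun p : TotalSpace F V => φ p.proj) p :=
      (hφ.comp (Bundle.contMDiff_proj V)).contMDiffAt
    refine (h3.smul h2).congr_of_eventuallyEq ?_
    filter_upwards [((𝒜.isOpen_dom x₀).preimage hproj).mem_nhds hp] with q hq
    have h4 := 𝒜.bundleChart_mk hq q.snd
    show φ q.proj • β (𝒜.fibMap x₀ q.proj q.snd) = φ q.proj • β (𝒜.bundleChart x₀ q).2
    rw [show 𝒜.bundleChart x₀ q = _ from h4]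
  · refine (contMDiffAt_const (c := (0 : ℝ))).congr_of_eventuallyEq ?_
    filter_upwards [((isClosed_tsupport φ).isOpen_compl.preimage hproj).mem_nhds
      fun h => hp (hs h)] with q hq
    show φ q.proj • β (𝒜.fibMap x₀ q.proj q.snd) = 0
    rw [image_eq_zero_of_notMem_tsupport hq, zero_smul]

theorem dualLoc_cutoffDual {x₀ : M} (φ : M → ℝ) (β : F →L[ℝ] ℝ) {u : EM} (hu : u ∈ 𝒜.cdom x₀) :
    𝒜.dualLoc x₀ (𝒜.cutoffDual x₀ φ β) u = φ ((chartAt EM x₀).symm u) • β := by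
  ext v
  show φ _ • β (𝒜.fibMap x₀ _ (𝒜.fibInv x₀ _ v)) = _
  rw [𝒜.fibMap_fibInv (𝒜.symm_mem_dom hu)]
  rfl

/-- For `θ` equal to the constant covector `β` near the base point, the Leibniz rule has no terms in
derivatives of `β`, and `Dʳ(β e₀) = β e_r` there. Thus the iterated total derivatives realise all
functionals `β ∘ e_r` of the frame at `A`. -/
theorem exists_dualSection {k : ℕ} {x₀ : M} {A : 𝒜.JetSpace k} (hA : A ∈ 𝒜.jetDom k x₀)
    (β : F →L[ℝ] ℝ) : ∃ θ : ∀ x, Module.Dual ℝ (V x), 𝒜.IsSmoothDualSection θ ∧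
      ∀ r (hr : r ≤ k) (z : 𝒜.ETangent k A), 𝒜.pullback hr (𝒜.iterTotalTimeDeriv θ r) A z =
        β (frameForm (𝒜.localAnchor x₀) (𝒜.structureFun x₀) k r (𝒜.jetCoord k x₀ A)
          (𝒜.fibCoord x₀ A z)) := by
  obtain ⟨φ, hφ, hs, h1⟩ := exists_cutoff EM (𝒜.isOpen_dom x₀) hA
  -- The value of the cutoff at one point is not enough: derivatives are taken, so the computation
  -- takes place on an open set where `φ = 1`.
  obtain ⟨O, hO1, hO, hAO⟩ := mem_nhds_iff.1 h1
  have hU : IsOpen (𝒜.cdom x₀ ∩ 𝒜.chartImage x₀ O) :=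
    (𝒜.isOpen_cdom x₀).inter (𝒜.isOpen_chartImage x₀ hO)
  have hθ := 𝒜.isSmoothDualSection_cutoffDual hφ hs β
  refine ⟨𝒜.cutoffDual x₀ φ β, hθ, fun r hr z => ?_⟩
  rw [𝒜.pullback_iterTotalTimeDeriv_apply hθ hr hA]
  have hmem : 𝒜.jetCoord k x₀ A ∈ (𝒜.cdom x₀ ∩ 𝒜.chartImage x₀ O) ×ˢ (univ : Set (Fin k → F)) :=
    ⟨⟨𝒜.chart_mem_cdom hA, (chartAt EM x₀).map_source hA.1, by
      show (chartAt EM x₀).symm (chartAt EM x₀ A.base) ∈ O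
      rw [(chartAt EM x₀).left_inv hA.1]; exact hAO⟩, mem_univ _⟩
  have hR := (𝒜.contDiffOn_localAnchor x₀).mono
    (prod_mono_left (t := (univ : Set F)) (inter_subset_left (s := 𝒜.cdom x₀)
      (t := 𝒜.chartImage x₀ O)))
  have hC := (𝒜.contDiffOn_structureFun x₀).mono (inter_subset_left (s := 𝒜.cdom x₀)
      (t := 𝒜.chartImage x₀ O))
  have h2 : EqOn (fun p : EM × (Fin k → F) => (𝒜.dualLoc x₀ (𝒜.cutoffDual x₀ φ β) p.1).comp
        (frameForm (𝒜.localAnchor x₀) (𝒜.structureFun x₀) k 0 p))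
      (fun p => β.comp (frameForm (𝒜.localAnchor x₀) (𝒜.structureFun x₀) k 0 p))
      ((𝒜.cdom x₀ ∩ 𝒜.chartImage x₀ O) ×ˢ univ) := by
    intro p hp
    have h3 : φ ((chartAt EM x₀).symm p.1) = 1 := hO1 hp.1.2.2
    simp only [𝒜.dualLoc_cutoffDual φ β hp.1.1, h3, one_smul]
  rw [truncDeriv_iterate_congr hU h2 r hmem]
  have h4 : ∀ r, EqOn ((truncDeriv (𝒜.localAnchor x₀) (𝒜.structureFun x₀))^[r]
        (fun p => β.comp (frameForm (𝒜.localAnchor x₀) (𝒜.structureFun x₀) k 0 p)))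
      (fun p => β.comp (frameForm (𝒜.localAnchor x₀) (𝒜.structureFun x₀) k r p))
      ((𝒜.cdom x₀ ∩ 𝒜.chartImage x₀ O) ×ˢ univ) := by
    intro r
    induction r with
    | zero => exact fun p _ => rfl
    | succ r ih =>
      intro p hp
      rw [Function.iterate_succ_apply', truncDeriv_congr hU ih hp]
      have h5 := truncDeriv_comp (R := 𝒜.localAnchor x₀) (C := 𝒜.structureFun x₀)
        (θ := fun _ : EM × (Fin k → F) => β) (p := p) (differentiableAt_const _)
        (((contDiffOn_frameForm hU hR hC k r).contDiffAt
          ((hU.prod isOpen_univ).mem_nhds hp)).differentiableAt (by simp))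
      refine h5.trans ?_
      have h6 : truncDerivFun (𝒜.localAnchor x₀) (fun _ : EM × (Fin k → F) => β) p = 0 := by
        simp [truncDerivFun]
      rw [h6, ContinuousLinearMap.zero_comp, zero_add]
      rfl
  rw [h4 r hmem]
  rfl

/-! ### The frame given by the iterated total time derivatives -/

/-- The coordinates on the fibres of `𝒯ᴱEᵏ` given by the iterated total time derivatives of a local
frame of the dual bundle. -/
noncomputable def frameEquiv {k : ℕ} {x₀ : M} {A : 𝒜.JetSpace k} (hA : A ∈ 𝒜.jetDom k x₀) :
    𝒜.ETangent k A ≃ₗ[ℝ] (Fin (k + 1) → F) :=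
  LinearEquiv.ofBijective
    ((frameMap (𝒜.localAnchor x₀) (𝒜.structureFun x₀) (𝒜.jetCoord k x₀ A)).toLinearMap.comp
      (𝒜.fibCoord x₀ A))
    ((isInvertible_frameMap (𝒜.isOpen_cdom x₀) (𝒜.contDiffOn_localAnchor x₀)
      (𝒜.contDiffOn_structureFun x₀) (𝒜.jetCoord_mem hA)).bijective.comp (𝒜.bijective_fibCoord hA))

theorem frameEquiv_apply {k : ℕ} {x₀ : M} {A : 𝒜.JetSpace k} (hA : A ∈ 𝒜.jetDom k x₀)
    (z : 𝒜.ETangent k A) : 𝒜.frameEquiv hA z =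
      frameMap (𝒜.localAnchor x₀) (𝒜.structureFun x₀) (𝒜.jetCoord k x₀ A) (𝒜.fibCoord x₀ A z) :=
  rfl

/-- In the fibre coordinates this is `fibCoord_map`; triangularity of the frame transfers the
vanishing of the first `l + 1` entries to the frame coordinates. -/
theorem map_eq_zero_iff {k l : ℕ} (hl : l ≤ k) {x₀ : M} {A : 𝒜.JetSpace k}
    (hA : A ∈ 𝒜.jetDom k x₀) (z : 𝒜.ETangent k A) :
    ETangent.map 𝒜 hl A z = 0 ↔
      ∀ i : Fin (k + 1), (i : ℕ) < l + 1 → 𝒜.frameEquiv hA z i = 0 := by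
  have h1 := frameMap_eq_zero_iff (𝒜.isOpen_cdom x₀) (𝒜.contDiffOn_localAnchor x₀)
    (𝒜.contDiffOn_structureFun x₀) (𝒜.jetCoord_mem hA) (𝒜.fibCoord x₀ A z) (l + 1)
  refine Iff.trans ?_ h1.symm
  have hA' : 𝒜.trunc hl A ∈ 𝒜.jetDom l x₀ := hA
  rw [← (injective_iff_map_eq_zero' (𝒜.fibCoord x₀ (𝒜.trunc hl A))).1
    (𝒜.bijective_fibCoord hA').1, 𝒜.fibCoord_map hl hA]
  constructor
  · intro h i hi
    exact congrFun h ⟨i, hi⟩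
  · intro h
    funext i
    exact h _ i.2

/-- The vertical endomorphism is, in the coordinates given by the iterated total time derivatives,
the weighted shift. -/
theorem pullback_iterTotalTimeDeriv_comp_iff {k : ℕ} {x₀ : M} {A : 𝒜.JetSpace k}
    (hA : A ∈ 𝒜.jetDom k x₀) (S : Module.End ℝ (𝒜.ETangent k A)) :
    (∀ θ, 𝒜.IsSmoothDualSection θ → ∀ r (hr : r ≤ k) z,
      𝒜.pullback hr (𝒜.iterTotalTimeDeriv θ r) A (S z) =
        (r : ℝ) * 𝒜.pullback ((Nat.sub_le r 1).trans hr) (𝒜.iterTotalTimeDeriv θ (r - 1)) A z) ↔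
    ∀ z, 𝒜.frameEquiv hA (S z) = raise F k (𝒜.frameEquiv hA z) := by
  constructor
  · intro h z
    funext r
    rw [raise_apply, frameEquiv_apply, frameEquiv_apply, frameMap_apply, frameMap_apply]
    refine (SeparatingDual.eq_iff_forall_dual_eq (R := ℝ)).2 fun β => ?_
    -- One `θ` serves for both sides, since its pairing with the frame is known for all orders up to
    -- `k`, in particular for `r` and `r - 1`.
    obtain ⟨θ, hθ, h1⟩ := 𝒜.exists_dualSection hA β
    have h2 := h θ hθ r (by omega) z
    rw [h1, h1] at h2
    rw [h2, map_smul, smul_eq_mul]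
  · intro h θ hθ r hr z
    have h1 : ∀ z, 𝒜.fibCoord x₀ A (S ((𝒜.fibEquiv hA).symm (𝒜.fibCoord x₀ A z))) =
        𝒜.fibCoord x₀ A (S z) := fun z => by
      rw [← 𝒜.fibEquiv_apply hA z, LinearEquiv.symm_apply_apply]
    have hθ' : ContDiffOn ℝ ∞ (fun p : EM × (Fin k → F) => 𝒜.dualLoc x₀ θ p.1)
        (𝒜.cdom x₀ ×ˢ univ) :=
      (𝒜.contDiffOn_dualLoc x₀ hθ).comp contDiff_fst.contDiffOn fun p hp => hp.1
    -- For a section with variable coefficients the Leibniz induction is needed. It is applied with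
    -- `j = 0`, to the endomorphism transported to fibre coordinates.
    have h2 := truncDeriv_iterate_comp (𝒜.isOpen_cdom x₀) (𝒜.contDiffOn_localAnchor x₀)
      (𝒜.contDiffOn_structureFun x₀) (𝒜.jetCoord_mem hA)
      (S := fun y => 𝒜.fibCoord x₀ A (S ((𝒜.fibEquiv hA).symm y))) (fun r hr y => by
        have h3 := congrFun (h ((𝒜.fibEquiv hA).symm y)) ⟨r, by omega⟩
        rw [raise_apply, frameEquiv_apply, frameEquiv_apply, frameMap_apply, frameMap_apply,
          𝒜.fibCoord_fibEquiv_symm hA] at h3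
        exact h3) r _ hθ' 0 (by omega) (𝒜.fibCoord x₀ A z)
    rw [h1, Nat.cast_zero, zero_smul, add_zero, smul_eq_mul] at h2
    rw [𝒜.pullback_iterTotalTimeDeriv_apply hθ hr hA, h2,
      𝒜.pullback_iterTotalTimeDeriv_apply hθ _ hA]

/-! ### Endomorphism fields which are constant in the frame -/

/-- The field of endomorphisms of `𝒯ᴱEᵏ` with constant coordinate expression `L` in the frame
at `x₀`. -/
noncomputable def frameEnd {k : ℕ} (x₀ : M) (L : (Fin (k + 1) → F) →L[ℝ] (Fin (k + 1) → F))
    (A : 𝒜.JetSpace k) : Module.End ℝ (𝒜.ETangent k A) :=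
  open scoped Classical in
  if hA : A ∈ 𝒜.jetDom k x₀ then
    (𝒜.frameEquiv hA).symm.toLinearMap.comp
      (L.toLinearMap.comp (𝒜.frameEquiv hA).toLinearMap) else 0

theorem frameEnd_apply {k : ℕ} {x₀ : M} (L : (Fin (k + 1) → F) →L[ℝ] (Fin (k + 1) → F))
    {A : 𝒜.JetSpace k} (hA : A ∈ 𝒜.jetDom k x₀) (z : 𝒜.ETangent k A) :
    𝒜.frameEnd x₀ L A z = (𝒜.frameEquiv hA).symm (L (𝒜.frameEquiv hA z)) := by
  rw [frameEnd, dif_pos hA]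
  rfl

theorem frameEquiv_frameEnd {k : ℕ} {x₀ : M} (L : (Fin (k + 1) → F) →L[ℝ] (Fin (k + 1) → F))
    {A : 𝒜.JetSpace k} (hA : A ∈ 𝒜.jetDom k x₀) (z : 𝒜.ETangent k A) :
    𝒜.frameEquiv hA (𝒜.frameEnd x₀ L A z) = L (𝒜.frameEquiv hA z) := by
  rw [𝒜.frameEnd_apply L hA, LinearEquiv.apply_symm_apply]

theorem fibCoord_frameEnd {k : ℕ} {x₀ : M} (L : (Fin (k + 1) → F) →L[ℝ] (Fin (k + 1) → F))
    {A : 𝒜.JetSpace k} (hA : A ∈ 𝒜.jetDom k x₀) (z : 𝒜.ETangent k A) :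
    𝒜.fibCoord x₀ A (𝒜.frameEnd x₀ L A z) =
      (frameMap (𝒜.localAnchor x₀) (𝒜.structureFun x₀) (𝒜.jetCoord k x₀ A)).inverse
        (L (frameMap (𝒜.localAnchor x₀) (𝒜.structureFun x₀) (𝒜.jetCoord k x₀ A)
          (𝒜.fibCoord x₀ A z))) := by
  have h1 := 𝒜.frameEquiv_frameEnd L hA z
  rw [frameEquiv_apply, frameEquiv_apply] at h1
  have h2 := isInvertible_frameMap (𝒜.isOpen_cdom x₀) (𝒜.contDiffOn_localAnchor x₀)
    (𝒜.contDiffOn_structureFun x₀) (𝒜.jetCoord_mem hA)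
  rw [← h1, h2.inverse_apply_eq.2 rfl]

/-- In fibre coordinates the field is the conjugate of the constant `L` by the frame matrix, and
both this matrix and its inverse depend smoothly on the point. -/
theorem isSmoothSectionAt_frameEnd {k : ℕ} {x₀ : M}
    (L : (Fin (k + 1) → F) →L[ℝ] (Fin (k + 1) → F))
    {A : 𝒜.JetSpace k} (hA : A ∈ 𝒜.jetDom k x₀) {Z : ∀ A : 𝒜.JetSpace k, 𝒜.ETangent k A}
    (hZ : 𝒜.IsSmoothSectionAt Z A) :
    𝒜.IsSmoothSectionAt (fun B => 𝒜.frameEnd x₀ L B (Z B)) A := by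
  rw [𝒜.isSmoothSectionAt_iff _ hA] at hZ ⊢
  have hp : 𝒜.jetCoord k x₀ A ∈ 𝒜.cdom x₀ ×ˢ (univ : Set (Fin k → F)) := 𝒜.jetCoord_mem hA
  have hO := (𝒜.isOpen_coordImage k x₀).mem_nhds hp
  have hg := (𝒜.contMDiffOn_jetCoord k x₀).contMDiffAt ((𝒜.isOpen_jetDom k x₀).mem_nhds hA)
  have h1 : ContDiffAt ℝ ∞ (fun p : EM × (Fin k → F) =>
      ((frameMap (𝒜.localAnchor x₀) (𝒜.structureFun x₀) p).inverse.comp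
        (L.comp (frameMap (𝒜.localAnchor x₀) (𝒜.structureFun x₀) p)))) (𝒜.jetCoord k x₀ A) :=
    ((contDiffOn_inverse_frameMap (𝒜.isOpen_cdom x₀) (𝒜.contDiffOn_localAnchor x₀)
      (𝒜.contDiffOn_structureFun x₀) k).contDiffAt hO).clm_comp
      (contDiffAt_const.clm_comp ((contDiffOn_frameMap (𝒜.isOpen_cdom x₀)
        (𝒜.contDiffOn_localAnchor x₀) (𝒜.contDiffOn_structureFun x₀) k).contDiffAt hO))
  have h2 := h1.contMDiffAt.comp A hg
  refine (h2.clm_apply hZ).congr_of_eventuallyEq ?_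
  filter_upwards [(𝒜.isOpen_jetDom k x₀).mem_nhds hA] with B hB
  exact 𝒜.fibCoord_frameEnd L hB (Z B)

theorem IsSmoothSectionAt.congr {𝒜 : LieAlgebroid EM F V} {k : ℕ}
    {Z W : ∀ A : 𝒜.JetSpace k, 𝒜.ETangent k A} {A : 𝒜.JetSpace k}
    (hZ : 𝒜.IsSmoothSectionAt Z A) (h : ∀ᶠ B in 𝓝 A, W B = Z B) : 𝒜.IsSmoothSectionAt W A := by
  refine (𝒜.isSmoothSectionAt_iff W (𝒜.mem_dom A.base)).2
    (((𝒜.isSmoothSectionAt_iff Z (𝒜.mem_dom A.base)).1 hZ).congr_of_eventuallyEq ?_)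
  filter_upwards [h] with B hB
  rw [hB]

/-- At each jet the chart of its own base point is used. Smoothness near `A` requires a single
chart, which is allowed because the weighted shifts of different charts coincide. -/
theorem exists_vertical {k : ℕ} : ∃ S, 𝒜.IsVerticalEndomorphism k S := by
  have key : ∀ (A : 𝒜.JetSpace k) (x₀ x₁ : M) (h₀ : A ∈ 𝒜.jetDom k x₀) (_ : A ∈ 𝒜.jetDom k x₁),
      𝒜.frameEnd x₀ (raise F k) A = 𝒜.frameEnd x₁ (raise F k) A := by
    intro A x₀ x₁ h₀ h₁
    -- The identity for the iterated derivatives is free of coordinates: it is obtained from the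
    -- shift in the chart at `x₁` and read as the shift in the chart at `x₀`.
    have h2 := (𝒜.pullback_iterTotalTimeDeriv_comp_iff h₀ _).1
      ((𝒜.pullback_iterTotalTimeDeriv_comp_iff h₁ _).2 (𝒜.frameEquiv_frameEnd (raise F k) h₁))
    refine LinearMap.ext fun z => (𝒜.frameEquiv h₀).injective ?_
    rw [h2, 𝒜.frameEquiv_frameEnd _ h₀]
  refine ⟨fun A => 𝒜.frameEnd A.base (raise F k) A, fun Z hZ => ?_, fun θ hθ r hr => ?_⟩
  · refine (𝒜.isSmoothSection_iff _).2 fun A => ?_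
    have hA : A ∈ 𝒜.jetDom k A.base := 𝒜.mem_dom A.base
    refine (𝒜.isSmoothSectionAt_frameEnd (raise F k) hA
      ((𝒜.isSmoothSection_iff Z).1 hZ A)).congr ?_
    filter_upwards [(𝒜.isOpen_jetDom k A.base).mem_nhds hA] with B hB
    rw [key B B.base A.base (𝒜.mem_dom B.base) hB]
  · funext A
    have hA : A ∈ 𝒜.jetDom k A.base := 𝒜.mem_dom A.base
    exact LinearMap.ext fun z => (𝒜.pullback_iterTotalTimeDeriv_comp_iff hA _).2
      (𝒜.frameEquiv_frameEnd (raise F k) hA) θ hθ r hr z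

/-! ### Uniqueness and powers of the vertical endomorphism -/

section

variable {𝒜} {k : ℕ} {S : ∀ A : 𝒜.JetSpace k, Module.End ℝ (𝒜.ETangent k A)}

theorem IsVerticalEndomorphism.frameEquiv_apply (hS : 𝒜.IsVerticalEndomorphism k S) {x₀ : M}
    {A : 𝒜.JetSpace k} (hA : A ∈ 𝒜.jetDom k x₀) (z : 𝒜.ETangent k A) :
    𝒜.frameEquiv hA (S A z) = raise F k (𝒜.frameEquiv hA z) :=
  (𝒜.pullback_iterTotalTimeDeriv_comp_iff hA (S A)).1 (fun θ hθ r hr z =>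
    congrArg (fun lam : 𝒜.OneForm k => lam A z) (hS.apply_eq θ hθ r hr)) z

theorem IsVerticalEndomorphism.unique {S' : ∀ A : 𝒜.JetSpace k, Module.End ℝ (𝒜.ETangent k A)}
    (hS : 𝒜.IsVerticalEndomorphism k S) (hS' : 𝒜.IsVerticalEndomorphism k S') : S = S' := by
  funext A
  have hA : A ∈ 𝒜.jetDom k A.base := 𝒜.mem_dom A.base
  refine LinearMap.ext fun z => (𝒜.frameEquiv hA).injective ?_
  rw [hS.frameEquiv_apply, hS'.frameEquiv_apply]

theorem IsVerticalEndomorphism.frameEquiv_pow_apply (hS : 𝒜.IsVerticalEndomorphism k S) {x₀ : M}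
    {A : 𝒜.JetSpace k} (hA : A ∈ 𝒜.jetDom k x₀) (l : ℕ) (z : 𝒜.ETangent k A) :
    𝒜.frameEquiv hA ((S A ^ l) z) = (raise F k)^[l] (𝒜.frameEquiv hA z) := by
  induction l with
  | zero => rfl
  | succ l ih =>
    rw [pow_succ', Module.End.mul_apply, hS.frameEquiv_apply, ih, Function.iterate_succ_apply']

theorem dualAction_iterate (S : ∀ A : 𝒜.JetSpace k, Module.End ℝ (𝒜.ETangent k A))
    (l : ℕ) (lam : 𝒜.OneForm k) (A : 𝒜.JetSpace k) (z : 𝒜.ETangent k A) :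
    (𝒜.dualAction S)^[l] lam A z = lam A ((S A ^ l) z) := by
  induction l generalizing z with
  | zero => rfl
  | succ l ih =>
    rw [Function.iterate_succ_apply', pow_succ, Module.End.mul_apply, ← ih]
    rfl

theorem IsVerticalEndomorphism.isSmoothForm_iterate (hS : 𝒜.IsVerticalEndomorphism k S) (l : ℕ)
    {lam : 𝒜.OneForm k} (hlam : 𝒜.IsSmoothForm lam) :
    𝒜.IsSmoothForm ((𝒜.dualAction S)^[l] lam) := by
  induction l with
  | zero => exact hlam
  | succ l ih =>
    rw [Function.iterate_succ_apply']
    exact fun Z hZ => ih _ (hS.smooth Z hZ)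

theorem IsVerticalEndomorphism.map_pow_apply (hS : 𝒜.IsVerticalEndomorphism k S) {l : ℕ}
    (hl : l ≤ k) (A : 𝒜.JetSpace k) (z : 𝒜.ETangent k A) :
    ETangent.map 𝒜 hl A ((S A ^ (l + 1)) z) = 0 := by
  have hA : A ∈ 𝒜.jetDom k A.base := 𝒜.mem_dom A.base
  rw [𝒜.map_eq_zero_iff hl hA]
  intro i hi
  rw [hS.frameEquiv_pow_apply hA, raise_iterate_of_lt _ _ _ hi]

/-- Vectors in the kernel have vanishing frame coordinates below `l + 1`, and on such families the
iterated backward shift is a right inverse of the weighted shift. -/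
theorem IsVerticalEndomorphism.exists_pow_apply_eq (hS : 𝒜.IsVerticalEndomorphism k S) {l : ℕ}
    (hl : l ≤ k) {A : 𝒜.JetSpace k} {z : 𝒜.ETangent k A} (hz : ETangent.map 𝒜 hl A z = 0) :
    ∃ w, (S A ^ (l + 1)) w = z := by
  have hA : A ∈ 𝒜.jetDom k A.base := 𝒜.mem_dom A.base
  rw [𝒜.map_eq_zero_iff hl hA] at hz
  refine ⟨(𝒜.frameEquiv hA).symm ((lower F k)^[l + 1] (𝒜.frameEquiv hA z)),
    (𝒜.frameEquiv hA).injective ?_⟩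
  rw [hS.frameEquiv_pow_apply hA, LinearEquiv.apply_symm_apply, raise_lower_iterate _ _ hz]

/-- Only the last `l` frame coordinates of such a vector can be nonzero, and `l` shifts push all of
them past index `k`. -/
theorem IsVerticalEndomorphism.pow_apply_eq_zero (hS : 𝒜.IsVerticalEndomorphism k S) {l : ℕ}
    {A : 𝒜.JetSpace k} {z : 𝒜.ETangent k A} (hl : l ≤ k)
    (hz : ETangent.map 𝒜 (Nat.sub_le k l) A z = 0) : (S A ^ l) z = 0 := by
  have hA : A ∈ 𝒜.jetDom k A.base := 𝒜.mem_dom A.base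
  rw [𝒜.map_eq_zero_iff _ hA] at hz
  refine (𝒜.frameEquiv hA).injective ?_
  rw [hS.frameEquiv_pow_apply hA, map_zero]
  exact raise_iterate_eq_zero l _ fun i hi => hz i (by omega)

theorem IsVerticalEndomorphism.pow_eq_zero (hS : 𝒜.IsVerticalEndomorphism k S)
    (A : 𝒜.JetSpace k) : S A ^ (k + 1) = 0 := by
  have hA : A ∈ 𝒜.jetDom k A.base := 𝒜.mem_dom A.base
  refine LinearMap.ext fun z => (𝒜.frameEquiv hA).injective ?_
  rw [hS.frameEquiv_pow_apply hA, LinearMap.zero_apply, map_zero]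
  exact raise_iterate_eq_zero _ _ fun i hi => absurd hi (by omega)

/-- In each chart the power of `lower` is a left inverse of `S^l` modulo `ker 𝒯τ_{k,k-l}`, the only
error being in the last `l` frame coordinates. A semibasic form does not see the error. -/
theorem IsVerticalEndomorphism.map_frameEnd_pow_sub (hS : 𝒜.IsVerticalEndomorphism k S) {l : ℕ}
    (hl : l ≤ k) {x₀ : M} {A : 𝒜.JetSpace k} (hA : A ∈ 𝒜.jetDom k x₀) (z : 𝒜.ETangent k A) :
    ETangent.map 𝒜 (Nat.sub_le k l) A
      (𝒜.frameEnd x₀ (lower F k ^ l) A ((S A ^ l) z) - z) = 0 := by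
  rw [𝒜.map_eq_zero_iff _ hA]
  intro i hi
  rw [map_sub, Pi.sub_apply, 𝒜.frameEquiv_frameEnd _ hA, hS.frameEquiv_pow_apply hA,
    FunLike.coe_pow_eq_iterate, lower_raise_iterate _ _ _ (by omega), sub_self]

end

/-! ### Gluing of local endomorphism fields -/

/-- Unlike the weighted shift, a general `L` (such as the backward shift) gives different
endomorphisms in different charts. Averaging them by a partition of unity on `M` is enough, since an
affine condition on the value of a covector survives weights with sum one. -/
theorem exists_glued_frameEnd [SecondCountableTopology M] {k : ℕ}
    (L : (Fin (k + 1) → F) →L[ℝ] (Fin (k + 1) → F)) :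
    ∃ N : ∀ A : 𝒜.JetSpace k, Module.End ℝ (𝒜.ETangent k A),
      (∀ Z, 𝒜.IsSmoothSection k Z → 𝒜.IsSmoothSection k fun A => N A (Z A)) ∧
      ∀ (A : 𝒜.JetSpace k) (mu : Module.Dual ℝ (𝒜.ETangent k A)) (z : 𝒜.ETangent k A) (c : ℝ),
        (∀ x₀, A ∈ 𝒜.jetDom k x₀ → mu (𝒜.frameEnd x₀ L A z) = c) → mu (N A z) = c := by
  have : LocallyCompactSpace M := ChartedSpace.locallyCompactSpace EM M
  obtain ⟨ρ, hρ⟩ := SmoothPartitionOfUnity.exists_isSubordinate 𝓘(ℝ, EM) (isClosed_univ (X := M))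
    (fun x₀ : M => 𝒜.dom x₀) (fun x₀ => 𝒜.isOpen_dom x₀)
    (fun x _ => mem_iUnion.2 ⟨x, 𝒜.mem_dom x⟩)
  refine ⟨fun A => ∑ x₀ ∈ ρ.finsupport A.base, ρ x₀ A.base • 𝒜.frameEnd x₀ L A,
    fun Z hZ => ?_, fun A mu z c h => ?_⟩
  · refine (𝒜.isSmoothSection_iff _).2 fun A => ?_
    have hA : A ∈ 𝒜.jetDom k A.base := 𝒜.mem_dom A.base
    -- The index set of the defining sum varies with the point. Near `A` it may be replaced by the
    -- fixed finite set `fintsupport`, because the additional weights are zero.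
    have hev : ∀ᶠ B : 𝒜.JetSpace k in 𝓝 A,
        ρ.finsupport B.base ⊆ ρ.fintsupport A.base :=
      ((𝒜.contMDiff_proj k).continuous.tendsto A).eventually
        (ρ.eventually_finsupport_subset A.base)
    have hsum : 𝒜.IsSmoothSectionAt (fun B => ∑ x₀ ∈ ρ.fintsupport A.base,
        ρ x₀ B.base • 𝒜.frameEnd x₀ L B (Z B)) A := by
      rw [𝒜.isSmoothSectionAt_iff _ hA]
      simp only [map_sum, map_smul]
      refine ContMDiffAt.sum fun x₀ hx₀ => ?_
      -- Subordination concerns the closed supports, so `A` lies in the chart at `x₀` even if the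
      -- weight vanishes at `A` itself; smoothness of that summand at `A` needs this.
      have hA₀ : A ∈ 𝒜.jetDom k x₀ := hρ x₀ ((ρ.mem_fintsupport_iff A.base x₀).1 hx₀)
      have h1 : ContMDiffAt 𝓘(ℝ, EM × (Fin k → F)) 𝓘(ℝ, ℝ) ∞
          (fun B : 𝒜.JetSpace k => ρ x₀ B.base) A :=
        ((ρ x₀).contMDiff.comp (𝒜.contMDiff_proj k)).contMDiffAt
      exact h1.smul ((𝒜.isSmoothSectionAt_iff _ hA).1
        (𝒜.isSmoothSectionAt_frameEnd L hA₀ ((𝒜.isSmoothSection_iff Z).1 hZ A)))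
    refine hsum.congr ?_
    filter_upwards [hev] with B hB
    rw [LinearMap.sum_apply]
    simp only [LinearMap.smul_apply]
    refine Finset.sum_subset hB fun x₀ _ hx₀ => ?_
    have h1 : ρ x₀ B.base = 0 := by
      by_contra h2
      exact hx₀ ((ρ.mem_finsupport B.base).2 h2)
    rw [h1, zero_smul]
  · have h1 : ∀ x₀ ∈ ρ.finsupport A.base, ρ x₀ A.base * mu (𝒜.frameEnd x₀ L A z) =
        ρ x₀ A.base * c := by
      intro x₀ hx₀
      rw [h x₀ (hρ x₀ (subset_tsupport _ ((ρ.mem_finsupport A.base).1 hx₀)))]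
    rw [LinearMap.sum_apply, map_sum]
    simp only [LinearMap.smul_apply, map_smul, smul_eq_mul]
    rw [Finset.sum_congr rfl h1, ← Finset.sum_mul, ρ.sum_finsupport _ (mem_univ _), one_mul]

end

end LieAlgebroid

/-! ### The main theorem -/

theorem mainTheorem9 {EM F M : Type*} {V : M → Type*}
    [NormedAddCommGroup EM] [NormedSpace ℝ EM] [FiniteDimensional ℝ EM]
    [NormedAddCommGroup F] [NormedSpace ℝ F] [FiniteDimensional ℝ F]
    [TopologicalSpace M] [T2Space M] [SecondCountableTopology M]
    [ChartedSpace EM M] [IsManifold 𝓘(ℝ, EM) ∞ M]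
    [TopologicalSpace (TotalSpace F V)] [∀ x, TopologicalSpace (V x)] [FiberBundle F V]
    [∀ x, AddCommGroup (V x)] [∀ x, Module ℝ (V x)] [VectorBundle ℝ F V]
    [ContMDiffVectorBundle ∞ F V 𝓘(ℝ, EM)]
    (𝒜 : LieAlgebroid EM F V) (k : ℕ) :
    (∃! S, 𝒜.IsVerticalEndomorphism k S) ∧
    ∀ S, 𝒜.IsVerticalEndomorphism k S →
      (∀ (l : ℕ) (hl : l ≤ k) (lam : 𝒜.OneForm k), 𝒜.IsSmoothForm lam →
        (𝒜.IsSemibasic hl lam ↔ (𝒜.dualAction S)^[l + 1] lam = 0)) ∧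
      (∀ l : ℕ, l ≤ k →
        (𝒜.dualAction S)^[l] '' {lam | 𝒜.IsSmoothForm lam} =
          {lam | 𝒜.IsSmoothForm lam ∧ 𝒜.IsSemibasic (Nat.sub_le k l) lam}) ∧
      (∀ A : 𝒜.JetSpace k, (S A) ^ (k + 1) = 0) := by
  obtain ⟨S₀, hS₀⟩ := 𝒜.exists_vertical (k := k)
  refine ⟨⟨S₀, hS₀, fun S hS => hS.unique hS₀⟩, fun S hS => ⟨?_, ?_, hS.pow_eq_zero⟩⟩
  · intro l hl lam _
    constructor
    · intro h
      funext A
      refine LinearMap.ext fun z => ?_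
      rw [LieAlgebroid.dualAction_iterate]
      exact h A _ (hS.map_pow_apply hl A z)
    · intro h A z hz
      -- The kernel of `𝒯τ_{k,l}` is contained in the image of `S^(l+1)`, so a form killed by the
      -- dual power vanishes on that kernel.
      obtain ⟨w, rfl⟩ := hS.exists_pow_apply_eq hl hz
      rw [← LieAlgebroid.dualAction_iterate, h]
      rfl
  · intro l hl
    ext mu
    constructor
    · rintro ⟨lam, hlam, rfl⟩
      refine ⟨hS.isSmoothForm_iterate l hlam, fun A z hz => ?_⟩
      rw [LieAlgebroid.dualAction_iterate, hS.pow_apply_eq_zero hl hz, map_zero]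
    · rintro ⟨hmu, hsb⟩
      obtain ⟨N, hN, hNc⟩ := 𝒜.exists_glued_frameEnd (JetCalculus.lower F k ^ l)
      -- The preimage is `μ ∘ N`, where `N` glues the local left inverses of `S^l`; it is smooth
      -- because `N` preserves smooth sections.
      refine ⟨fun A => (mu A).comp (N A), fun Z hZ => hmu _ (hN Z hZ), ?_⟩
      funext A
      refine LinearMap.ext fun z => ?_
      rw [LieAlgebroid.dualAction_iterate]
      -- It suffices that each local inverse reproduces `μ(z)` from `S^l z`. This holds because the
      -- discrepancy lies in `ker 𝒯τ_{k,k-l}`, on which `μ` vanishes.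
      refine hNc A (mu A) _ _ fun x₀ hA => ?_
      have h1 := hsb A _ (hS.map_frameEnd_pow_sub hl hA z)
      rwa [map_sub, sub_eq_zero] at h1
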